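/- Let $\Bbbk$ be a commutative ring and $X$ a simplicial set. All chains are normalized. **Notation.** Let $Z(X)\supseteq X$ be the simplicial set obtained by freely adding, for every nondegenerate edge $e$ of $X$, an edge $e^{op}$ with $\partial_0e^{op}=\partial_1e$, $\partial_1e^{op}=\partial_0e$; put $(e^{op})^{op}=e$. Write $\min\sigma$, $\max\sigma$ for the first and last vertex of a simplex $\sigma$, $\sigma_{i\ldots j}$ for its face on the vertices $i,\ldots,j$, and $|\bar\sigma|=\dim\sigma-1$ if $\dim\sigma\ge1$. A *word* from $a$ to $b$ is a sequence $y=\bar\sigma_1\cdots\bar\sigma_r$, $r\ge1$, of simplices $\sigma_j$ of $Z(X)$ of positive dimension with $\min\sigma_1=a$, $\max\sigma_j=\min\sigma_{j+1}$, $\max\sigma_r=b$; its degree is $|y|=\sum_j|\bar\sigma_j|$. **The closed necklical set.** $\widehat{\mathbf\Lambda}_nX$ is the set of pairs $(x,y)$, where $x$ is a $p$-simplex of $X$ and $y$ a word from $\max x$ to $\min x$ with $p+|y|=n$, modulo the equivalence relation generated by: (a) a letter $\overline{s_0v}$, $v$ a vertex, may be deleted from $y$ if $y$ has another letter; (b)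 $\bar a\,\overline{a^{op}}$ may be replaced by $\overline{s_0(\min a)}$; (c) for cyclically consecutive beads $\sigma,\tau$ of $(x,\sigma_1,\ldots,\sigma_r)$, the last degeneracy of $\sigma$ may be replaced by the first degeneracy of $\tau$ (e.g. $(s_px,y)\sim(x,\eta_1y)$). For $n\geq 1$ the face operators are, with $p=\dim x$, - $d^0_i(x,y)=(x_{0\ldots i-1},\ \overline{x_{i-1\ldots p}}\cdot y)$ for $1\le i\le p$, and for $p<i\le n$ it splits a letter $\bar\sigma$ of $y$ at an inner vertex $l$ into $\overline{\sigma_{0\ldots l}}\,\overline{\sigma_{l\ldots\dim\sigma}}$; - $d^1_i(x,y)=(\partial_{i-1}x,y)$ for $2\le i\le p$, $d^1_1=d^2_1$ if $p\ge1$, and for $p<i\le n$ it replaces a letter $\bar\sigma$ of $y$ by $\overline{\partial_l\sigma}$ for an inner vertex $l$; - $d^2_i(x,y)=(x_{i\ldots p},\ y\cdot\overline{x_{0\ldots i}})$ for $1\le i\le p$. Here $i=p+1,\ldots,n$ runs in order through the inner vertices of the letters of $y$. $C_n(\widehat{\mathbf\Lambda}X)$ is the free $\Bbbk$-module on $\widehat{\mathbf\Lambda}_nX$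 modulo the classes of all $(x,y)$ such that $x$ is degenerate or a letter of $y$ of dimension at least $2$ is degenerate, and $$d(x,y)=\sum_{i=1}^{n}(-1)^i(d^0_i-d^1_i)(x,y)+\sum_{i=2}^{p}(-1)^{(i-1)n}d^2_i(x,y).$$ **The hat-coHochschild complex.** The hat-cobar construction is the graded $\Bbbk$-linear category $\widehat\Omega(a,b)$ on the vertices, spanned by words $[\bar\sigma_1|\cdots|\bar\sigma_r]$ from $a$ to $b$, freely generated by the nondegenerate simplices of $Z(X)$ of positive dimension modulo $[\bar a|\overline{a^{op}}]=1$; for a degenerate $\sigma$ one puts $[\bar\sigma]=1$ if $\dim\sigma=1$ and $[\bar\sigma]=0$ if $\dim\sigma\ge2$. Its differential is the graded derivation with $$d_{\widehat\Omega}[\bar\sigma]=-\sum_{0<i<m}(-1)^i[\overline{\partial_i\sigma}]+\sum_{0<i<m}(-1)^i[\overline{\sigma_{0\ldots i}}|\overline{\sigma_{i\ldots m}}],\qquad m=\dim\sigma.$$ Let $C_*(X)(a,b)\subseteq C_*(X)$ be spanned by the simplices from $a$ to $b$. The hat-coHochschild complex is $$\widehat\Lambda C_*(X)=\bigoplus_{a,b\in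 X_0}C_*(X)(a,b)\otimes\widehat\Omega(b,a)$$ (which is $C_*(X)\otimes\widehat\Omega(x_0,x_0)$ if $X_0=\{x_0\}$) with $d=d_C\otimes1+1\otimes d_{\widehat\Omega}+\theta_1+\theta_2$, where, for $x$ of dimension $p$, $d_Cx=\sum_{0<i<p}(-1)^i\partial_ix$ is the truncated differential, $(1\otimes d_{\widehat\Omega})(x\otimes w)=(-1)^{p}x\otimes d_{\widehat\Omega}w$, and $$\theta_1(x\otimes w)=-\sum_{0\le i<p}(-1)^i\,x_{0\ldots i}\otimes[\overline{x_{i\ldots p}}]\,w,\qquad \theta_2(x\otimes w)=\sum_{0<i\le p}(-1)^{(i+1)(p-i+|w|)}\,x_{i\ldots p}\otimes w\,[\overline{x_{0\ldots i}}].$$ **Theorem.** The formula for $d$ is well defined on $C_*(\widehat{\mathbf\Lambda}X)$ (it holds for every representative $(x,y)$), and $(C_*(\widehat{\mathbf\Lambda}X),d)$ and $\widehat\Lambda C_*(X)$ are chain complexes. They coincide: there is an isomorphism of chain complexes $$C_*(\widehat{\mathbf\Lambda}X)\;\cong\;\widehat\Lambda C_*(X),\qquad (x,\bar\sigma_1\cdots\bar\sigma_r)\longmapsto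 x\otimes[\bar\sigma_1|\cdots|\bar\sigma_r].$$ -/

import Mathlib

universe u v

noncomputable section

namespace HatNecklical

open CategoryTheory Opposite

/-! ### Simplices, their vertices, front and back faces -/

section Simplices

open Simplicial

/-- The vertices of a simplicial set. -/
abbrev Vert (X : SSet.{u}) : Type u := X _⦋0⦌

variable {X : SSet.{u}}

/-- The `j`-th vertex of a simplex. -/
def vertex (s : X.S) (j : Fin (s.dim + 1)) : Vert X :=
  X.map (SimplexCategory.const ⦋0⦌ ⦋s.dim⦌ j).op s.simplex

/-- The first vertex `min s`. -/
def minV (s : X.S) : Vert X := vertex s 0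

/-- The last vertex `max s`. -/
def maxV (s : X.S) : Vert X := vertex s (Fin.last s.dim)

/-- The front face of `s`, on the vertices `0, …, i`. -/
def front (s : X.S) (i : Fin (s.dim + 1)) : X.S :=
  SSet.S.mk (X.map (SimplexCategory.subinterval (n := s.dim) 0 i.1 (by omega)).op s.simplex)

/-- The back face of `s`, on the vertices `i, …, dim s`. -/
def back (s : X.S) (i : Fin (s.dim + 1)) : X.S :=
  SSet.S.mk
    (X.map (SimplexCategory.subinterval (n := s.dim) i.1 (s.dim - i.1) (by omega)).op s.simplex)

/-- The face `∂ᵢ s`, which omits the vertex `i` (for a vertex `s`, a dummy value). -/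
def del (s : X.S) (i : Fin (s.dim + 1)) : X.S :=
  match s, i with
  | @SSet.S.mk _ 0 x, _ => SSet.S.mk x
  | @SSet.S.mk _ (_ + 1) x, i => SSet.S.mk (X.δ i x)

/-- The degenerate simplex `sᵢ s`, which repeats the vertex `i`. -/
def dgn (s : X.S) (i : Fin (s.dim + 1)) : X.S := SSet.S.mk (X.σ i s.simplex)

/-- The degenerate edge `s₀ v` at a vertex `v`. -/
def unitEdge (v : Vert X) : X.S := dgn (SSet.S.mk v) 0

@[simp] lemma front_dim (s : X.S) (i : Fin (s.dim + 1)) : (front s i).dim = i.1 := rfl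

@[simp] lemma back_dim (s : X.S) (i : Fin (s.dim + 1)) : (back s i).dim = s.dim - i.1 := rfl

@[simp] lemma del_dim (s : X.S) (i : Fin (s.dim + 1)) : (del s i).dim = s.dim - 1 := by
  rcases s with @⟨_ | n, x⟩ <;> rfl

lemma vertex_map {m : ℕ} (s : X.S) (f : ⦋m⦌ ⟶ ⦋s.dim⦌) (j : Fin (m + 1)) :
    vertex (SSet.S.mk (X.map f.op s.simplex)) j = vertex s (f.toOrderHom j) := by
  simp only [vertex]
  rw [← ConcreteCategory.comp_apply, ← X.map_comp, ← op_comp]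
  rfl

lemma minV_front (s : X.S) (i : Fin (s.dim + 1)) : minV (front s i) = minV s := by
  refine (vertex_map s _ _).trans (congrArg (vertex s) (Fin.ext ?_))
  simp [SimplexCategory.subinterval]

lemma maxV_front (s : X.S) (i : Fin (s.dim + 1)) : maxV (front s i) = vertex s i := by
  refine (vertex_map s _ _).trans (congrArg (vertex s) (Fin.ext ?_))
  simp [SimplexCategory.subinterval]

lemma minV_back (s : X.S) (i : Fin (s.dim + 1)) : minV (back s i) = vertex s i :=
  (vertex_map s _ _).trans (congrArg (vertex s) (Fin.ext (Nat.zero_add i.1)))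

lemma maxV_back (s : X.S) (i : Fin (s.dim + 1)) : maxV (back s i) = maxV s :=
  (vertex_map s _ _).trans
    (congrArg (vertex s) (Fin.ext (Nat.sub_add_cancel (Nat.le_of_lt_succ i.2))))

lemma minV_del (s : X.S) (i : Fin (s.dim + 1)) (h : 0 < i.1) : minV (del s i) = minV s := by
  rcases s with @⟨_ | n, x⟩
  · rfl
  · refine (vertex_map (SSet.S.mk x) (SimplexCategory.δ i) _).trans
      (congrArg (vertex (SSet.S.mk x)) ?_)
    exact Fin.succAbove_ne_zero_zero (Fin.pos_iff_ne_zero.1 h)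

lemma maxV_del (s : X.S) (i : Fin (s.dim + 1)) (h : i.1 < s.dim) : maxV (del s i) = maxV s := by
  rcases s with @⟨_ | n, x⟩
  · rfl
  · refine (vertex_map (SSet.S.mk x) (SimplexCategory.δ i) _).trans
      (congrArg (vertex (SSet.S.mk x)) ?_)
    refine Fin.succAbove_ne_last_last (fun h' => ?_)
    have h1 : i.1 = n + 1 := congrArg Fin.val h'
    exact absurd h (by rw [h1]; exact lt_irrefl _)

lemma vertex_image {Y : SSet.{u}} (f : X ⟶ Y) (s : X.S) (j : Fin (s.dim + 1)) :
    vertex (SSet.S.map f s) j = f.app _ (vertex s j) :=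
  (ConcreteCategory.congr_hom
    (f.naturality (SimplexCategory.const ⦋0⦌ ⦋s.dim⦌ j).op) s.simplex).symm

end Simplices

/-! ### Formally inverting the nondegenerate edges -/

/-- The `n`-simplices of `Z(X)`: those of `X`, and, for every nondegenerate edge `e` of `X`, the
surjective monotone maps `[n] → [1]`, that is, the simplices of the added edge `eᵒᵖ` which do not lie
in its end points. -/
inductive ZObj (X : SSet.{u}) (n : SimplexCategoryᵒᵖ) : Type u
  | old (x : X.obj n) : ZObj X n
  | added (e : X.nonDegenerate 1) (f : n.unop ⟶ SimplexCategory.mk 1)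
      (hf : Function.Surjective f.toOrderHom) : ZObj X n

section Invert

open Simplicial

variable {X : SSet.{u}}

open Classical in
/-- The simplex `f : [n] → [1]` of the added edge `eᵒᵖ`. If `f` is constant, it is a degenerate
vertex; the vertex `0` of `eᵒᵖ` is the vertex `1` of `e`, and the vertex `1` of `eᵒᵖ` is the
vertex `0` of `e`. -/
def addedSimplex (e : X.nonDegenerate 1) {n : SimplexCategoryᵒᵖ} (f : n.unop ⟶ ⦋1⦌) : ZObj X n :=
  if h : Function.Surjective f.toOrderHom then ZObj.added e f h
  else ZObj.old (X.map (SimplexCategory.const n.unop ⦋1⦌ (Fin.rev (f.toOrderHom 0))).op e.1)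

/-- The simplicial operators of `Z(X)`. -/
def ZMap {m n : SimplexCategoryᵒᵖ} (θ : m ⟶ n) (z : ZObj X m) : ZObj X n :=
  match z with
  | ZObj.old x => ZObj.old (X.map θ x)
  | ZObj.added e f _ => addedSimplex e (θ.unop ≫ f)

lemma const_of_not_surjective {n : SimplexCategory} (f : n ⟶ ⦋1⦌)
    (h : ¬ Function.Surjective f.toOrderHom) (t : Fin (n.len + 1)) :
    f.toOrderHom t = f.toOrderHom 0 := by
  by_contra hne
  apply h
  intro b
  have h1 : ∀ a c b : Fin 2, a ≠ c → b = a ∨ b = c := by decide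
  rcases h1 _ _ b hne with hb | hb
  · exact ⟨t, hb.symm⟩
  · exact ⟨0, hb.symm⟩

lemma ZMap_addedSimplex {m n : SimplexCategoryᵒᵖ} (θ : m ⟶ n) (e : X.nonDegenerate 1)
    (f : m.unop ⟶ ⦋1⦌) : ZMap θ (addedSimplex e f) = addedSimplex e (θ.unop ≫ f) := by
  by_cases h : Function.Surjective f.toOrderHom
  · rw [addedSimplex, dif_pos h, ZMap]
  · have h' : ¬ Function.Surjective (θ.unop ≫ f).toOrderHom := by
      intro hs
      apply h
      intro b
      obtain ⟨a, ha⟩ := hs b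
      exact ⟨θ.unop.toOrderHom a, ha⟩
    have hc : (θ.unop ≫ f).toOrderHom 0 = f.toOrderHom 0 :=
      const_of_not_surjective f h (θ.unop.toOrderHom 0)
    rw [addedSimplex, dif_neg h, addedSimplex, dif_neg h', ZMap, hc,
      ← ConcreteCategory.comp_apply, ← X.map_comp]
    rfl

lemma ZMap_id (n : SimplexCategoryᵒᵖ) (z : ZObj X n) : ZMap (𝟙 n) z = z := by
  rcases z with x | ⟨e, f, hf⟩
  · simp [ZMap]
  · rw [ZMap, unop_id, Category.id_comp, addedSimplex, dif_pos hf]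

lemma ZMap_comp {l m n : SimplexCategoryᵒᵖ} (θ : l ⟶ m) (φ : m ⟶ n) (z : ZObj X l) :
    ZMap (θ ≫ φ) z = ZMap φ (ZMap θ z) := by
  rcases z with x | ⟨e, f, hf⟩
  · simp [ZMap]
  · change addedSimplex e ((θ ≫ φ).unop ≫ f) = ZMap φ (addedSimplex e (θ.unop ≫ f))
    rw [ZMap_addedSimplex, unop_comp, Category.assoc]

variable (X)

/-- The simplicial set `Z(X)`, obtained from `X` by adding freely, for every nondegenerate edge `e`,
an edge `eᵒᵖ` with `∂₀ eᵒᵖ = ∂₁ e` and `∂₁ eᵒᵖ = ∂₀ e`. -/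
def Z : SSet.{u} where
  obj n := ZObj X n
  map θ := ↾(ZMap θ)
  map_id n := by ext z; exact ZMap_id n z
  map_comp θ φ := by ext z; exact ZMap_comp θ φ z

/-- The inclusion of `X` in `Z(X)`. -/
def inclZ : X ⟶ Z X where
  app n := ↾(fun x => (ZObj.old x : ZObj X n))
  naturality _ _ _ := rfl

variable {X}

/-- A vertex of `X`, as a vertex of `Z(X)`. -/
def inclV (v : Vert X) : Vert (Z X) := (inclZ X).app _ v

/-- A nondegenerate edge of `X`, as an edge of `Z(X)`. -/
def edge (e : X.nonDegenerate 1) : (Z X).S := SSet.S.map (inclZ X) (SSet.S.mk e.1)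

/-- The added edge `eᵒᵖ` of `Z(X)`. -/
def opEdge (e : X.nonDegenerate 1) : (Z X).S :=
  @SSet.S.mk (Z X) 1 (show ZObj X (op ⦋1⦌) from ZObj.added e (𝟙 ⦋1⦌) (fun b => ⟨b, rfl⟩))

end Invert

/-- `OpPair a b` means that `b = aᵒᵖ`, where `(eᵒᵖ)ᵒᵖ = e`. -/
inductive OpPair {X : SSet.{u}} : (Z X).S → (Z X).S → Prop
  | edge_op (e : X.nonDegenerate 1) : OpPair (edge e) (opEdge e)
  | op_edge (e : X.nonDegenerate 1) : OpPair (opEdge e) (edge e)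

/-! ### Words of simplices -/

section Words

variable {Y : SSet.{u}}

/-- `IsPath a w b`: the word `w` consists of simplices of positive dimension, the last vertex of
each one is the first vertex of the next one, and `w` leads from the vertex `a` to the vertex
`b`. -/
def IsPath (a : Vert Y) (w : List Y.S) (b : Vert Y) : Prop :=
  match w with
  | [] => a = b
  | s :: w => 0 < s.dim ∧ minV s = a ∧ IsPath (maxV s) w b

/-- The degree of a word, where a simplex `s` contributes `dim s - 1`. -/
def wordDeg (w : List Y.S) : ℕ := (w.map fun s => s.dim - 1).sum

/-- The operator `d⁰ᵢ` on words: it splits a simplex into a front and a back face. The positions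
`1, …, wordDeg w` run through the inner vertices of the simplices of `w`. -/
def wordSplit (w : List Y.S) (i : ℕ) : List Y.S :=
  match w with
  | [] => []
  | s :: w =>
    if h : i < s.dim then front s ⟨i, by omega⟩ :: back s ⟨i, by omega⟩ :: w
    else s :: wordSplit w (i - (s.dim - 1))

/-- The operator `d¹ᵢ` on words: it omits an inner vertex of a simplex. -/
def wordDel (w : List Y.S) (i : ℕ) : List Y.S :=
  match w with
  | [] => []
  | s :: w =>
    if h : i < s.dim then del s ⟨i, by omega⟩ :: w else s :: wordDel w (i - (s.dim - 1))

lemma wordDeg_cons (s : Y.S) (w : List Y.S) : wordDeg (s :: w) = (s.dim - 1) + wordDeg w := rfl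

lemma wordDeg_append (w w' : List Y.S) : wordDeg (w ++ w') = wordDeg w + wordDeg w' := by
  simp [wordDeg]

lemma isPath_append {a b : Vert Y} {w : List Y.S} {s : Y.S} (h : IsPath a w (minV s))
    (hs : 0 < s.dim) (hb : maxV s = b) : IsPath a (w ++ [s]) b := by
  induction w generalizing a with
  | nil => exact ⟨hs, h.symm, hb⟩
  | cons t w ih => exact ⟨h.1, h.2.1, ih h.2.2⟩

lemma isPath_wordSplit {a b : Vert Y} {w : List Y.S} (h : IsPath a w b) {i : ℕ} (hi : 0 < i) :
    IsPath a (wordSplit w i) b := by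
  induction w generalizing a i with
  | nil => exact h
  | cons s w ih =>
    obtain ⟨h0, h1, h2⟩ := h
    rw [wordSplit]
    split_ifs with hs
    · refine ⟨hi, (minV_front s _).trans h1, ?_, ?_, ?_⟩
      · exact Nat.sub_pos_of_lt hs
      · rw [minV_back, maxV_front]
      · rw [maxV_back]; exact h2
    · exact ⟨h0, h1, ih h2 (by omega)⟩

lemma isPath_wordDel {a b : Vert Y} {w : List Y.S} (h : IsPath a w b) {i : ℕ} (hi : 0 < i) :
    IsPath a (wordDel w i) b := by
  induction w generalizing a i with
  | nil => exact h
  | cons s w ih =>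
    obtain ⟨h0, h1, h2⟩ := h
    rw [wordDel]
    split_ifs with hs
    · refine ⟨?_, (minV_del s _ hi).trans h1, ?_⟩
      · rw [del_dim]; omega
      · rw [maxV_del s _ hs]; exact h2
    · exact ⟨h0, h1, ih h2 (by omega)⟩

lemma wordDeg_wordSplit (w : List Y.S) {i : ℕ} (hi : 0 < i) (hw : i ≤ wordDeg w) :
    wordDeg (wordSplit w i) + 1 = wordDeg w := by
  induction w generalizing i with
  | nil => simp [wordDeg] at hw; omega
  | cons s w ih =>
    rw [wordDeg_cons] at hw ⊢
    rw [wordSplit]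
    split_ifs with hs
    · simp only [wordDeg_cons, front_dim, back_dim]; omega
    · have := ih (i := i - (s.dim - 1)) (by omega) (by omega)
      rw [wordDeg_cons]; omega

lemma wordDeg_wordDel (w : List Y.S) {i : ℕ} (hi : 0 < i) (hw : i ≤ wordDeg w) :
    wordDeg (wordDel w i) + 1 = wordDeg w := by
  induction w generalizing i with
  | nil => simp [wordDeg] at hw; omega
  | cons s w ih =>
    rw [wordDeg_cons] at hw ⊢
    rw [wordDel]
    split_ifs with hs
    · simp only [wordDeg_cons, del_dim]; omega
    · have := ih (i := i - (s.dim - 1)) (by omega) (by omega)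
      rw [wordDeg_cons]; omega

lemma wordSplit_ne_nil {w : List Y.S} (hw : w ≠ []) (i : ℕ) : wordSplit w i ≠ [] := by
  cases w with
  | nil => exact absurd rfl hw
  | cons s w => rw [wordSplit]; split_ifs <;> simp

lemma wordDel_ne_nil {w : List Y.S} (hw : w ≠ []) (i : ℕ) : wordDel w i ≠ [] := by
  cases w with
  | nil => exact absurd rfl hw
  | cons s w => rw [wordDel]; split_ifs <;> simp

lemma wordSplit_append (u w : List Y.S) {i : ℕ} (hi : 0 < i) :
    wordSplit (u ++ w) i = if i ≤ wordDeg u then wordSplit u i ++ w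
      else u ++ wordSplit w (i - wordDeg u) := by
  induction u generalizing i with
  | nil =>
    have h0 : wordDeg ([] : List Y.S) = 0 := rfl
    rw [if_neg (by omega)]; rfl
  | cons s u ih =>
    rw [List.cons_append, wordSplit, wordSplit, wordDeg_cons]
    by_cases hs : i < s.dim
    · rw [dif_pos hs, dif_pos hs, if_pos (by omega)]; rfl
    · rw [dif_neg hs, dif_neg hs, ih (by omega)]
      by_cases h : i - (s.dim - 1) ≤ wordDeg u
      · rw [if_pos h, if_pos (by omega)]; rfl
      · rw [if_neg h, if_neg (by omega), Nat.sub_sub]; rfl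

lemma wordDel_append (u w : List Y.S) {i : ℕ} (hi : 0 < i) :
    wordDel (u ++ w) i = if i ≤ wordDeg u then wordDel u i ++ w
      else u ++ wordDel w (i - wordDeg u) := by
  induction u generalizing i with
  | nil =>
    have h0 : wordDeg ([] : List Y.S) = 0 := rfl
    rw [if_neg (by omega)]; rfl
  | cons s u ih =>
    rw [List.cons_append, wordDel, wordDel, wordDeg_cons]
    by_cases hs : i < s.dim
    · rw [dif_pos hs, dif_pos hs, if_pos (by omega)]; rfl
    · rw [dif_neg hs, dif_neg hs, ih (by omega)]
      by_cases h : i - (s.dim - 1) ≤ wordDeg u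
      · rw [if_pos h, if_pos (by omega)]; rfl
      · rw [if_neg h, if_neg (by omega), Nat.sub_sub]; rfl

end Words

/-! ### The closed necklical set -/

/-- A closed necklace of dimension `n` in `X` with first bead in `X` and further beads in `Z(X)`:
a simplex `x` of `X` and a nonempty word of simplices of `Z(X)` of positive dimension which leads
from `max x` to `min x`. -/
structure ClosedNecklace (X : SSet.{u}) (n : ℕ) where
  /-- the first bead -/
  first : X.S
  /-- the other beads -/
  word : List (Z X).S
  word_ne : word ≠ []
  path : IsPath (inclV (maxV first)) word (inclV (minV first))
  deg_eq : first.dim + wordDeg word = n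

/-- The relations between closed necklaces: constant edges are deleted (if another bead remains
behind the first one), an edge followed by its formal inverse is replaced by a constant edge, and the
last degeneracy of a bead is the same as the first degeneracy of the bead that follows it in the
cyclic order. -/
inductive Rel {X : SSet.{u}} : X.S × List (Z X).S → X.S × List (Z X).S → Prop
  | unit (x : X.S) (u : List (Z X).S) (v : Vert (Z X)) (w : List (Z X).S) (h : u ++ w ≠ []) :
      Rel (x, u ++ [unitEdge v] ++ w) (x, u ++ w)
  | inv (x : X.S) (u : List (Z X).S) (a b : (Z X).S) (w : List (Z X).S) (h : OpPair a b) :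
      Rel (x, u ++ [a, b] ++ w) (x, u ++ [unitEdge (minV a)] ++ w)
  | slide (x : X.S) (u : List (Z X).S) (s t : (Z X).S) (w : List (Z X).S) :
      Rel (x, u ++ [dgn s (Fin.last _), t] ++ w) (x, u ++ [s, dgn t 0] ++ w)
  | slide_first (x : X.S) (s : (Z X).S) (w : List (Z X).S) :
      Rel (dgn x (Fin.last _), s :: w) (x, dgn s 0 :: w)
  | slide_last (x : X.S) (w : List (Z X).S) (s : (Z X).S) :
      Rel (x, w ++ [dgn s (Fin.last _)]) (dgn x 0, w ++ [s])

/-- The set of elements of dimension `n` of the closed necklical set associated with `X`. -/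
def LambdaHat (X : SSet.{u}) (n : ℕ) : Type u :=
  Quot fun r s : ClosedNecklace X n => Rel (r.first, r.word) (s.first, s.word)

namespace ClosedNecklace

variable {X : SSet.{u}} {n : ℕ}

/-- A simplex of `X`, as a simplex of `Z(X)`. -/
abbrev inclS (s : X.S) : (Z X).S := SSet.S.map (inclZ X) s

lemma minV_inclS (s : X.S) : minV (inclS s) = inclV (minV s) := vertex_image _ _ _

lemma maxV_inclS (s : X.S) : maxV (inclS s) = inclV (maxV s) := vertex_image _ _ _

/-- The class of a closed necklace in the closed necklical set. -/
def toLambda (r : ClosedNecklace X n) : LambdaHat X n := Quot.mk _ r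

/-- A closed necklace is degenerate if its first bead is a degenerate simplex, or if another bead is
a degenerate simplex of a simplex of positive dimension; these are the images of the degeneracy
operators. -/
def IsDegenerate (r : ClosedNecklace X n) : Prop :=
  r.first.simplex ∈ X.degenerate r.first.dim ∨
    ∃ s ∈ r.word, 2 ≤ s.dim ∧ s.simplex ∈ (Z X).degenerate s.dim

/-- The face operator `d⁰ᵢ₊₁`, with `0 ≤ i ≤ n`. If `i + 1 ≤ p = dim x`, it sends `(x, w)` to
`(x|0…i, x|i…p · w)`; otherwise it splits a bead of `w`. -/
def d0 (r : ClosedNecklace X (n + 1)) (i : Fin (n + 1)) : ClosedNecklace X n :=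
  if h : i.1 < r.first.dim then
    { first := front r.first ⟨i.1, by omega⟩
      word := inclS (back r.first ⟨i.1, by omega⟩) :: r.word
      word_ne := by simp
      path := by
        refine ⟨Nat.sub_pos_of_lt h, ?_, ?_⟩
        · rw [minV_inclS, minV_back, maxV_front]
        · rw [maxV_inclS, maxV_back, minV_front]; exact r.path
      deg_eq := by
        have := r.deg_eq
        change i.1 + ((r.first.dim - i.1 - 1) + wordDeg r.word) = n
        omega }
  else
    { first := r.first
      word := wordSplit r.word (i.1 + 1 - r.first.dim)
      word_ne := wordSplit_ne_nil r.word_ne _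
      path := isPath_wordSplit r.path (by omega)
      deg_eq := by
        have := r.deg_eq
        have := wordDeg_wordSplit r.word (i := i.1 + 1 - r.first.dim) (by omega) (by omega)
        omega }

/-- The face operator `d²ᵢ₊₁`, with `0 ≤ i < p = dim x`. It sends `(x, w)` to
`(x|i+1…p, w · x|0…i+1)`. -/
def d2 (r : ClosedNecklace X (n + 1)) (i : Fin r.first.dim) : ClosedNecklace X n where
  first := back r.first i.succ
  word := r.word ++ [inclS (front r.first i.succ)]
  word_ne := by simp
  path := by
    refine isPath_append ?_ (Nat.succ_pos _) ?_
    · rw [minV_inclS, minV_front, maxV_back]; exact r.path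
    · rw [maxV_inclS, maxV_front, minV_back]
  deg_eq := by
    have := r.deg_eq
    rw [wordDeg_append]
    change (r.first.dim - (i.1 + 1)) + (wordDeg r.word + ((i.1 + 1) - 1 + 0)) = n
    omega

/-- The face operator `d¹ᵢ₊₁`, with `0 ≤ i ≤ n`. If `1 ≤ i < p = dim x`, it sends `(x, w)` to
`(∂ᵢ x, w)`; if `p ≤ i`, it omits an inner vertex of a bead of `w`; and `d¹₁ = d²₁` if `0 < p`. -/
def d1 (r : ClosedNecklace X (n + 1)) (i : Fin (n + 1)) : ClosedNecklace X n :=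
  if h : i.1 < r.first.dim then
    if h0 : i.1 = 0 then d2 r ⟨0, by omega⟩
    else
      { first := del r.first ⟨i.1, by omega⟩
        word := r.word
        word_ne := r.word_ne
        path := by
          rw [minV_del _ _ (Nat.pos_of_ne_zero h0), maxV_del _ _ h]; exact r.path
        deg_eq := by
          have := r.deg_eq
          rw [del_dim]
          omega }
  else
    { first := r.first
      word := wordDel r.word (i.1 + 1 - r.first.dim)
      word_ne := wordDel_ne_nil r.word_ne _
      path := isPath_wordDel r.path (by omega)
      deg_eq := by
        have := r.deg_eq
        have := wordDeg_wordDel r.word (i := i.1 + 1 - r.first.dim) (by omega) (by omega)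
        omega }

end ClosedNecklace

/-! ### The normalized chain complex of the closed necklical set -/

section Chains

variable (k : Type v) [CommRing k] (X : SSet.{u}) (n : ℕ)

/-- The span of the degenerate elements in the free module on the elements of dimension `n`. -/
def degenerateChains : Submodule k (LambdaHat X n →₀ k) :=
  Submodule.span k
    {z | ∃ r : ClosedNecklace X n, r.IsDegenerate ∧ z = Finsupp.single r.toLambda 1}

/-- The normalized chains of degree `n` of the closed necklical set: the free module on its
elements of dimension `n`, modulo the degenerate ones. -/
abbrev Chains : Type (max u v) := (LambdaHat X n →₀ k) ⧸ degenerateChains k X n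

variable {X n}

/-- The normalized chain represented by a closed necklace. -/
def cls (r : ClosedNecklace X n) : Chains k X n :=
  (degenerateChains k X n).mkQ (Finsupp.single r.toLambda 1)

/-- The alternating sum `∑ᵢ (-1)ⁱ (d⁰ᵢ - d¹ᵢ) + ∑ᵢ (-1)^((i-1)m) d²ᵢ` of faces, where `i` runs
through `1, …, m` in the first sum and through `2, …, p` in the second one; here `m = n + 1` is the
dimension of the closed necklace and `p` is the dimension of its first bead. (The indices `i` below
are smaller by one.) -/
def faceSum (r : ClosedNecklace X (n + 1)) : Chains k X n :=
  ∑ i : Fin (n + 1), (-1 : k) ^ (i.1 + 1) • (cls k (r.d0 i) - cls k (r.d1 i)) +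
    ∑ i : Fin r.first.dim with 0 < i.1, (-1 : k) ^ (i.1 * (n + 1)) • cls k (r.d2 i)

lemma cls_eq {r s : ClosedNecklace X n} (h : Rel (r.first, r.word) (s.first, s.word)) :
    cls k r = cls k s :=
  congrArg (fun c => (degenerateChains k X n).mkQ (Finsupp.single c 1)) (Quot.sound h)

/-- Replacing a part of degree zero of the word replaces the same part in all the faces. -/
lemma faceSum_eq_of_middle (m m' : List (Z X).S) (c : Prop)
    (hR : ∀ (x : X.S) (u w : List (Z X).S),
      u ++ w ≠ [] ∨ c → Rel (x, u ++ m ++ w) (x, u ++ m' ++ w))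
    (x : X.S) (u w : List (Z X).S)
    (hc : u ++ w ≠ [] ∨ c) (r r' : ClosedNecklace X (n + 1)) (hx : r.first = x)
    (hx' : r'.first = x) (hw : r.word = u ++ m ++ w) (hw' : r'.word = u ++ m' ++ w)
    (hs : ∀ i, 0 < i → wordSplit (m ++ w) i = m ++ wordSplit w i)
    (hs' : ∀ i, 0 < i → wordSplit (m' ++ w) i = m' ++ wordSplit w i)
    (hd : ∀ i, 0 < i → wordDel (m ++ w) i = m ++ wordDel w i)
    (hd' : ∀ i, 0 < i → wordDel (m' ++ w) i = m' ++ wordDel w i) :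
    faceSum k r = faceSum k r' := by
  obtain ⟨y, _, h1, h2, h3⟩ := r
  obtain ⟨_, _, h1', h2', h3'⟩ := r'
  dsimp only at hx hx' hw hw'
  subst hx' hx hw hw'
  have key2 : ∀ i, cls k (ClosedNecklace.d2 ⟨y, u ++ m ++ w, h1, h2, h3⟩ i) =
      cls k (ClosedNecklace.d2 ⟨y, u ++ m' ++ w, h1', h2', h3'⟩ i) := by
    intro i
    refine cls_eq k ?_
    simp only [ClosedNecklace.d2, List.append_assoc]
    simpa only [List.append_assoc] using hR _ u (w ++ [_]) (Or.inl (by simp))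
  have key0 : ∀ i, cls k (ClosedNecklace.d0 ⟨y, u ++ m ++ w, h1, h2, h3⟩ i) =
      cls k (ClosedNecklace.d0 ⟨y, u ++ m' ++ w, h1', h2', h3'⟩ i) := by
    intro i
    refine cls_eq k ?_
    by_cases h : i.1 < y.dim
    · simp only [ClosedNecklace.d0, dif_pos h]
      exact hR _ (_ :: u) w (Or.inl (by simp))
    · simp only [ClosedNecklace.d0, dif_neg h, List.append_assoc]
      have hi : 0 < i.1 + 1 - y.dim := by omega
      rw [wordSplit_append u (m ++ w) hi, wordSplit_append u (m' ++ w) hi]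
      by_cases h' : i.1 + 1 - y.dim ≤ wordDeg u
      · rw [if_pos h', if_pos h', ← List.append_assoc, ← List.append_assoc]
        refine hR _ _ _ (Or.inl ?_)
        have : u ≠ [] := by
          rintro rfl
          change _ ≤ 0 at h'
          omega
        simp [wordSplit_ne_nil this]
      · rw [if_neg h', if_neg h', hs _ (by omega), hs' _ (by omega), ← List.append_assoc,
          ← List.append_assoc]
        refine hR _ _ _ (hc.imp_left fun hne => ?_)
        by_cases hwn : w = []
        · subst hwn
          simp only [List.append_nil] at hne
          simp [hne]
        · simp [wordSplit_ne_nil hwn]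
  have key1 : ∀ i, cls k (ClosedNecklace.d1 ⟨y, u ++ m ++ w, h1, h2, h3⟩ i) =
      cls k (ClosedNecklace.d1 ⟨y, u ++ m' ++ w, h1', h2', h3'⟩ i) := by
    intro i
    by_cases h : i.1 < y.dim
    · by_cases h0 : i.1 = 0
      · simp only [ClosedNecklace.d1, dif_pos h, dif_pos h0]
        exact key2 _
      · refine cls_eq k ?_
        simp only [ClosedNecklace.d1, dif_pos h, dif_neg h0]
        exact hR _ u w hc
    · refine cls_eq k ?_
      simp only [ClosedNecklace.d1, dif_neg h, List.append_assoc]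
      have hi : 0 < i.1 + 1 - y.dim := by omega
      rw [wordDel_append u (m ++ w) hi, wordDel_append u (m' ++ w) hi]
      by_cases h' : i.1 + 1 - y.dim ≤ wordDeg u
      · rw [if_pos h', if_pos h', ← List.append_assoc, ← List.append_assoc]
        refine hR _ _ _ (Or.inl ?_)
        have : u ≠ [] := by
          rintro rfl
          change _ ≤ 0 at h'
          omega
        simp [wordDel_ne_nil this]
      · rw [if_neg h', if_neg h', hd _ (by omega), hd' _ (by omega), ← List.append_assoc,
          ← List.append_assoc]
        refine hR _ _ _ (hc.imp_left fun hne => ?_)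
        by_cases hwn : w = []
        · subst hwn
          simp only [List.append_nil] at hne
          simp [hne]
        · simp [wordDel_ne_nil hwn]
  simp only [faceSum, key0, key1, key2]

lemma wordSplit_edge {Y : SSet.{u}} (s : Y.S) (hs : s.dim = 1) (w : List Y.S) (i : ℕ)
    (hi : 0 < i) : wordSplit (s :: w) i = s :: wordSplit w i := by
  rw [wordSplit, dif_neg (by omega), hs]; rfl

lemma wordDel_edge {Y : SSet.{u}} (s : Y.S) (hs : s.dim = 1) (w : List Y.S) (i : ℕ)
    (hi : 0 < i) : wordDel (s :: w) i = s :: wordDel w i := by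
  rw [wordDel, dif_neg (by omega), hs]; rfl

lemma OpPair.dim_eq {a b : (Z X).S} (h : OpPair a b) : a.dim = 1 ∧ b.dim = 1 := by
  cases h <;> exact ⟨rfl, rfl⟩

open Classical in
/-- The boundary of the element represented by a closed necklace: it is `0` if the closed necklace
is degenerate, and the alternating sum of the faces otherwise. -/
def repBoundary (r : ClosedNecklace X (n + 1)) : Chains k X n :=
  if r.IsDegenerate then 0 else faceSum k r

lemma repBoundary_eq (r r' : ClosedNecklace X (n + 1))
    (h : Rel (r.first, r.word) (r'.first, r'.word)) : repBoundary k r = repBoundary k r' := by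
  have hdeg : ∀ q q' : ClosedNecklace X (n + 1), (q.IsDegenerate ↔ q'.IsDegenerate) →
      faceSum k q = faceSum k q' → repBoundary k q = repBoundary k q' := by
    intro q q' h1 h2
    by_cases hq : q.IsDegenerate
    · rw [repBoundary, repBoundary, if_pos hq, if_pos (h1.1 hq)]
    · rw [repBoundary, repBoundary, if_neg hq, if_neg (fun hh => hq (h1.2 hh)), h2]
  have hzero : ∀ q q' : ClosedNecklace X (n + 1), q.IsDegenerate → q'.IsDegenerate →
      repBoundary k q = repBoundary k q' := by
    intro q q' h1 h2
    rw [repBoundary, repBoundary, if_pos h1, if_pos h2]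
  have hpos : ∀ (a : Vert (Z X)) (w : List (Z X).S) (b : Vert (Z X)), IsPath a w b →
      ∀ s ∈ w, 0 < s.dim := by
    intro a w b hw
    induction w generalizing a with
    | nil => simp
    | cons t w ih =>
      intro s hs
      rcases List.mem_cons.1 hs with rfl | hs
      · exact hw.1
      · exact ih _ hw.2.2 s hs
  obtain ⟨x, w, h1, h2, h3⟩ := r
  obtain ⟨x', w', h1', h2', h3'⟩ := r'
  have hp := hpos _ _ _ h2
  have hp' := hpos _ _ _ h2'
  dsimp only at h
  cases h with
  | unit _ u v w hne =>
    refine hdeg _ _ ?_ ?_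
    · have hu : (unitEdge v).dim = 1 := rfl
      simp only [ClosedNecklace.IsDegenerate, List.mem_append, List.mem_singleton]
      refine or_congr Iff.rfl ⟨?_, ?_⟩
      · rintro ⟨s, (hs | rfl) | hs, hs2⟩
        · exact ⟨s, Or.inl hs, hs2⟩
        · omega
        · exact ⟨s, Or.inr hs, hs2⟩
      · rintro ⟨s, hs | hs, hs2⟩
        · exact ⟨s, Or.inl (Or.inl hs), hs2⟩
        · exact ⟨s, Or.inr hs, hs2⟩
    · refine faceSum_eq_of_middle k [unitEdge v] [] False ?_ x u w (Or.inl hne) _ _ rfl rfl rfl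
        (by simp) ?_ ?_ ?_ ?_
      · intro y u w hc
        simpa using Rel.unit y u v w (by simpa using hc)
      · exact fun i hi => wordSplit_edge _ rfl _ _ hi
      · exact fun i hi => rfl
      · exact fun i hi => wordDel_edge _ rfl _ _ hi
      · exact fun i hi => rfl
  | inv _ u a b w hab =>
    obtain ⟨ha, hb⟩ := hab.dim_eq
    refine hdeg _ _ ?_ ?_
    · have hu : (unitEdge (minV a)).dim = 1 := rfl
      simp only [ClosedNecklace.IsDegenerate, List.mem_append, List.mem_cons, List.not_mem_nil,
        or_false]
      refine or_congr Iff.rfl ⟨?_, ?_⟩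
      · rintro ⟨s, (hs | rfl | rfl) | hs, hs2⟩
        · exact ⟨s, Or.inl (Or.inl hs), hs2⟩
        · omega
        · omega
        · exact ⟨s, Or.inr hs, hs2⟩
      · rintro ⟨s, (hs | rfl) | hs, hs2⟩
        · exact ⟨s, Or.inl (Or.inl hs), hs2⟩
        · omega
        · exact ⟨s, Or.inr hs, hs2⟩
    · refine faceSum_eq_of_middle k [a, b] [unitEdge (minV a)] True ?_ x u w (Or.inr trivial) _ _
        rfl rfl rfl rfl ?_ ?_ ?_ ?_
      · intro y u w _
        exact Rel.inv y u a b w hab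
      · intro i hi
        simp only [List.cons_append, List.nil_append]
        rw [wordSplit_edge _ ha _ _ hi, wordSplit_edge _ hb _ _ hi]
      · exact fun i hi => wordSplit_edge _ rfl _ _ hi
      · intro i hi
        simp only [List.cons_append, List.nil_append]
        rw [wordDel_edge _ ha _ _ hi, wordDel_edge _ hb _ _ hi]
      · exact fun i hi => wordDel_edge _ rfl _ _ hi
  | slide _ u s t w =>
    refine hzero _ _ (Or.inr ⟨dgn s (Fin.last _), by simp, ?_, SSet.σ_mem_degenerate _ _ _⟩)
      (Or.inr ⟨dgn t 0, by simp, ?_, SSet.σ_mem_degenerate _ _ _⟩)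
    · exact Nat.succ_le_succ (hp' s (by simp))
    · exact Nat.succ_le_succ (hp t (by simp))
  | slide_first _ s w =>
    refine hzero _ _ (Or.inl (SSet.σ_mem_degenerate _ _ _))
      (Or.inr ⟨dgn s 0, by simp, ?_, SSet.σ_mem_degenerate _ _ _⟩)
    exact Nat.succ_le_succ (hp s (by simp))
  | slide_last _ w s =>
    refine hzero _ _ (Or.inr ⟨dgn s (Fin.last _), by simp, ?_, SSet.σ_mem_degenerate _ _ _⟩)
      (Or.inl (SSet.σ_mem_degenerate _ _ _))
    exact Nat.succ_le_succ (hp' s (by simp))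

variable (X n)

/-- The boundary of an element of the closed necklical set. -/
def boundary (c : LambdaHat X (n + 1)) : Chains k X n :=
  Quot.lift (repBoundary k) (repBoundary_eq k) c

/-- The differential of the normalized chain complex of the closed necklical set. -/
def chainsD : Chains k X (n + 1) →ₗ[k] Chains k X n :=
  (degenerateChains k X (n + 1)).liftQ (Finsupp.linearCombination k (boundary k X n))
    (by
      refine Submodule.span_le.2 ?_
      rintro _ ⟨r, hr, rfl⟩
      rw [SetLike.mem_coe, LinearMap.mem_ker, Finsupp.linearCombination_single, one_smul]
      exact if_pos hr)

end Chains

/-! ### The hat-cobar construction -/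

/-- The generators of the hat-cobar construction: the unit words at the vertices, and the desuspensions
`[s]`, of degree `dim s - 1`, of the nondegenerate simplices `s` of `Z(X)` of positive dimension. -/
inductive HatGen (X : SSet.{u}) : Type u
  | unit (v : Vert (Z X)) : HatGen X
  | bead (s : (Z X).S) (hs : s.simplex ∈ (Z X).nonDegenerate s.dim) (pos : 0 < s.dim) : HatGen X

section HatCobar

variable (k : Type v) [CommRing k] {X : SSet.{u}}

/-- The generators, in the free algebra. -/
def freeUnit (v : Vert (Z X)) : FreeAlgebra k (HatGen X) := FreeAlgebra.ι k (HatGen.unit v)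

/-- The generators, in the free algebra. -/
def freeBead (s : (Z X).S) (hs : s.simplex ∈ (Z X).nonDegenerate s.dim) (pos : 0 < s.dim) :
    FreeAlgebra k (HatGen X) := FreeAlgebra.ι k (HatGen.bead s hs pos)

/-- The relations of the hat-cobar construction. The first four are those of a path algebra: the
unit words are orthogonal idempotents, and `[s]` leads from `min s` to `max s`, so that words which
are not composable vanish. The last one is `[a|aᵒᵖ] = 1`. -/
inductive HatRel : FreeAlgebra k (HatGen X) → FreeAlgebra k (HatGen X) → Prop
  | unit_mul_self (v : Vert (Z X)) : HatRel (freeUnit k v * freeUnit k v) (freeUnit k v)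
  | unit_mul_unit (v w : Vert (Z X)) (h : v ≠ w) : HatRel (freeUnit k v * freeUnit k w) 0
  | unit_mul (s : (Z X).S) (hs : s.simplex ∈ (Z X).nonDegenerate s.dim) (pos : 0 < s.dim) :
      HatRel (freeUnit k (minV s) * freeBead k s hs pos) (freeBead k s hs pos)
  | mul_unit (s : (Z X).S) (hs : s.simplex ∈ (Z X).nonDegenerate s.dim) (pos : 0 < s.dim) :
      HatRel (freeBead k s hs pos * freeUnit k (maxV s)) (freeBead k s hs pos)
  | inv (a b : (Z X).S) (ha : a.simplex ∈ (Z X).nonDegenerate a.dim) (ha' : 0 < a.dim)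
      (hb : b.simplex ∈ (Z X).nonDegenerate b.dim) (hb' : 0 < b.dim) (h : OpPair a b) :
      HatRel (freeBead k a ha ha' * freeBead k b hb hb') (freeUnit k (minV a))

variable (X)

/-- The path algebra version of the hat-cobar construction. The span of the nonempty words
`[s₁|…|sᵣ]` which lead from a vertex `a` to a vertex `b` is `hatCobar k a b q`, for all degrees `q`;
for `a = b = x₀` this is the hat-cobar construction at the base point `x₀`. -/
def HatPath : Type (max u v) := RingQuot (HatRel k (X := X))

instance : Ring (HatPath k X) := inferInstanceAs (Ring (RingQuot (HatRel k (X := X))))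

instance : Algebra k (HatPath k X) := inferInstanceAs (Algebra k (RingQuot (HatRel k (X := X))))

variable {X}

/-- The projection from the free algebra. -/
def hatMk : FreeAlgebra k (HatGen X) →ₐ[k] HatPath k X := RingQuot.mkAlgHom k (HatRel k)

lemma hatMk_rel {a b : FreeAlgebra k (HatGen X)} (h : HatRel k a b) : hatMk k a = hatMk k b :=
  RingQuot.mkAlgHom_rel k h

lemma hatMk_surjective : Function.Surjective (hatMk k (X := X)) :=
  RingQuot.mkAlgHom_surjective k (HatRel k)

/-- The algebra homomorphism induced by a homomorphism which respects the relations. -/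
def hatLift {B : Type*} [Semiring B] [Algebra k B] (f : FreeAlgebra k (HatGen X) →ₐ[k] B)
    (hf : ∀ ⦃a b⦄, HatRel k a b → f a = f b) : HatPath k X →ₐ[k] B :=
  RingQuot.liftAlgHom k ⟨f, hf⟩

lemma hatLift_hatMk {B : Type*} [Semiring B] [Algebra k B] (f : FreeAlgebra k (HatGen X) →ₐ[k] B)
    (hf : ∀ ⦃a b⦄, HatRel k a b → f a = f b) (a : FreeAlgebra k (HatGen X)) :
    hatLift k f hf (hatMk k a) = f a :=
  RingQuot.liftAlgHom_mkAlgHom_apply k f hf a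

/-- The generators of the hat-cobar construction. -/
def hatGen (g : HatGen X) : HatPath k X := hatMk k (FreeAlgebra.ι k g)

open Classical in
/-- The element `[s]` for a simplex `s` of positive dimension: if `s` is degenerate, then `[s]` is
the unit word at its vertex if `s` is an edge, and `0` if `dim s ≥ 2`. -/
def bracket (s : (Z X).S) : HatPath k X :=
  if h : s.simplex ∈ (Z X).nonDegenerate s.dim ∧ 0 < s.dim then hatGen k (HatGen.bead s h.1 h.2)
  else if s.dim = 1 then hatGen k (HatGen.unit (minV s))
  else 0

lemma hatUnit_mul_self (v : Vert (Z X)) :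
    hatGen k (HatGen.unit v) * hatGen k (HatGen.unit v) = hatGen k (HatGen.unit v) :=
  (map_mul _ _ _).symm.trans (hatMk_rel k (HatRel.unit_mul_self v))

lemma hatUnit_mul_unit {v w : Vert (Z X)} (h : v ≠ w) :
    hatGen k (HatGen.unit v) * hatGen k (HatGen.unit w) = 0 :=
  (map_mul _ _ _).symm.trans
    ((hatMk_rel k (HatRel.unit_mul_unit v w h)).trans (map_zero _))

lemma hatUnit_mul_bead (s : (Z X).S) (hs : s.simplex ∈ (Z X).nonDegenerate s.dim)
    (pos : 0 < s.dim) : hatGen k (HatGen.unit (minV s)) * hatGen k (HatGen.bead s hs pos) =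
      hatGen k (HatGen.bead s hs pos) :=
  (map_mul _ _ _).symm.trans (hatMk_rel k (HatRel.unit_mul s hs pos))

lemma bead_mul_hatUnit (s : (Z X).S) (hs : s.simplex ∈ (Z X).nonDegenerate s.dim)
    (pos : 0 < s.dim) : hatGen k (HatGen.bead s hs pos) * hatGen k (HatGen.unit (maxV s)) =
      hatGen k (HatGen.bead s hs pos) :=
  (map_mul _ _ _).symm.trans (hatMk_rel k (HatRel.mul_unit s hs pos))

lemma bead_mul_bead {a b : (Z X).S} (ha : a.simplex ∈ (Z X).nonDegenerate a.dim) (ha' : 0 < a.dim)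
    (hb : b.simplex ∈ (Z X).nonDegenerate b.dim) (hb' : 0 < b.dim) (h : OpPair a b) :
    hatGen k (HatGen.bead a ha ha') * hatGen k (HatGen.bead b hb hb') =
      hatGen k (HatGen.unit (minV a)) :=
  (map_mul _ _ _).symm.trans (hatMk_rel k (HatRel.inv a b ha ha' hb hb' h))

/-- A degenerate edge has equal end points. -/
lemma maxV_eq_minV_of_degenerate (s : (Z X).S) (hs : s.simplex ∉ (Z X).nonDegenerate s.dim)
    (h1 : s.dim = 1) : maxV s = minV s := by
  obtain ⟨n, x, rfl⟩ := s.mk_surjective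
  dsimp only at h1
  subst h1
  have hx : x ∈ (Z X).degenerate 1 := not_not.1 hs
  obtain ⟨m, hm, f, y, rfl⟩ := hx
  obtain rfl : m = 0 := by omega
  refine (vertex_map (SSet.S.mk y) f _).trans (Eq.trans ?_ (vertex_map (SSet.S.mk y) f _).symm)
  exact congrArg _ (Subsingleton.elim (α := Fin 1) _ _)

lemma hatUnit_mul_bracket (s : (Z X).S) :
    hatGen k (HatGen.unit (minV s)) * bracket k s = bracket k s := by
  rw [bracket]
  split_ifs with h h'
  · exact hatUnit_mul_bead k s h.1 h.2
  · exact hatUnit_mul_self k _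
  · exact mul_zero _

lemma bracket_mul_hatUnit (s : (Z X).S) :
    bracket k s * hatGen k (HatGen.unit (maxV s)) = bracket k s := by
  rw [bracket]
  split_ifs with h h'
  · exact bead_mul_hatUnit k s h.1 h.2
  · rw [maxV_eq_minV_of_degenerate s (fun hh => h ⟨hh, by omega⟩) h']
    exact hatUnit_mul_self k _
  · exact zero_mul _

/-- The sign `(-1)^q` for a generator of degree `q`. -/
def genSign (g : HatGen X) : k :=
  match g with
  | HatGen.unit _ => 1
  | HatGen.bead s _ _ => (-1) ^ (s.dim - 1)

/-- The algebra endomorphism which multiplies an element of degree `q` by `(-1)^q`. -/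
def hatSign : HatPath k X →ₐ[k] HatPath k X :=
  hatLift k (FreeAlgebra.lift k fun g => genSign k g • hatGen k g) (by
    intro a b h
    cases h with
    | unit_mul_self v => simp [freeUnit, genSign, hatUnit_mul_self]
    | unit_mul_unit v w h => simp [freeUnit, genSign, hatUnit_mul_unit k h]
    | unit_mul s hs pos => simp [freeUnit, freeBead, genSign, hatUnit_mul_bead]
    | mul_unit s hs pos => simp [freeUnit, freeBead, genSign, bead_mul_hatUnit]
    | inv a b ha ha' hb hb' h =>
      simp [freeUnit, freeBead, genSign, h.dim_eq.1, h.dim_eq.2, bead_mul_bead k ha ha' hb hb' h])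

/-- The differential on generators: `d[s] = -[d_A s] + ∑ (-1)^{dim s'} [s'|s'']`, where `d_A` is the
alternating sum of the inner faces, and `s'`, `s''` run through the pairs of a front and a back face
of complementary positive dimensions. -/
def genD (g : HatGen X) : HatPath k X :=
  match g with
  | HatGen.unit _ => 0
  | HatGen.bead s _ _ =>
    -(∑ i : Fin (s.dim + 1) with 0 < i.1 ∧ i.1 < s.dim, (-1 : k) ^ i.1 • bracket k (del s i)) +
      (∑ i : Fin (s.dim + 1) with 0 < i.1 ∧ i.1 < s.dim,
        (-1 : k) ^ i.1 • (bracket k (front s i) * bracket k (back s i)))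

lemma hatUnit_mul_genD (s : (Z X).S) (hs : s.simplex ∈ (Z X).nonDegenerate s.dim)
    (pos : 0 < s.dim) : hatGen k (HatGen.unit (minV s)) * genD k (HatGen.bead s hs pos) =
      genD k (HatGen.bead s hs pos) := by
  rw [genD, mul_add, mul_neg, Finset.mul_sum, Finset.mul_sum]
  refine congrArg₂ (· + ·) (congrArg _ (Finset.sum_congr rfl fun i hi => ?_))
    (Finset.sum_congr rfl fun i _ => ?_)
  · rw [mul_smul_comm, ← minV_del s i (Finset.mem_filter.1 hi).2.1, hatUnit_mul_bracket]
  · rw [mul_smul_comm, ← mul_assoc, ← minV_front s i, hatUnit_mul_bracket]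

lemma genD_mul_hatUnit (s : (Z X).S) (hs : s.simplex ∈ (Z X).nonDegenerate s.dim)
    (pos : 0 < s.dim) : genD k (HatGen.bead s hs pos) * hatGen k (HatGen.unit (maxV s)) =
      genD k (HatGen.bead s hs pos) := by
  rw [genD, add_mul, neg_mul, Finset.sum_mul, Finset.sum_mul]
  refine congrArg₂ (· + ·) (congrArg _ (Finset.sum_congr rfl fun i hi => ?_))
    (Finset.sum_congr rfl fun i _ => ?_)
  · rw [smul_mul_assoc, ← maxV_del s i (Finset.mem_filter.1 hi).2.2, bracket_mul_hatUnit]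
  · rw [smul_mul_assoc, mul_assoc, ← maxV_back s i, bracket_mul_hatUnit]

lemma genD_edge (s : (Z X).S) (hs : s.simplex ∈ (Z X).nonDegenerate s.dim)
    (pos : 0 < s.dim) (h : s.dim = 1) : genD k (HatGen.bead s hs pos) = 0 := by
  rw [genD, Finset.filter_eq_empty_iff.2 fun i _ => by omega]
  simp

/-- The algebra homomorphism to `2 × 2` matrices which sends an element `a` to the triangular matrix
with rows `(±a, d a)` and `(0, a)`; that it is multiplicative means that `d` is a derivation. -/
def hatTriangular : HatPath k X →ₐ[k] Matrix (Fin 2) (Fin 2) (HatPath k X) :=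
  hatLift k
    (FreeAlgebra.lift k fun g => !![genSign k g • hatGen k g, genD k g; 0, hatGen k g]) (by
    intro a b h
    cases h with
    | unit_mul_self v => simp [freeUnit, genSign, genD, hatUnit_mul_self]
    | unit_mul_unit v w h =>
      simp [freeUnit, genSign, genD, hatUnit_mul_unit k h]
      ext i j; fin_cases i <;> fin_cases j <;> rfl
    | unit_mul s hs pos =>
      have hD := hatUnit_mul_genD k s hs pos
      have h0 : genD k (HatGen.unit (minV s)) = 0 := rfl
      simp [freeUnit, freeBead, genSign, h0, hD, hatUnit_mul_bead]
    | mul_unit s hs pos =>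
      have hD := genD_mul_hatUnit k s hs pos
      have h0 : genD k (HatGen.unit (maxV s)) = 0 := rfl
      simp [freeUnit, freeBead, genSign, h0, hD, bead_mul_hatUnit]
    | inv a b ha ha' hb hb' h =>
      have h0 : genD k (HatGen.unit (minV a)) = 0 := rfl
      simp [freeUnit, freeBead, genSign, h0, genD_edge k a ha ha' h.dim_eq.1,
        genD_edge k b hb hb' h.dim_eq.2, h.dim_eq.1, h.dim_eq.2, bead_mul_bead k ha ha' hb hb' h])

/-- The differential of the hat-cobar construction. -/
def cobarD : HatPath k X →ₗ[k] HatPath k X :=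
  Matrix.entryLinearMap k (HatPath k X) 0 1 ∘ₗ (hatTriangular k).toLinearMap

lemma cobarD_hatGen (g : HatGen X) : cobarD k (hatGen k g) = genD k g := by
  simp [cobarD, hatTriangular, hatGen, hatLift_hatMk]

lemma hatTriangular_apply (a : HatPath k X) :
    hatTriangular k a = !![hatSign k a, cobarD k a; 0, a] := by
  obtain ⟨a, rfl⟩ := hatMk_surjective k a
  induction a using FreeAlgebra.induction with
  | grade0 r =>
    ext i j
    fin_cases i <;> fin_cases j <;> simp [cobarD, Matrix.algebraMap_matrix_apply]
  | grade1 g =>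
    simp [hatTriangular, hatSign, cobarD, hatGen, hatLift_hatMk]
  | mul a b ha hb =>
    rw [map_mul, map_mul, ha, hb, cobarD]
    ext i j
    fin_cases i <;> fin_cases j <;> simp [ha, hb]
  | add a b ha hb =>
    rw [map_add, map_add, ha, hb]
    ext i j
    fin_cases i <;> fin_cases j <;> simp

/-- The differential is a graded derivation. -/
lemma cobarD_mul (a b : HatPath k X) :
    cobarD k (a * b) = cobarD k a * b + hatSign k a * cobarD k b := by
  have h := congrFun (congrFun (map_mul (hatTriangular k) a b) 0) 1
  rw [hatTriangular_apply, hatTriangular_apply k a, hatTriangular_apply k b,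
    Matrix.mul_fin_two] at h
  simpa [add_comm] using h

/-- The words from `a` to `b` of degree `q` in the hat-cobar construction: the span of the elements
`[s₁|…|sᵣ]`, `r ≥ 1`, for simplices `sⱼ` of `Z(X)` of positive dimension such that `min s₁ = a`,
`max sⱼ = min sⱼ₊₁`, `max sᵣ = b`, and of total degree `q`. -/
def hatCobar (a b : Vert (Z X)) (q : ℕ) : Submodule k (HatPath k X) :=
  Submodule.span k
    {z | ∃ w : List (Z X).S, w ≠ [] ∧ IsPath a w b ∧ wordDeg w = q ∧ z = (w.map (bracket k)).prod}

end HatCobar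

/-! ### The hat-coHochschild complex -/

section HatCoHochschild

open TensorProduct

variable (k : Type v) [CommRing k] (X : SSet.{u})

/-- The normalized chains of `X`: the free module on the nondegenerate simplices. -/
def SChains : Type (max u v) := X.N →₀ k

instance : AddCommGroup (SChains k X) := inferInstanceAs (AddCommGroup (X.N →₀ k))

instance : Module k (SChains k X) := inferInstanceAs (Module k (X.N →₀ k))

variable {X}

/-- The basis of the normalized chains. -/
def sBasis : Module.Basis X.N k (SChains k X) := ⟨LinearEquiv.refl k (X.N →₀ k)⟩

open Classical in
/-- The normalized chain of a simplex, which is `0` if the simplex is degenerate. -/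
def chain (s : X.S) : SChains k X :=
  if h : s.simplex ∈ X.nonDegenerate s.dim then sBasis k (SSet.N.mk' s h) else 0

/-- The normalized chains of degree `p` spanned by the simplices with first vertex `a` and last
vertex `b`. -/
def chainsFromTo (a b : Vert X) (p : ℕ) : Submodule k (SChains k X) :=
  Submodule.span k {z | ∃ s : X.S, minV s = a ∧ maxV s = b ∧ s.dim = p ∧ z = chain k s}

/-- The truncated differential `d_C - ∂₀ - (-1)^p ∂_p` on simplices of dimension `p`, that is, the
alternating sum of the inner faces. -/
def innerD : SChains k X →ₗ[k] SChains k X :=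
  (sBasis k).constr k fun x : X.N =>
    ∑ i : Fin (x.dim + 1) with 0 < i.1 ∧ i.1 < x.dim, (-1 : k) ^ i.1 • chain k (del x.toS i)

/-- The map which multiplies a chain of degree `p` by `(-1)^p`. -/
def chainSign : SChains k X →ₗ[k] SChains k X :=
  (sBasis k).constr k fun x : X.N => (-1 : k) ^ x.dim • sBasis k x

/-- The map `θ₁(x ⊗ w) = -∑ (-1)^{|x'|} x' ⊗ [x'']w`, where `∑ x' ⊗ x''` is the Alexander-Whitney
coproduct of `x`, restricted to the terms with `dim x'' > 0`. -/
def theta1 : SChains k X ⊗[k] HatPath k X →ₗ[k] SChains k X ⊗[k] HatPath k X :=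
  TensorProduct.lift <| (sBasis k).constr k fun x : X.N =>
    -(∑ i : Fin (x.dim + 1) with i.1 < x.dim, (-1 : k) ^ i.1 •
      (TensorProduct.mk k _ _ (chain k (front x.toS i)) ∘ₗ
        LinearMap.mulLeft k (bracket k (SSet.S.map (inclZ X) (back x.toS i)))))

/-- The map `θ₂(x ⊗ w) = ∑ (-1)^{(|x'|+1)(|x''|+|w|)} x'' ⊗ w[x']`, where `∑ x' ⊗ x''` is the
Alexander-Whitney coproduct of `x`, restricted to the terms with `dim x' > 0`. -/
def theta2 : SChains k X ⊗[k] HatPath k X →ₗ[k] SChains k X ⊗[k] HatPath k X :=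
  TensorProduct.lift <| (sBasis k).constr k fun x : X.N =>
    ∑ i : Fin (x.dim + 1) with 0 < i.1, (-1 : k) ^ ((i.1 + 1) * (x.dim - i.1)) •
      (TensorProduct.mk k _ _ (chain k (back x.toS i)) ∘ₗ
        LinearMap.mulRight k (bracket k (SSet.S.map (inclZ X) (front x.toS i))) ∘ₗ
          (hatSign k ^ (i.1 + 1)).toLinearMap)

/-- The differential `d ⊗ 1 + 1 ⊗ d + θ₁ + θ₂` of the hat-coHochschild complex, where
`(1 ⊗ d)(x ⊗ w) = (-1)^{|x|} x ⊗ dw`. -/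
def hatCoHochD : SChains k X ⊗[k] HatPath k X →ₗ[k] SChains k X ⊗[k] HatPath k X :=
  TensorProduct.map (innerD k) LinearMap.id + TensorProduct.map (chainSign k) (cobarD k) +
    theta1 k + theta2 k

variable (X)

/-- The degree `n` part of the hat-coHochschild complex: the sum, over `p + q = n` and all vertices
`a`, `b` of `X`, of the images of `C_p(a, b) ⊗ Ω̂_q(b, a)`, where `C_p(a, b)` is spanned by the
`p`-simplices from `a` to `b` and `Ω̂_q(b, a)` by the words of degree `q` from `b` to `a`. If `X` has
only one vertex `x₀`, this is the degree `n` part of `C(X) ⊗ Ω̂(x₀, x₀)`. -/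
def hatCoHoch (n : ℕ) : Submodule k (SChains k X ⊗[k] HatPath k X) :=
  ⨆ (p : ℕ) (q : ℕ) (_ : p + q = n) (a : Vert X) (b : Vert X),
    LinearMap.range
      (TensorProduct.mapIncl (chainsFromTo k a b p) (hatCobar k (inclV b) (inclV a) q))

end HatCoHochschild

end HatNecklical

end

open HatNecklical

open scoped TensorProduct

noncomputable section

namespace HatNecklical

open CategoryTheory Opposite

/-! The map from necklaces to tensors exists because the conventions on the two sides match.
Deleting a constant edge and cancelling an edge against its formal inverse are relations of the path
algebra, and both sides of a sliding relation are degenerate, so both go to 0. This gives `toHoch`.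
It has a left inverse `ofHoch`: for a fixed nondegenerate first bead, a monomial in the generators
is sent to the class of the necklace that it spells, or to 0 if it spells none. The relations of the
path algebra are respected because each of them either comes from `Rel` or involves words that are
not composable (`freeNecklace_rel`). So `toHoch` is injective, and its image is `hatCoHoch`
(`range_toHoch`).

The differentials agree term by term (`toHoch_faceSum`). The faces d⁰ᵢ with i ≤ p give θ₁, the d¹ᵢ
with 2 ≤ i ≤ p give the truncated differential, d¹₁ = d²₁ and the other d²ᵢ give θ₂, and the faces
of the word give 1 ⊗ d by the Leibniz rule (`cobarD_wordProd`).

The delicate point is degeneracy. The formulas for the differentials are imposed on nondegenerate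
simplices, but they hold for all of them (`cobarD_bracket`, `hatCoHochD_tmul`). In sⱼt the faces ∂ⱼ
and ∂ⱼ₊₁ cancel; if one of them is an outer face, which is absent from the sum, the other one
cancels against the cut that splits off a degenerate edge, since this edge acts as a unit.

Hence d² = 0 can be verified once, on tensors, by simplicial identities that need no case
distinction (`cobarD_cobarD_bracket`, `hochFormula_hochFormula`). The claims about necklaces follow
by injectivity: the face sum of a degenerate necklace vanishes because its image does
(`faceSum_of_isDegenerate`), and d² = 0 is reflected in the same way. -/

/-! ### Simplicial operators indexed by natural numbers -/

section Operators

open Simplicial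

variable {Y : SSet.{u}}

/-- The map `[m] → [n]` induced by a monotone map of natural numbers, truncated at `n`. -/
def truncHom (m n : ℕ) (φ : ℕ →o ℕ) : ⦋m⦌ ⟶ ⦋n⦌ :=
  SimplexCategory.mkHom
    { toFun := fun i => ⟨min (φ i.1) n, by omega⟩
      monotone' := fun i j h => Fin.mk_le_mk.2 (min_le_min_right _ (φ.monotone h)) }

/-- The simplex of dimension `m` whose `i`-th vertex is the vertex `φ i` of `s`. -/
def pull (s : Y.S) (m : ℕ) (φ : ℕ →o ℕ) : Y.S :=
  SSet.S.mk (Y.map (truncHom m s.dim φ).op s.simplex)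

@[simp] lemma pull_dim (s : Y.S) (m : ℕ) (φ : ℕ →o ℕ) : (pull s m φ).dim = m := rfl

/-- Operators are recorded by maps on ℕ, so that simplices whose dimensions agree only
propositionally can be compared without transport. -/
lemma mk_map_eq_pull {m : ℕ} (s : Y.S) (f : ⦋m⦌ ⟶ ⦋s.dim⦌) (φ : ℕ →o ℕ)
    (h : ∀ i : Fin (m + 1), (f.toOrderHom i).1 = φ i.1) :
    SSet.S.mk (Y.map f.op s.simplex) = pull s m φ := by
  have : f = truncHom m s.dim φ := by
    ext i : 3
    refine Fin.ext ?_
    have h1 := h i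
    have h2 : (f.toOrderHom i).1 < s.dim + 1 := (f.toOrderHom i).2
    change (f.toOrderHom i).1 = min (φ i.1) s.dim
    omega
  rw [this, pull]

lemma pull_congr (s : Y.S) {m m' : ℕ} (φ φ' : ℕ →o ℕ) (hm : m = m')
    (h : ∀ i ≤ m, φ i = φ' i) : pull s m φ = pull s m' φ' := by
  subst hm
  have : truncHom m s.dim φ = truncHom m s.dim φ' := by
    ext i : 3
    refine Fin.ext ?_
    change min (φ i.1) s.dim = min (φ' i.1) s.dim
    rw [h i.1 (Nat.le_of_lt_succ i.2)]
  rw [pull, this, pull]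

/-- The bound on `ψ` makes the inner truncation at `m` inactive; the outer truncation at `s.dim` is
the same on both sides. -/
lemma pull_pull (s : Y.S) (m m' : ℕ) (φ ψ : ℕ →o ℕ) (h : ∀ i ≤ m', ψ i ≤ m) :
    pull (pull s m φ) m' ψ = pull s m' (φ.comp ψ) := by
  have : truncHom m' m ψ ≫ truncHom m s.dim φ = truncHom m' s.dim (φ.comp ψ) := by
    ext i : 3
    refine Fin.ext ?_
    change min (φ (min (ψ i.1) m)) s.dim = min (φ (ψ i.1)) s.dim
    rw [min_eq_left (h i.1 (Nat.le_of_lt_succ i.2))]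
  simp only [pull]
  rw [← this, op_comp, Y.map_comp]
  rfl

lemma pull_pull_eq_pull (s : Y.S) {m m' m'' : ℕ} (φ ψ χ : ℕ →o ℕ) (hm : m' = m'')
    (h : ∀ t ≤ m', ψ t ≤ m ∧ φ (ψ t) = χ t) : pull (pull s m φ) m' ψ = pull s m'' χ :=
  (pull_pull s _ _ _ _ fun t ht => (h t ht).1).trans (pull_congr _ _ _ hm fun t ht => (h t ht).2)

/-- Every simplicial identity below is an instance of this lemma or of `pull_pull_eq_pull`, and
thereby becomes linear arithmetic. -/
lemma pull_pull_eq_pull_pull (s : Y.S) {m m' n n' : ℕ} (φ ψ χ ω : ℕ →o ℕ) (hm : m' = n')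
    (h : ∀ t ≤ m', ψ t ≤ m ∧ ω t ≤ n ∧ φ (ψ t) = χ (ω t)) :
    pull (pull s m φ) m' ψ = pull (pull s n χ) n' ω :=
  (pull_pull_eq_pull s _ _ (χ.comp ω) hm fun t ht => ⟨(h t ht).1, (h t ht).2.2⟩).trans
    (pull_pull s _ _ _ _ fun t ht => (h t (ht.trans hm.ge)).2.1).symm

lemma pull_id (s : Y.S) : pull s s.dim OrderHom.id = s := by
  have h := mk_map_eq_pull s (𝟙 _) OrderHom.id fun _ => rfl
  rw [← h, op_id, Y.map_id]
  rfl

/-- Translation by `i`. -/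
def shiftHom (i : ℕ) : ℕ →o ℕ := ⟨fun t => t + i, fun _ _ h => Nat.add_le_add_right h i⟩

/-- The monotone map which omits `i`. -/
def skipHom (i : ℕ) : ℕ →o ℕ :=
  ⟨fun t => if t < i then t else t + 1, fun a b h => by dsimp only; split_ifs <;> omega⟩

/-- The monotone map which takes the value `j` twice. -/
def dupHom (j : ℕ) : ℕ →o ℕ :=
  ⟨fun t => if t ≤ j then t else t - 1, fun a b h => by dsimp only; split_ifs <;> omega⟩

lemma shiftHom_apply (i t : ℕ) : shiftHom i t = t + i := rfl

lemma skipHom_apply (i t : ℕ) : skipHom i t = if t < i then t else t + 1 := rfl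

lemma dupHom_apply (j t : ℕ) : dupHom j t = if t ≤ j then t else t - 1 := rfl

lemma id_apply_nat (t : ℕ) : (OrderHom.id : ℕ →o ℕ) t = t := rfl

/-- The front face on the vertices `0, …, i`. -/
def fr (s : Y.S) (i : ℕ) : Y.S := pull s i OrderHom.id

/-- The back face on the vertices `i, …, dim s`. -/
def bk (s : Y.S) (i : ℕ) : Y.S := pull s (s.dim - i) (shiftHom i)

/-- The face which omits the vertex `i`. -/
def dl (s : Y.S) (i : ℕ) : Y.S := pull s (s.dim - 1) (skipHom i)

/-- The degenerate simplex which repeats the vertex `j`. -/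
def dg (s : Y.S) (j : ℕ) : Y.S := pull s (s.dim + 1) (dupHom j)

@[simp] lemma fr_dim (s : Y.S) (i : ℕ) : (fr s i).dim = i := rfl

@[simp] lemma bk_dim (s : Y.S) (i : ℕ) : (bk s i).dim = s.dim - i := rfl

@[simp] lemma dl_dim (s : Y.S) (i : ℕ) : (dl s i).dim = s.dim - 1 := rfl

@[simp] lemma dg_dim (s : Y.S) (i : ℕ) : (dg s i).dim = s.dim + 1 := rfl

lemma front_eq_fr (s : Y.S) (i : Fin (s.dim + 1)) : front s i = fr s i.1 :=
  mk_map_eq_pull s _ _ fun _ => rfl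

lemma back_eq_bk (s : Y.S) (i : Fin (s.dim + 1)) : back s i = bk s i.1 :=
  mk_map_eq_pull s _ _ fun _ => rfl

lemma del_eq_dl (s : Y.S) (i : Fin (s.dim + 1)) (h : 0 < s.dim) : del s i = dl s i.1 := by
  rcases s with @⟨_ | n, x⟩
  · exact absurd h (lt_irrefl _)
  · refine mk_map_eq_pull (SSet.S.mk x) (SimplexCategory.δ i) _ fun t => ?_
    change (Fin.succAbove i t).1 = if t.1 < i.1 then t.1 else t.1 + 1
    simp only [Fin.succAbove, Fin.lt_def, Fin.val_castSucc]
    split_ifs <;> rfl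

lemma dgn_eq_dg (s : Y.S) (i : Fin (s.dim + 1)) : dgn s i = dg s i.1 := by
  refine mk_map_eq_pull s (SimplexCategory.σ i) _ fun t => ?_
  change (Fin.predAbove i t).1 = if t.1 ≤ i.1 then t.1 else t.1 - 1
  simp only [Fin.predAbove, Fin.lt_def, Fin.val_castSucc]
  split_ifs <;> first | rfl | omega

set_option linter.unusedSimpArgs false

/-! ### Simplicial identities for front faces, back faces, omitted and repeated vertices. -/

section Identities

variable (s : Y.S) {i j : ℕ}

lemma fr_dim_self : fr s s.dim = s := pull_id s

lemma bk_zero : bk s 0 = s := pull_id s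

lemma fr_fr (h : j ≤ i) : fr (fr s i) j = fr s j := by
  simp only [fr, bk, dl, dg, pull_dim]
  refine pull_pull_eq_pull s _ _ _ (by omega) fun t ht => ?_
  simp only [shiftHom_apply, skipHom_apply, dupHom_apply, id_apply_nat]
  refine ⟨?_, ?_⟩ <;> first | omega | trivial

lemma bk_bk (h : i + j ≤ s.dim) : bk (bk s i) j = bk s (i + j) := by
  simp only [fr, bk, dl, dg, pull_dim]
  refine pull_pull_eq_pull s _ _ _ (by omega) fun t ht => ?_
  simp only [shiftHom_apply, skipHom_apply, dupHom_apply, id_apply_nat]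
  refine ⟨?_, ?_⟩ <;> omega

lemma fr_bk (h : i + j ≤ s.dim) : fr (bk s i) j = bk (fr s (i + j)) i := by
  simp only [fr, bk, dl, dg, pull_dim]
  refine pull_pull_eq_pull_pull s _ _ _ _ (by omega) fun t ht => ?_
  simp only [shiftHom_apply, skipHom_apply, dupHom_apply, id_apply_nat]
  refine ⟨?_, ?_, ?_⟩ <;> first | omega | trivial

lemma dl_dl (hj : j < i) (hi : i ≤ s.dim) (h : 2 ≤ s.dim) :
    dl (dl s i) j = dl (dl s j) (i - 1) := by
  simp only [fr, bk, dl, dg, pull_dim]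
  refine pull_pull_eq_pull_pull s _ _ _ _ (by omega) fun t ht => ?_
  simp only [shiftHom_apply, skipHom_apply, dupHom_apply, id_apply_nat]
  refine ⟨?_, ?_, ?_⟩ <;> (try split_ifs) <;> omega

lemma fr_dl_of_lt (hij : i < j) (hj : j ≤ s.dim) : fr (dl s j) i = fr s i := by
  simp only [fr, bk, dl, dg, pull_dim]
  refine pull_pull_eq_pull s _ _ _ (by omega) fun t ht => ?_
  simp only [shiftHom_apply, skipHom_apply, dupHom_apply, id_apply_nat]
  refine ⟨?_, ?_⟩ <;> (try split_ifs) <;> omega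

lemma fr_dl_of_le (hij : j ≤ i) (hi : i < s.dim) : fr (dl s j) i = dl (fr s (i + 1)) j := by
  simp only [fr, bk, dl, dg, pull_dim]
  refine pull_pull_eq_pull_pull s _ _ _ _ (by omega) fun t ht => ?_
  simp only [shiftHom_apply, skipHom_apply, dupHom_apply, id_apply_nat]
  refine ⟨?_, ?_, ?_⟩ <;> (try split_ifs) <;> first | omega | trivial

lemma bk_dl_of_lt (hij : i < j) (hj : j ≤ s.dim) : bk (dl s j) i = dl (bk s i) (j - i) := by
  simp only [fr, bk, dl, dg, pull_dim]
  refine pull_pull_eq_pull_pull s _ _ _ _ (by omega) fun t ht => ?_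
  simp only [shiftHom_apply, skipHom_apply, dupHom_apply, id_apply_nat]
  refine ⟨?_, ?_, ?_⟩ <;> (try split_ifs) <;> omega

lemma bk_dl_of_le (hij : j ≤ i) (hi : i < s.dim) : bk (dl s j) i = bk s (i + 1) := by
  simp only [fr, bk, dl, dg, pull_dim]
  refine pull_pull_eq_pull s _ _ _ (by omega) fun t ht => ?_
  simp only [shiftHom_apply, skipHom_apply, dupHom_apply, id_apply_nat]
  refine ⟨?_, ?_⟩ <;> (try split_ifs) <;> omega

lemma dl_dg_self (hj : j ≤ s.dim) : dl (dg s j) j = s := by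
  simp only [fr, bk, dl, dg, pull_dim]
  refine (pull_pull_eq_pull s _ _ OrderHom.id (by omega) fun t ht => ?_).trans (pull_id s)
  simp only [shiftHom_apply, skipHom_apply, dupHom_apply, id_apply_nat]
  refine ⟨?_, ?_⟩ <;> (try split_ifs) <;> omega

lemma dl_dg_succ (hj : j ≤ s.dim) : dl (dg s j) (j + 1) = s := by
  simp only [fr, bk, dl, dg, pull_dim]
  refine (pull_pull_eq_pull s _ _ OrderHom.id (by omega) fun t ht => ?_).trans (pull_id s)
  simp only [shiftHom_apply, skipHom_apply, dupHom_apply, id_apply_nat]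
  refine ⟨?_, ?_⟩ <;> (try split_ifs) <;> omega

lemma dl_dg_of_lt (hij : i < j) (hj : j ≤ s.dim) : dl (dg s j) i = dg (dl s i) (j - 1) := by
  simp only [fr, bk, dl, dg, pull_dim]
  refine pull_pull_eq_pull_pull s _ _ _ _ (by omega) fun t ht => ?_
  simp only [shiftHom_apply, skipHom_apply, dupHom_apply, id_apply_nat]
  refine ⟨?_, ?_, ?_⟩ <;> (try split_ifs) <;> omega

lemma dl_dg_of_gt (hij : j + 1 < i) (hi : i ≤ s.dim + 1) :
    dl (dg s j) i = dg (dl s (i - 1)) j := by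
  simp only [fr, bk, dl, dg, pull_dim]
  refine pull_pull_eq_pull_pull s _ _ _ _ (by omega) fun t ht => ?_
  simp only [shiftHom_apply, skipHom_apply, dupHom_apply, id_apply_nat]
  refine ⟨?_, ?_, ?_⟩ <;> (try split_ifs) <;> omega

lemma fr_dg_of_le (hij : i ≤ j) (hj : j ≤ s.dim) : fr (dg s j) i = fr s i := by
  simp only [fr, bk, dl, dg, pull_dim]
  refine pull_pull_eq_pull s _ _ _ (by omega) fun t ht => ?_
  simp only [shiftHom_apply, skipHom_apply, dupHom_apply, id_apply_nat]
  refine ⟨?_, ?_⟩ <;> (try split_ifs) <;> omega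

lemma fr_dg_of_lt (hij : j < i) (hi : i ≤ s.dim + 1) : fr (dg s j) i = dg (fr s (i - 1)) j := by
  simp only [fr, bk, dl, dg, pull_dim]
  refine pull_pull_eq_pull_pull s _ _ _ _ (by omega) fun t ht => ?_
  simp only [shiftHom_apply, skipHom_apply, dupHom_apply, id_apply_nat]
  refine ⟨?_, ?_, ?_⟩ <;> (try split_ifs) <;> first | omega | trivial

lemma bk_dg_of_le (hij : i ≤ j) (hj : j ≤ s.dim) : bk (dg s j) i = dg (bk s i) (j - i) := by
  simp only [fr, bk, dl, dg, pull_dim]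
  refine pull_pull_eq_pull_pull s _ _ _ _ (by omega) fun t ht => ?_
  simp only [shiftHom_apply, skipHom_apply, dupHom_apply, id_apply_nat]
  refine ⟨?_, ?_, ?_⟩ <;> (try split_ifs) <;> omega

lemma bk_dg_of_lt (hij : j < i) (hi : i ≤ s.dim + 1) : bk (dg s j) i = bk s (i - 1) := by
  simp only [fr, bk, dl, dg, pull_dim]
  refine pull_pull_eq_pull s _ _ _ (by omega) fun t ht => ?_
  simp only [shiftHom_apply, skipHom_apply, dupHom_apply, id_apply_nat]
  refine ⟨?_, ?_⟩ <;> (try split_ifs) <;> omega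

end Identities

lemma dg_mem_degenerate (s : Y.S) {j : ℕ} (hj : j ≤ s.dim) :
    (dg s j).simplex ∈ Y.degenerate (dg s j).dim := by
  rw [← dgn_eq_dg s ⟨j, by omega⟩]
  exact SSet.σ_mem_degenerate _ _ _

lemma exists_eq_dg {s : Y.S} (hs : s.simplex ∈ Y.degenerate s.dim) :
    ∃ (t : Y.S) (j : ℕ), j ≤ t.dim ∧ s = dg t j := by
  rcases s with @⟨_ | n, x⟩
  · simp [SSet.degenerate_zero] at hs
  · change x ∈ Y.degenerate (n + 1) at hs
    rw [SSet.degenerate_eq_iUnion_range_σ] at hs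
    obtain ⟨i, y, rfl⟩ := Set.mem_iUnion.1 hs
    exact ⟨SSet.S.mk y, i.1, Nat.le_of_lt_succ i.2, dgn_eq_dg (SSet.S.mk y) i⟩

lemma minV_fr (s : Y.S) {i : ℕ} (hi : i ≤ s.dim) : minV (fr s i) = minV s := by
  rw [← front_eq_fr s ⟨i, by omega⟩, minV_front]

lemma maxV_bk (s : Y.S) {i : ℕ} (hi : i ≤ s.dim) : maxV (bk s i) = maxV s := by
  rw [← back_eq_bk s ⟨i, by omega⟩, maxV_back]

lemma minV_bk (s : Y.S) {i : ℕ} (hi : i ≤ s.dim) : minV (bk s i) = maxV (fr s i) := by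
  rw [← back_eq_bk s ⟨i, by omega⟩, ← front_eq_fr s ⟨i, by omega⟩, minV_back, maxV_front]

lemma minV_dl (s : Y.S) {i : ℕ} (h : 0 < i) (hi : i < s.dim) : minV (dl s i) = minV s := by
  rw [← del_eq_dl s ⟨i, by omega⟩ (by omega), minV_del _ _ h]

lemma maxV_dl (s : Y.S) {i : ℕ} (hi : i < s.dim) : maxV (dl s i) = maxV s := by
  rw [← del_eq_dl s ⟨i, by omega⟩ (by omega), maxV_del _ _ hi]

end Operators

/-! ### Reindexing of sums over faces and cuts, and comparison of signs. -/

section Sums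

variable {M : Type*} [AddCommMonoid M]

lemma sum_fin_filter (p : ℕ) (P : ℕ → Prop) [DecidablePred P] (a b : ℕ)
    (h : ∀ i, i ∈ Finset.Ico a b ↔ i < p ∧ P i) (g : ℕ → M) (f : Fin p → M)
    (hf : ∀ i : Fin p, P i.1 → f i = g i.1) :
    ∑ i : Fin p with P i.1, f i = ∑ i ∈ Finset.Ico a b, g i := by
  refine Finset.sum_bij (fun i _ => i.1) ?_ ?_ ?_ ?_
  · intro i hi
    exact (h i.1).2 ⟨i.2, (Finset.mem_filter.1 hi).2⟩
  · intro i _ j _ hij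
    exact Fin.ext hij
  · intro i hi
    exact ⟨⟨i, ((h i).1 hi).1⟩, by simpa using ((h i).1 hi).2, rfl⟩
  · intro i hi
    exact hf i (Finset.mem_filter.1 hi).2

end Sums

section Sums

variable {M : Type*} [AddCommMonoid M]

lemma sum_Ico_shift (c i n : ℕ) (f : ℕ → M) :
    ∑ j ∈ Finset.Ico c (n - i), f (i + j) = ∑ m ∈ Finset.Ico (i + c) n, f m := by
  refine Finset.sum_nbij' (fun j => i + j) (fun m => m - i) ?_ ?_ ?_ ?_ ?_ <;>
    simp only [Finset.mem_Ico]
  · intro j hj; omega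
  · intro j hj; omega
  · intro j hj; omega
  · intro j hj; omega
  · intro j hj; trivial

/-- Coassociativity: cutting at `i` and then cutting the back part at its vertex `j` is cutting at
`i < m = i + j`, as is cutting at `m` and then cutting the front part at `i`. -/
lemma sum_Ico_Ico_one (a n : ℕ) (g : ℕ → ℕ → M) :
    ∑ i ∈ Finset.Ico a n, ∑ j ∈ Finset.Ico 1 (n - i), g i (i + j) =
      ∑ m ∈ Finset.Ico a n, ∑ i ∈ Finset.Ico a m, g i m := by
  simp only [fun i => sum_Ico_shift 1 i n (g i)]
  refine Finset.sum_comm' fun i m => ?_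
  simp only [Finset.mem_Ico]
  omega

/-- The variant for cuts from both ends, where `i = m` is allowed because the remaining middle part
may be a vertex. -/
lemma sum_Ico_Ico_zero (n : ℕ) (g : ℕ → ℕ → M) :
    ∑ i ∈ Finset.Ico 1 (n + 1), ∑ j ∈ Finset.Ico 0 (n - i), g i (i + j) =
      ∑ m ∈ Finset.Ico 0 n, ∑ i ∈ Finset.Ico 1 (m + 1), g i m := by
  simp only [fun i => sum_Ico_shift 0 i n (g i)]
  refine Finset.sum_comm' fun i m => ?_
  simp only [Finset.mem_Ico]
  omega

/-- A cut of `∂ⱼ s` at `i` is a cut of `s` followed by a face: of the back part if `i < j`, and of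
the front part if `j ≤ i`, where the cut then sits at `i + 1`. Taking `a = 0` admits a front part
that is a vertex (as in θ₁), and `b = 1` a back part that is a vertex (as in θ₂). -/
lemma sum_split_faces (p a b : ℕ) (ha : a ≤ 1) (hb : b ≤ 1) (H K L : ℕ → ℕ → M)
    (hK : ∀ i j, a ≤ i → i < j → j < p → H i j = K i (j - i))
    (hL : ∀ i j, a ≤ i → 1 ≤ j → j ≤ i → i + 1 < p + b → H i j = L (i + 1) j) :
    ∑ j ∈ Finset.Ico 1 p, ∑ i ∈ Finset.Ico a (p - 1 + b), H i j =
      ∑ i ∈ Finset.Ico a (p + b), ∑ j ∈ Finset.Ico 1 (p - i), K i j +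
        ∑ i ∈ Finset.Ico a (p + b), ∑ j ∈ Finset.Ico 1 i, L i j := by
  have h1 : ∀ j ∈ Finset.Ico 1 p, ∑ i ∈ Finset.Ico a (p - 1 + b), H i j =
      ∑ i ∈ (Finset.Ico a (p - 1 + b)).filter (· < j), K i (j - i) +
        ∑ i ∈ Finset.Ico (j + 1) (p + b), L i j := by
    intro j hj
    rw [Finset.mem_Ico] at hj
    rw [← Finset.sum_filter_add_sum_filter_not _ (· < j)]
    congr 1
    · refine Finset.sum_congr rfl fun i hi => ?_
      simp only [Finset.mem_filter, Finset.mem_Ico] at hi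
      exact hK _ _ hi.1.1 hi.2 hj.2
    · refine Finset.sum_nbij' (fun i => i + 1) (fun i => i - 1) ?_ ?_ ?_ ?_ ?_ <;>
        simp only [Finset.mem_filter, Finset.mem_Ico] <;> intro i hi
      · omega
      · omega
      · omega
      · omega
      · exact hL _ _ hi.1.1 hj.1 (by omega) (by omega)
  rw [Finset.sum_congr rfl h1, Finset.sum_add_distrib]
  congr 1
  · have h2 : ∀ i ∈ Finset.Ico a (p + b), ∑ j ∈ Finset.Ico 1 (p - i), K i j =
        ∑ j ∈ Finset.Ico (i + 1) p, K i (j - i) := by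
      intro i _
      rw [← sum_Ico_shift 1 i p (fun j => K i (j - i))]
      simp only [Nat.add_sub_cancel_left]
    rw [Finset.sum_congr rfl h2]
    refine Finset.sum_comm' fun i j => ?_
    simp only [Finset.mem_filter, Finset.mem_Ico]
    omega
  · refine Finset.sum_comm' fun i j => ?_
    simp only [Finset.mem_Ico]
    omega

variable {k N : Type*} [CommRing k] [AddCommGroup N] [Module k N]

lemma sum_faces_faces (p : ℕ) (f : ℕ → ℕ → N)
    (h : ∀ i j, 1 ≤ j → j < i → i < p → f i j = f j (i - 1)) :
    ∑ i ∈ Finset.Ico 1 p, ∑ j ∈ Finset.Ico 1 (p - 1), (-1 : k) ^ (i + j) • f i j = 0 := by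
  rw [Finset.sum_sigma']
  -- The two orders of omitting the same pair of vertices are exchanged; their signs are opposite.
  refine Finset.sum_involution
    (fun x _ => if x.2 < x.1 then ⟨x.2, x.1 - 1⟩ else ⟨x.2 + 1, x.1⟩) ?_ ?_ ?_ ?_
  · rintro ⟨i, j⟩ hx
    simp only [Finset.mem_sigma, Finset.mem_Ico] at hx
    dsimp only
    split_ifs with hij
    · rw [h i j (by omega) hij (by omega), ← add_smul]
      obtain ⟨i, rfl⟩ : ∃ i', i = i' + 1 := ⟨i - 1, by omega⟩
      simp only [Nat.add_sub_cancel]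
      rw [show i + 1 + j = (j + i) + 1 by omega, pow_succ]
      simp
    · dsimp only
      rw [h (j + 1) i (by omega) (by omega) (by omega), Nat.add_sub_cancel, ← add_smul,
        show j + 1 + i = (i + j) + 1 by omega, pow_succ]
      simp
  · rintro ⟨i, j⟩ hx _
    dsimp only
    split_ifs with hij <;> simp only [ne_eq, Sigma.mk.injEq, heq_eq_eq, not_and] <;> omega
  · rintro ⟨i, j⟩ hx
    simp only [Finset.mem_sigma, Finset.mem_Ico] at hx
    dsimp only
    split_ifs with hij <;> simp only [Finset.mem_sigma, Finset.mem_Ico] <;> omega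
  · rintro ⟨i, j⟩ hx
    simp only [Finset.mem_sigma, Finset.mem_Ico] at hx
    dsimp only
    split_ifs with hij h2 h2 <;> dsimp only at * <;>
      simp only [Sigma.mk.injEq, heq_eq_eq, and_true, true_and] <;> omega

/-- Signs are compared by parity, which turns each sign check into propositional logic after
expanding `Even` of sums and products. -/
lemma neg_one_pow_eq {a b : ℕ} (h : Even a ↔ Even b) : (-1 : k) ^ a = (-1) ^ b := by
  by_cases ha : Even a
  · rw [ha.neg_one_pow, (h.1 ha).neg_one_pow]
  · rw [(Nat.not_even_iff_odd.1 ha).neg_one_pow,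
      (Nat.not_even_iff_odd.1 (fun hb => ha (h.2 hb))).neg_one_pow]

lemma neg_one_pow_eq_neg {a b : ℕ} (h : Even a ↔ ¬ Even b) : (-1 : k) ^ a = -(-1) ^ b := by
  rw [neg_one_pow_eq (b := b + 1) (by rw [h, Nat.even_add_one]), pow_succ, mul_neg_one]

end Sums

/-! ### The differential of the hat-cobar construction on all simplices, and its square. -/

section Bracket

variable (k : Type v) [CommRing k] {X : SSet.{u}}

lemma bracket_of_nonDegenerate {s : (Z X).S} (h : s.simplex ∈ (Z X).nonDegenerate s.dim)
    (h' : 0 < s.dim) : bracket k s = hatGen k (HatGen.bead s h h') :=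
  dif_pos ⟨h, h'⟩

lemma bracket_of_degenerate_edge {s : (Z X).S} (h : s.simplex ∈ (Z X).degenerate s.dim)
    (h' : s.dim = 1) : bracket k s = hatGen k (HatGen.unit (minV s)) := by
  rw [bracket, dif_neg fun hh => hh.1 h, if_pos h']

lemma bracket_of_degenerate {s : (Z X).S} (h : s.simplex ∈ (Z X).degenerate s.dim)
    (h' : s.dim ≠ 1) : bracket k s = 0 := by
  rw [bracket, dif_neg fun hh => hh.1 h, if_neg h']

lemma bracket_of_dim_eq_zero {s : (Z X).S} (h : s.dim = 0) : bracket k s = 0 := by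
  rw [bracket, dif_neg (by omega), if_neg (by omega)]

lemma cobarD_hatUnit (v : Vert (Z X)) : cobarD k (hatGen k (HatGen.unit v)) = 0 :=
  cobarD_hatGen k _

lemma hatSign_hatGen (g : HatGen X) : hatSign k (hatGen k g) = genSign k g • hatGen k g := by
  simp [hatSign, hatGen, hatLift_hatMk]

lemma hatSign_hatUnit (v : Vert (Z X)) :
    hatSign k (hatGen k (HatGen.unit v)) = hatGen k (HatGen.unit v) := by
  rw [hatSign_hatGen, genSign, one_smul]

lemma hatSign_bracket (s : (Z X).S) :
    hatSign k (bracket k s) = (-1 : k) ^ (s.dim - 1) • bracket k s := by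
  by_cases h : s.simplex ∈ (Z X).nonDegenerate s.dim
  · rcases Nat.eq_zero_or_pos s.dim with h0 | h0
    · rw [bracket_of_dim_eq_zero k h0, map_zero, smul_zero]
    · rw [bracket_of_nonDegenerate k h h0, hatSign_hatGen, genSign]
  · replace h := not_not.1 h
    by_cases h1 : s.dim = 1
    · rw [bracket_of_degenerate_edge k h h1, hatSign_hatUnit, h1, pow_zero, one_smul]
    · rw [bracket_of_degenerate k h h1, map_zero, smul_zero]

/-- The signed terms of the differential of `[s]`. -/
def splitTerm (s : (Z X).S) (i : ℕ) : HatPath k X :=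
  bracket k (fr s i) * bracket k (bk s i) - bracket k (dl s i)

/-- Only `∂ⱼ` and `∂ⱼ₊₁` undo the degeneracy. A cut contributes only if its degenerate part is an
edge, that is, at the last inner vertex for `j = dim s` or at the first one for `j = 0`; it then
equals `[s]` and cancels the face in the same term. -/
lemma splitTerm_dg (s : (Z X).S) {j i : ℕ} (hj : j ≤ s.dim) (h0 : 0 < i) (hi : i < s.dim + 1) :
    splitTerm k (dg s j) i =
      if i = j ∧ i < s.dim then - bracket k s
      else if i = j + 1 ∧ 1 < i then - bracket k s else 0 := by
  have hdl : bracket k (dl (dg s j) i) = if i = j ∨ i = j + 1 then bracket k s else 0 := by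
    split_ifs with h
    · rcases h with rfl | rfl
      · rw [dl_dg_self s hj]
      · rw [dl_dg_succ s hj]
    -- For all other `i` the face is degenerate of dimension at least 2, so its bracket is 0 and not
    -- a unit.
    · rcases lt_or_gt_of_ne (fun hh => h (Or.inl hh)) with hlt | hgt
      · rw [dl_dg_of_lt s hlt hj]
        refine bracket_of_degenerate k (dg_mem_degenerate _ ?_) ?_ <;>
          simp only [dl_dim, dg_dim] <;> omega
      · rw [dl_dg_of_gt s (by omega) (by omega)]
        refine bracket_of_degenerate k (dg_mem_degenerate _ ?_) ?_ <;>
          simp only [dl_dim, dg_dim] <;> omega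
  have hsp : bracket k (fr (dg s j) i) * bracket k (bk (dg s j) i) =
      if i = j ∧ i = s.dim ∨ i = j + 1 ∧ i = 1 then bracket k s else 0 := by
    rcases le_or_gt i j with hij | hij
    · rw [fr_dg_of_le s hij hj, bk_dg_of_le s hij hj]
      have hd : (dg (bk s i) (j - i)).simplex ∈ (Z X).degenerate (dg (bk s i) (j - i)).dim :=
        dg_mem_degenerate _ (by simp only [bk_dim]; omega)
      split_ifs with h
      · obtain rfl : i = s.dim := by omega
        rw [fr_dim_self, bracket_of_degenerate_edge k hd (by simp), ← bk_dg_of_le s hij hj,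
          minV_bk _ (by simp), fr_dg_of_le s hij hj, fr_dim_self, bracket_mul_hatUnit]
      · rw [bracket_of_degenerate k hd (by simp only [dg_dim, bk_dim]; omega), mul_zero]
    · rw [fr_dg_of_lt s hij (by omega), bk_dg_of_lt s hij (by omega)]
      have hd : (dg (fr s (i - 1)) j).simplex ∈ (Z X).degenerate (dg (fr s (i - 1)) j).dim :=
        dg_mem_degenerate _ (by simp only [fr_dim]; omega)
      split_ifs with h
      · obtain rfl : i = 1 := by omega
        rw [bk_zero, bracket_of_degenerate_edge k hd (by simp),
          ← maxV_eq_minV_of_degenerate _ (not_not.2 hd) (by simp), ← fr_dg_of_lt s hij (by omega),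
          ← minV_bk _ (by simp), bk_dg_of_lt s hij (by omega), bk_zero, hatUnit_mul_bracket]
      · rw [bracket_of_degenerate k hd (by simp only [dg_dim, fr_dim]; omega), zero_mul]
  rw [splitTerm, hdl, hsp]
  split_ifs <;> first | omega | simp

lemma sum_splitTerm_of_degenerate (s : (Z X).S) (h : s.simplex ∈ (Z X).degenerate s.dim) :
    ∑ i ∈ Finset.Ico 1 s.dim, (-1 : k) ^ i • splitTerm k s i = 0 := by
  obtain ⟨t, j, hj, rfl⟩ := exists_eq_dg h
  have hz : ∀ i ∈ Finset.Ico 1 (dg t j).dim, ¬ (i = j ∧ i < t.dim) → ¬ (i = j + 1 ∧ 1 < i) →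
      (-1 : k) ^ i • splitTerm k (dg t j) i = 0 := by
    intro i hi h1 h2
    simp only [dg_dim, Finset.mem_Ico] at hi
    rw [splitTerm_dg k t hj hi.1 hi.2, if_neg h1, if_neg h2, smul_zero]
  -- If `j` is an inner vertex of `t`, the terms `j` and `j + 1` survive with opposite signs;
  -- otherwise no term survives.
  by_cases hjt : 1 ≤ j ∧ j < t.dim
  · rw [Finset.sum_eq_add j (j + 1) (by omega) (fun i hi hne => hz i hi (by omega) (by omega))
      (fun hh => absurd (Finset.mem_Ico.2 ⟨hjt.1, by simp only [dg_dim]; omega⟩) hh)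
      (fun hh => absurd (Finset.mem_Ico.2 ⟨by omega, by simp only [dg_dim]; omega⟩) hh),
      splitTerm_dg k t hj (by omega) (by omega), splitTerm_dg k t hj (by omega) (by omega),
      if_pos ⟨rfl, hjt.2⟩, if_neg (by omega), if_pos (by omega), ← add_smul, pow_succ]
    simp
  · refine Finset.sum_eq_zero fun i hi => hz i hi ?_ ?_ <;>
      simp only [dg_dim, Finset.mem_Ico] at hi <;> omega

/-- For degenerate `s` this says that the conventions `[s] = 1` and `[s] = 0` are compatible with
the differential. It permits iterating the formula over faces that may be degenerate. -/
lemma cobarD_bracket (s : (Z X).S) :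
    cobarD k (bracket k s) = ∑ i ∈ Finset.Ico 1 s.dim, (-1 : k) ^ i • splitTerm k s i := by
  by_cases h : s.simplex ∈ (Z X).nonDegenerate s.dim
  · rcases Nat.eq_zero_or_pos s.dim with h0 | h0
    · rw [bracket_of_dim_eq_zero k h0, map_zero, h0]
      rfl
    · rw [bracket_of_nonDegenerate k h h0, cobarD_hatGen, genD, neg_add_eq_sub,
        ← Finset.sum_sub_distrib]
      refine sum_fin_filter _ (fun i => 0 < i ∧ i < s.dim) _ _
        (fun i => by simp only [Finset.mem_Ico]; omega) _ _ fun i _ => ?_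
      rw [← smul_sub, splitTerm, front_eq_fr, back_eq_bk, del_eq_dl _ _ h0]
  · rw [sum_splitTerm_of_degenerate k s (not_not.1 h)]
    by_cases h1 : s.dim = 1
    · rw [bracket_of_degenerate_edge k (not_not.1 h) h1, cobarD_hatUnit]
    · rw [bracket_of_degenerate k (not_not.1 h) h1, map_zero]

lemma cobarD_one : cobarD k (1 : HatPath k X) = 0 := by
  have h := cobarD_mul k (1 : HatPath k X) 1
  simpa using h

lemma cobarD_algebraMap (r : k) : cobarD k (algebraMap k (HatPath k X) r) = 0 := by
  rw [Algebra.algebraMap_eq_smul_one, map_smul, cobarD_one, smul_zero]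

@[elab_as_elim]
lemma hatPath_induction {motive : HatPath k X → Prop}
    (algebraMap : ∀ r, motive (algebraMap k _ r)) (gen : ∀ g, motive (hatGen k g))
    (mul : ∀ a b, motive a → motive b → motive (a * b))
    (add : ∀ a b, motive a → motive b → motive (a + b)) (a : HatPath k X) : motive a := by
  obtain ⟨a, rfl⟩ := hatMk_surjective k a
  induction a using FreeAlgebra.induction with
  | grade0 r => rw [AlgHom.commutes]; exact algebraMap r
  | grade1 g => exact gen g
  | mul a b ha hb => rw [map_mul]; exact mul _ _ ha hb
  | add a b ha hb => rw [map_add]; exact add _ _ ha hb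

/-- Replaces the generators by brackets, for which the formulas hold without a nondegeneracy
hypothesis. -/
lemma gen_induction {motive : HatPath k X → Prop}
    (unit : ∀ v, motive (hatGen k (HatGen.unit v))) (br : ∀ s, motive (bracket k s))
    (g : HatGen X) : motive (hatGen k g) := by
  cases g with
  | unit v => exact unit v
  | bead s hs pos => rw [← bracket_of_nonDegenerate k hs pos]; exact br s

/-- Both parts of the term have degree `dim s - 2`. -/
lemma hatSign_splitTerm (s : (Z X).S) {i : ℕ} (h0 : 0 < i) (hi : i < s.dim) :
    hatSign k (splitTerm k s i) = (-1 : k) ^ s.dim • splitTerm k s i := by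
  rw [splitTerm, map_sub, map_mul, hatSign_bracket, hatSign_bracket, hatSign_bracket,
    smul_mul_smul_comm, ← pow_add, smul_sub]
  simp only [fr_dim, bk_dim, dl_dim]
  obtain ⟨i, rfl⟩ : ∃ i', i = i' + 1 := ⟨i - 1, by omega⟩
  obtain ⟨m, hm⟩ : ∃ m, s.dim = i + m + 2 := ⟨s.dim - i - 2, by omega⟩
  rw [hm, show i + 1 - 1 + (i + m + 2 - (i + 1) - 1) = i + m by omega,
    show i + m + 2 - 1 - 1 = i + m by omega, pow_add _ (i + m) 2]
  simp

lemma hatSign_cobarD (a : HatPath k X) : hatSign k (cobarD k a) = - cobarD k (hatSign k a) := by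
  induction a using hatPath_induction with
  | algebraMap r => rw [AlgHom.commutes, cobarD_algebraMap, map_zero, neg_zero]
  | gen g =>
    refine gen_induction k (motive := fun a => hatSign k (cobarD k a) = - cobarD k (hatSign k a))
      (fun v => ?_) (fun s => ?_) g
    · rw [hatSign_hatUnit, cobarD_hatUnit, map_zero, neg_zero]
    · rw [hatSign_bracket, map_smul, cobarD_bracket, map_sum, Finset.smul_sum,
        ← Finset.sum_neg_distrib]
      refine Finset.sum_congr rfl fun i hi => ?_
      rw [Finset.mem_Ico] at hi
      rw [map_smul, hatSign_splitTerm k s hi.1 hi.2, smul_comm, ← neg_smul]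
      obtain ⟨m, hm⟩ : ∃ m, s.dim = m + 1 := ⟨s.dim - 1, by omega⟩
      rw [hm, pow_succ, Nat.add_sub_cancel, mul_neg_one]
  | mul a b ha hb =>
    rw [map_mul (hatSign k) a b, cobarD_mul, cobarD_mul, map_add, map_mul, map_mul, ha, hb]
    simp only [neg_mul, mul_neg, neg_add]
  | add a b ha hb => simp only [map_add, ha, hb, neg_add]

/-- Double cuts cancel by coassociativity, double faces by the simplicial identity, and a face
followed by a cut against a cut followed by a face of one of its parts. -/
lemma cobarD_cobarD_bracket (s : (Z X).S) : cobarD k (cobarD k (bracket k s)) = 0 := by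
  set p := s.dim with hp
  -- `g i m` is the double cut at `i < m`. `K i j` and `L i j` cut at `i` and then omit the vertex
  -- `j` of the back or front part. `H i j` cuts the face `∂ⱼ s` at `i`.
  let g : ℕ → ℕ → HatPath k X := fun i m =>
    (-1 : k) ^ (i + m) • (bracket k (fr s i) * bracket k (bk (fr s m) i) * bracket k (bk s m))
  let K : ℕ → ℕ → HatPath k X := fun i j =>
    (-1 : k) ^ j • (bracket k (fr s i) * bracket k (dl (bk s i) j))
  let L : ℕ → ℕ → HatPath k X := fun i j =>
    (-1 : k) ^ (i + j + 1) • (bracket k (dl (fr s i) j) * bracket k (bk s i))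
  let H : ℕ → ℕ → HatPath k X := fun i j =>
    (-1 : k) ^ (i + j) • (bracket k (fr (dl s j) i) * bracket k (bk (dl s j) i))
  have hterm : ∀ i ∈ Finset.Ico 1 p, cobarD k ((-1 : k) ^ i • splitTerm k s i) =
      ∑ j ∈ Finset.Ico 1 i, g j i + ∑ j ∈ Finset.Ico 1 i, L i j -
        ∑ j ∈ Finset.Ico 1 (p - i), g i (i + j) + ∑ j ∈ Finset.Ico 1 (p - i), K i j -
        ∑ j ∈ Finset.Ico 1 (p - 1), H j i +
        ∑ j ∈ Finset.Ico 1 (p - 1), (-1 : k) ^ (i + j) • bracket k (dl (dl s i) j) := by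
    intro i hi
    rw [Finset.mem_Ico] at hi
    have e1 : (-1 : k) ^ i • (cobarD k (bracket k (fr s i)) * bracket k (bk s i)) =
        ∑ j ∈ Finset.Ico 1 i, g j i + ∑ j ∈ Finset.Ico 1 i, L i j := by
      rw [cobarD_bracket, Finset.sum_mul, Finset.smul_sum, ← Finset.sum_add_distrib]
      refine Finset.sum_congr rfl fun j hj => ?_
      simp only [Finset.mem_Ico] at hj
      simp only [g, L]
      rw [splitTerm, fr_fr s hj.2.le, smul_mul_assoc, sub_mul, smul_smul, ← pow_add, smul_sub,
        add_comm j i, pow_succ, mul_neg_one, neg_smul, sub_eq_add_neg]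
    -- The sign `i - 1`, from moving the differential past the front bead, makes these double cuts
    -- opposite to those in `e1`.
    have e2 : (-1 : k) ^ i • (hatSign k (bracket k (fr s i)) * cobarD k (bracket k (bk s i))) =
        - ∑ j ∈ Finset.Ico 1 (p - i), g i (i + j) + ∑ j ∈ Finset.Ico 1 (p - i), K i j := by
      rw [cobarD_bracket, Finset.mul_sum, Finset.smul_sum, ← Finset.sum_neg_distrib,
        ← Finset.sum_add_distrib]
      refine Finset.sum_congr rfl fun j hj => ?_
      simp only [Finset.mem_Ico] at hj
      simp only [g, K]
      rw [splitTerm, fr_bk s (by omega), bk_bk s (by omega), hatSign_bracket,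
        smul_mul_smul_comm, smul_smul, mul_sub, ← mul_assoc, smul_sub, fr_dim, ← pow_add, ← pow_add,
        neg_one_pow_eq_neg (a := i + (i - 1) + j) (b := j), neg_one_pow_eq (a := i + (i + j)) (b := j),
        neg_smul, neg_smul, sub_neg_eq_add, mul_assoc]
      · simp [Nat.even_add]; tauto
      · obtain ⟨i, rfl⟩ : ∃ i', i = i' + 1 := ⟨i - 1, by omega⟩
        simp only [Nat.add_sub_cancel, Nat.even_add, Nat.not_even_one]; tauto
    have e3 : (-1 : k) ^ i • cobarD k (bracket k (dl s i)) = ∑ j ∈ Finset.Ico 1 (p - 1), H j i -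
        ∑ j ∈ Finset.Ico 1 (p - 1), (-1 : k) ^ (i + j) • bracket k (dl (dl s i) j) := by
      rw [cobarD_bracket, Finset.smul_sum, ← Finset.sum_sub_distrib]
      refine Finset.sum_congr rfl fun j hj => ?_
      simp only [H]
      rw [splitTerm, smul_smul, ← pow_add, smul_sub, add_comm j i]
    rw [map_smul, splitTerm, map_sub, cobarD_mul, smul_sub, smul_add, e1, e2, e3]
    abel
  have hH := sum_split_faces p 1 0 le_rfl zero_le_one H K L
    (fun i j _ hij hj => by
      simp only [H, K]
      rw [fr_dl_of_lt s hij (by omega), bk_dl_of_lt s hij (by omega)]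
      congr 1
      obtain ⟨m, rfl⟩ := Nat.exists_eq_add_of_lt hij
      refine neg_one_pow_eq ?_
      rw [show i + (i + m + 1) = 2 * i + (i + m + 1 - i) by omega]
      simp [Nat.even_add])
    (fun i j _ _ hij hi => by
      simp only [H, L]
      rw [fr_dl_of_le s hij (by omega), bk_dl_of_le s hij (by omega)]
      congr 1
      refine neg_one_pow_eq ?_
      rw [show i + 1 + j + 1 = i + j + 2 by omega]
      simp [Nat.even_add])
  have hD := sum_faces_faces (k := k) p (fun i j => bracket k (dl (dl s i) j)) (fun i j h1 h2 h3 => by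
    rw [dl_dl s h2 (by omega) (by omega)])
  have hg := sum_Ico_Ico_one 1 p g
  simp only [Nat.add_zero] at hH
  rw [cobarD_bracket, map_sum, Finset.sum_congr rfl hterm]
  simp only [Finset.sum_add_distrib, Finset.sum_sub_distrib]
  rw [hH, hD, hg]
  abel

/-- On products the cross terms of the square of the derivation cancel, because `hatSign`
anticommutes with `cobarD`. -/
lemma cobarD_cobarD (a : HatPath k X) : cobarD k (cobarD k a) = 0 := by
  induction a using hatPath_induction with
  | algebraMap r => rw [cobarD_algebraMap, map_zero]
  | gen g =>
    refine gen_induction k (motive := fun a => cobarD k (cobarD k a) = 0)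
      (fun v => ?_) (cobarD_cobarD_bracket k) g
    rw [cobarD_hatUnit, map_zero]
  | mul a b ha hb =>
    rw [cobarD_mul, map_add, cobarD_mul, cobarD_mul, ha, hb, hatSign_cobarD]
    simp
  | add a b ha hb => simp only [map_add, ha, hb, add_zero]

end Bracket

/-! ### The hat-coHochschild differential on tensors that close up, and its square. -/

section Formula

open TensorProduct ClosedNecklace

variable (k : Type v) [CommRing k] {X : SSet.{u}}

/-- The element `[s]` for a simplex `s` of `X`. -/
def br (s : X.S) : HatPath k X := bracket k (inclS s)

lemma br_of_degenerate {s : X.S} (h : s.simplex ∈ X.degenerate s.dim) (h' : s.dim ≠ 1) :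
    br k s = 0 :=
  bracket_of_degenerate k (SSet.degenerate_app_apply h (inclZ X)) h'

lemma br_of_degenerate_edge {s : X.S} (h : s.simplex ∈ X.degenerate s.dim) (h' : s.dim = 1) :
    br k s = hatGen k (HatGen.unit (inclV (minV s))) := by
  rw [br, bracket_of_degenerate_edge k (SSet.degenerate_app_apply h (inclZ X)) h', minV_inclS]

lemma minV_eq_maxV_of_degenerate {s : X.S} (h : s.simplex ∈ X.degenerate s.dim)
    (h' : s.dim = 1) : inclV (minV s) = inclV (maxV s) := by
  rw [← minV_inclS, ← maxV_inclS]
  exact (maxV_eq_minV_of_degenerate (inclS s)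
    (not_not.2 (SSet.degenerate_app_apply h (inclZ X))) h').symm

lemma hatUnit_mul_br (s : X.S) :
    hatGen k (HatGen.unit (inclV (minV s))) * br k s = br k s := by
  rw [← minV_inclS]; exact hatUnit_mul_bracket k _

lemma br_mul_hatUnit (s : X.S) :
    br k s * hatGen k (HatGen.unit (inclV (maxV s))) = br k s := by
  rw [← maxV_inclS]; exact bracket_mul_hatUnit k _

lemma hatSign_br (s : X.S) : hatSign k (br k s) = (-1 : k) ^ (s.dim - 1) • br k s :=
  hatSign_bracket k (inclS s)

lemma cobarD_br (s : X.S) : cobarD k (br k s) = ∑ i ∈ Finset.Ico 1 s.dim,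
    (-1 : k) ^ i • (br k (fr s i) * br k (bk s i) - br k (dl s i)) :=
  cobarD_bracket k (inclS s)

lemma chain_of_degenerate {s : X.S} (h : s.simplex ∈ X.degenerate s.dim) : chain k s = 0 :=
  dif_neg fun hh => hh h

/-- The elements of degree `q` modulo `2` which lead from the last to the first vertex of `s`. -/
structure Closes (s : X.S) (q : ℕ) (w : HatPath k X) : Prop where
  left : hatGen k (HatGen.unit (inclV (maxV s))) * w = w
  right : w * hatGen k (HatGen.unit (inclV (minV s))) = w
  sign : hatSign k w = (-1 : k) ^ q • w

variable {k}

namespace Closes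

variable {s : X.S} {q : ℕ} {w : HatPath k X}

/-- This lemma, `Closes.cobarD`, `Closes.fr` and `Closes.bk` cover the four kinds of summands of the
differential, so that `hatCoHochD_tmul` applies to each of them again. -/
lemma dl (h : Closes k s q w) {i : ℕ} (h0 : 0 < i) (hi : i < s.dim) : Closes k (dl s i) q w :=
  ⟨by rw [maxV_dl s hi]; exact h.left, by rw [minV_dl s h0 hi]; exact h.right, h.sign⟩

lemma cobarD (h : Closes k s q w) : Closes k s (q + 1) (cobarD k w) := by
  refine ⟨?_, ?_, ?_⟩
  · have := cobarD_mul k (hatGen k (HatGen.unit (inclV (maxV s)))) w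
    rw [h.left, cobarD_hatUnit, zero_mul, zero_add, hatSign_hatUnit] at this
    exact this.symm
  · have := cobarD_mul k w (hatGen k (HatGen.unit (inclV (minV s))))
    rw [h.right, cobarD_hatUnit, mul_zero, add_zero] at this
    exact this.symm
  · rw [hatSign_cobarD, h.sign, map_smul, pow_succ, mul_neg_one, neg_smul]

lemma fr (h : Closes k s q w) {i : ℕ} (hi : i ≤ s.dim) :
    Closes k (fr s i) (s.dim - i - 1 + q) (br k (bk s i) * w) := by
  refine ⟨?_, ?_, ?_⟩
  · rw [← mul_assoc, ← minV_bk s hi, hatUnit_mul_br]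
  · rw [mul_assoc, minV_fr s hi, h.right]
  · rw [map_mul, hatSign_br, h.sign, smul_mul_smul_comm, pow_add, bk_dim]

lemma bk (h : Closes k s q w) {i : ℕ} (hi : i ≤ s.dim) :
    Closes k (bk s i) (q + (i - 1)) (w * br k (HatNecklical.fr s i)) := by
  refine ⟨?_, ?_, ?_⟩
  · rw [← mul_assoc, maxV_bk s hi, h.left]
  · rw [mul_assoc, minV_bk s hi, br_mul_hatUnit]
  · rw [map_mul, hatSign_br, h.sign, smul_mul_smul_comm, pow_add, fr_dim]

/-- Evaluates the part of the sign of θ₂ that depends on the degree of `w`. -/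
lemma hatSign_pow (h : Closes k s q w) (n : ℕ) :
    (hatSign k ^ n : HatPath k X →ₐ[k] HatPath k X) w = (-1 : k) ^ (n * q) • w := by
  induction n with
  | zero => simp
  | succ n ih =>
    rw [pow_succ, AlgHom.mul_apply, h.sign, map_smul, ih, smul_smul, ← pow_add]
    congr 2
    ring

end Closes

variable (k)

/-- The value of the differential of the hat-coHochschild complex at `s ⊗ w`, where `w` has
degree `q`. -/
def hochFormula (s : X.S) (q : ℕ) (w : HatPath k X) : SChains k X ⊗[k] HatPath k X :=
  ∑ i ∈ Finset.Ico 1 s.dim, (-1 : k) ^ i • (chain k (dl s i) ⊗ₜ[k] w) +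
    (-1 : k) ^ s.dim • (chain k s ⊗ₜ[k] cobarD k w) -
    ∑ i ∈ Finset.Ico 0 s.dim, (-1 : k) ^ i • (chain k (fr s i) ⊗ₜ[k] (br k (bk s i) * w)) +
    ∑ i ∈ Finset.Ico 1 (s.dim + 1), (-1 : k) ^ ((i + 1) * (s.dim - i + q)) •
      (chain k (bk s i) ⊗ₜ[k] (w * br k (fr s i)))

variable {k}

lemma hatCoHochD_of_nonDegenerate {s : X.S} (hs : s.simplex ∈ X.nonDegenerate s.dim) {q : ℕ}
    {w : HatPath k X} (h : Closes k s q w) :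
    hatCoHochD k (chain k s ⊗ₜ[k] w) = hochFormula k s q w := by
  have hc : chain k s = sBasis k (SSet.N.mk' s hs) := dif_pos hs
  rw [hatCoHochD, LinearMap.add_apply, LinearMap.add_apply, LinearMap.add_apply, hochFormula,
    sub_eq_add_neg]
  refine congrArg₂ (· + ·) (congrArg₂ (· + ·) (congrArg₂ (· + ·) ?_ ?_) ?_) ?_
  · rw [TensorProduct.map_tmul, hc, innerD, Module.Basis.constr_basis, LinearMap.id_apply,
      TensorProduct.sum_tmul]
    refine sum_fin_filter _ (fun i => 0 < i ∧ i < s.dim) _ _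
      (fun i => by simp only [Finset.mem_Ico]; omega) _ _ fun i hi => ?_
    rw [TensorProduct.smul_tmul', del_eq_dl _ _ (by dsimp only; omega)]
  · rw [TensorProduct.map_tmul, hc, chainSign, Module.Basis.constr_basis, TensorProduct.smul_tmul']
  · rw [theta1, hc, TensorProduct.lift.tmul, Module.Basis.constr_basis, LinearMap.neg_apply,
      LinearMap.sum_apply]
    refine congrArg _ (sum_fin_filter _ (fun i => i < s.dim) _ _
      (fun i => by simp only [Finset.mem_Ico]; omega) _ _ fun i hi => ?_)
    rw [front_eq_fr, back_eq_bk]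
    rfl
  · rw [theta2, hc, TensorProduct.lift.tmul, Module.Basis.constr_basis,
      LinearMap.sum_apply]
    refine sum_fin_filter _ (fun i => 0 < i) _ _
      (fun i => by simp only [Finset.mem_Ico]; omega) _ _ fun i hi => ?_
    rw [front_eq_fr, back_eq_bk, LinearMap.smul_apply, LinearMap.comp_apply, LinearMap.comp_apply,
      AlgHom.toLinearMap_apply, h.hatSign_pow, map_smul, map_smul, smul_smul, ← pow_add, ← mul_add]
    rfl

/-- For `s = sⱼ t` each surviving term is `±(-1)ʲ t ⊗ w`: with + for `1 ≤ j` (from `∂ⱼ`) and for `j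
= 0` (from θ₂), with - for `j < dim t` (from `∂ⱼ₊₁`) and for `j = dim t` (from θ₁). Exactly one of
each sign occurs. -/
lemma hochFormula_of_degenerate {s : X.S} (hs : s.simplex ∈ X.degenerate s.dim) {q : ℕ}
    {w : HatPath k X} (h : Closes k s q w) : hochFormula k s q w = 0 := by
  obtain ⟨t, j, hj, rfl⟩ := exists_eq_dg hs
  set c := chain k t ⊗ₜ[k] w with hc
  have hA : ∑ i ∈ Finset.Ico 1 (dg t j).dim, (-1 : k) ^ i • (chain k (dl (dg t j) i) ⊗ₜ[k] w) =
      (if 1 ≤ j then (-1 : k) ^ j • c else 0) - (if j < t.dim then (-1 : k) ^ j • c else 0) := by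
    have hterm : ∀ i ∈ Finset.Ico 1 (dg t j).dim,
        (-1 : k) ^ i • (chain k (dl (dg t j) i) ⊗ₜ[k] w) =
          (if i = j then (-1 : k) ^ j • c else 0) - (if i = j + 1 then (-1 : k) ^ j • c else 0) := by
      intro i hi
      simp only [dg_dim, Finset.mem_Ico] at hi
      rcases lt_trichotomy i j with hlt | rfl | hgt
      · rw [dl_dg_of_lt t hlt hj, chain_of_degenerate k (dg_mem_degenerate _ (by
          simp only [dl_dim]; omega)), TensorProduct.zero_tmul, smul_zero, if_neg (by omega),
          if_neg (by omega), sub_zero]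
      · rw [dl_dg_self t hj, if_pos rfl, if_neg (by omega), sub_zero]
      · rw [if_neg (by omega), zero_sub]
        split_ifs with h1
        · subst h1
          rw [dl_dg_succ t hj, pow_succ, mul_neg_one, neg_smul]
        · rw [dl_dg_of_gt t (by omega) (by omega), chain_of_degenerate k (dg_mem_degenerate _ (by
            simp only [dl_dim]; omega)), TensorProduct.zero_tmul, smul_zero, neg_zero]
    rw [Finset.sum_congr rfl hterm, Finset.sum_sub_distrib, Finset.sum_ite_eq', Finset.sum_ite_eq']
    simp only [dg_dim, Finset.mem_Ico]
    congr 1 <;> refine if_congr ?_ rfl rfl <;> omega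
  have hC : ∑ i ∈ Finset.Ico 0 (dg t j).dim,
      (-1 : k) ^ i • (chain k (fr (dg t j) i) ⊗ₜ[k] (br k (bk (dg t j) i) * w)) =
        if j = t.dim then (-1 : k) ^ j • c else 0 := by
    have hz : ∀ i ∈ Finset.Ico 0 (dg t j).dim, ¬ (i = j ∧ j = t.dim) →
        (-1 : k) ^ i • (chain k (fr (dg t j) i) ⊗ₜ[k] (br k (bk (dg t j) i) * w)) = 0 := by
      intro i hi hne
      simp only [dg_dim, Finset.mem_Ico] at hi
      rcases le_or_gt i j with hij | hij
      · rw [bk_dg_of_le t hij hj, br_of_degenerate k (dg_mem_degenerate _ (by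
          simp only [bk_dim]; omega)) (by simp only [dg_dim, bk_dim]; omega), zero_mul,
          TensorProduct.tmul_zero, smul_zero]
      · rw [fr_dg_of_lt t hij (by omega), chain_of_degenerate k (dg_mem_degenerate _ (by
          simp only [fr_dim]; omega)), TensorProduct.zero_tmul, smul_zero]
    split_ifs with hjt
    · rw [Finset.sum_eq_single_of_mem j (by simp only [dg_dim, Finset.mem_Ico]; omega)
        (fun i hi hne => hz i hi (by omega))]
      have hd : (bk (dg t j) j).simplex ∈ X.degenerate (bk (dg t j) j).dim := by
        rw [bk_dg_of_le t le_rfl hj]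
        exact dg_mem_degenerate _ (by simp only [bk_dim]; omega)
      -- The back part is a degenerate edge at the last vertex; its bracket is a unit word, which
      -- fixes `w` because `w` starts there.
      rw [br_of_degenerate_edge k hd (by simp only [bk_dim, dg_dim]; omega),
        minV_eq_maxV_of_degenerate hd (by simp only [bk_dim, dg_dim]; omega),
        maxV_bk _ (by simp only [dg_dim]; omega), h.left, fr_dg_of_le t le_rfl hj]
      subst hjt
      rw [fr_dim_self]
    · exact Finset.sum_eq_zero fun i hi => hz i hi (by omega)
  have hE : ∑ i ∈ Finset.Ico 1 ((dg t j).dim + 1), (-1 : k) ^ ((i + 1) * ((dg t j).dim - i + q)) •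
      (chain k (bk (dg t j) i) ⊗ₜ[k] (w * br k (fr (dg t j) i))) =
        if j = 0 then (-1 : k) ^ j • c else 0 := by
    have hz : ∀ i ∈ Finset.Ico 1 ((dg t j).dim + 1), ¬ (i = 1 ∧ j = 0) →
        (-1 : k) ^ ((i + 1) * ((dg t j).dim - i + q)) •
          (chain k (bk (dg t j) i) ⊗ₜ[k] (w * br k (fr (dg t j) i))) = 0 := by
      intro i hi hne
      simp only [dg_dim, Finset.mem_Ico] at hi
      rcases le_or_gt i j with hij | hij
      · rw [bk_dg_of_le t hij hj, chain_of_degenerate k (dg_mem_degenerate _ (by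
          simp only [bk_dim]; omega)), TensorProduct.zero_tmul, smul_zero]
      · rw [fr_dg_of_lt t hij (by omega), br_of_degenerate k (dg_mem_degenerate _ (by
          simp only [fr_dim]; omega)) (by simp only [dg_dim, fr_dim]; omega), mul_zero,
          TensorProduct.tmul_zero, smul_zero]
    split_ifs with hj0
    · rw [Finset.sum_eq_single_of_mem 1 (by simp only [dg_dim, Finset.mem_Ico]; omega)
        (fun i hi hne => hz i hi (by omega))]
      subst hj0
      have hd : (fr (dg t 0) 1).simplex ∈ X.degenerate (fr (dg t 0) 1).dim := by
        rw [fr_dg_of_lt t zero_lt_one (by omega)]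
        exact dg_mem_degenerate _ (by simp only [fr_dim]; omega)
      -- The front part is a degenerate edge at the first vertex, where `w` ends. The sign exponent
      -- is a multiple of `i + 1 = 2`.
      rw [br_of_degenerate_edge k hd (by simp only [fr_dim]),
        minV_fr _ (by simp only [dg_dim]; omega), h.right, bk_dg_of_lt t zero_lt_one (by omega),
        Nat.sub_self, bk_zero, neg_one_pow_eq (b := 0)]
      simp
    · exact Finset.sum_eq_zero fun i hi => hz i hi (by omega)
  rw [hochFormula, hA, hC, hE, chain_of_degenerate k hs, TensorProduct.zero_tmul, smul_zero]
  split_ifs <;> first | omega | simp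

/-- Valid for degenerate `s` as well, where both sides are 0. -/
lemma hatCoHochD_tmul {s : X.S} {q : ℕ} {w : HatPath k X} (h : Closes k s q w) :
    hatCoHochD k (chain k s ⊗ₜ[k] w) = hochFormula k s q w := by
  by_cases hs : s.simplex ∈ X.nonDegenerate s.dim
  · exact hatCoHochD_of_nonDegenerate hs h
  · rw [hochFormula_of_degenerate (not_not.1 hs) h, chain_of_degenerate k (not_not.1 hs),
      TensorProduct.zero_tmul, map_zero]

-- The square of the differential vanishes by cancellation of matching pairs: repeated cuts from one
-- end against cuts of the resulting bead, cuts from both ends in the two orders, faces and cuts in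
-- the two orders, and terms with `cobarD k w` in the two orders. The rest are double faces and
-- `cobarD k (cobarD k w) = 0`.
set_option maxHeartbeats 1000000 in
lemma hochFormula_hochFormula {s : X.S} {q : ℕ} {w : HatPath k X} (h : Closes k s q w) :
    hatCoHochD k (hochFormula k s q w) = 0 := by
  set p := s.dim with hp
  -- The index 1 refers to cuts that move the back part in front of `w` (θ₁), the index 2 to cuts
  -- that move the front part behind `w` (θ₂). `G` are double cuts, `K` and `L` omit a vertex of the
  -- back or front part after a cut, `H` cuts a face, and `Q` combines a cut with the differential
  -- of `w`. In `R i m` the middle part from `i` to `m` remains as the first bead.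
  let G₁ : ℕ → ℕ → SChains k X ⊗[k] HatPath k X := fun i m =>
    (-1 : k) ^ (i + m) • (chain k (fr s i) ⊗ₜ[k] (br k (bk (fr s m) i) * (br k (bk s m) * w)))
  let K₁ : ℕ → ℕ → SChains k X ⊗[k] HatPath k X := fun i j =>
    (-1 : k) ^ j • (chain k (fr s i) ⊗ₜ[k] (br k (dl (bk s i) j) * w))
  let L₁ : ℕ → ℕ → SChains k X ⊗[k] HatPath k X := fun i j =>
    (-1 : k) ^ (i + j + 1) • (chain k (dl (fr s i) j) ⊗ₜ[k] (br k (bk s i) * w))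
  let H₁ : ℕ → ℕ → SChains k X ⊗[k] HatPath k X := fun i j =>
    (-1 : k) ^ (j + i) • (chain k (fr (dl s j) i) ⊗ₜ[k] (br k (bk (dl s j) i) * w))
  let Q₁ : ℕ → SChains k X ⊗[k] HatPath k X := fun i =>
    (-1 : k) ^ (p + i) • (chain k (fr s i) ⊗ₜ[k] (br k (bk s i) * cobarD k w))
  let G₂ : ℕ → ℕ → SChains k X ⊗[k] HatPath k X := fun i m =>
    (-1 : k) ^ (m * (p - m + q) + i) •
      (chain k (bk s m) ⊗ₜ[k] (w * (br k (fr s i) * br k (bk (fr s m) i))))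
  let K₂ : ℕ → ℕ → SChains k X ⊗[k] HatPath k X := fun i j =>
    (-1 : k) ^ ((i + 1) * (p - i + q) + j) • (chain k (dl (bk s i) j) ⊗ₜ[k] (w * br k (fr s i)))
  let L₂ : ℕ → ℕ → SChains k X ⊗[k] HatPath k X := fun i j =>
    (-1 : k) ^ (i * (p - i + q) + j + 1) • (chain k (bk s i) ⊗ₜ[k] (w * br k (dl (fr s i) j)))
  let H₂ : ℕ → ℕ → SChains k X ⊗[k] HatPath k X := fun i j =>
    (-1 : k) ^ (j + (i + 1) * (p - 1 - i + q)) •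
      (chain k (bk (dl s j) i) ⊗ₜ[k] (w * br k (fr (dl s j) i)))
  let Q₂ : ℕ → SChains k X ⊗[k] HatPath k X := fun i =>
    (-1 : k) ^ (p + (i + 1) * (p - i + (q + 1))) •
      (chain k (bk s i) ⊗ₜ[k] (cobarD k w * br k (fr s i)))
  let R : ℕ → ℕ → SChains k X ⊗[k] HatPath k X := fun i m =>
    (-1 : k) ^ ((i + 1) * (p - i + q) + (i + m)) •
      (chain k (bk (fr s m) i) ⊗ₜ[k] (br k (bk s m) * (w * br k (fr s i))))
  have hA : ∀ i ∈ Finset.Ico 1 p, hatCoHochD k ((-1 : k) ^ i • (chain k (dl s i) ⊗ₜ[k] w)) =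
      ∑ j ∈ Finset.Ico 1 (p - 1), (-1 : k) ^ (i + j) • (chain k (dl (dl s i) j) ⊗ₜ[k] w) -
        (-1 : k) ^ (p + i) • (chain k (dl s i) ⊗ₜ[k] cobarD k w) -
        ∑ j ∈ Finset.Ico 0 (p - 1), H₁ j i + ∑ j ∈ Finset.Ico 1 (p - 1 + 1), H₂ j i := by
    intro i hi
    rw [Finset.mem_Ico] at hi
    have e : (-1 : k) ^ i * (-1) ^ (p - 1) = -(-1) ^ (p + i) := by
      rw [← pow_add]
      obtain ⟨r, hr⟩ : ∃ r, p = r + 1 := ⟨p - 1, by omega⟩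
      rw [hr, Nat.add_sub_cancel]
      refine neg_one_pow_eq_neg ?_
      simp only [Nat.even_add, Nat.not_even_one]; clear * -; grind
    rw [map_smul, hatCoHochD_tmul (h.dl hi.1 hi.2), hochFormula]
    simp only [smul_add, smul_sub, Finset.smul_sum, smul_smul, dl_dim, ← hp, H₁, H₂, e, neg_smul]
    simp only [← pow_add]
    abel
  have hB : hatCoHochD k ((-1 : k) ^ p • (chain k s ⊗ₜ[k] cobarD k w)) =
      ∑ i ∈ Finset.Ico 1 p, (-1 : k) ^ (p + i) • (chain k (dl s i) ⊗ₜ[k] cobarD k w) -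
        ∑ i ∈ Finset.Ico 0 p, Q₁ i + ∑ i ∈ Finset.Ico 1 (p + 1), Q₂ i := by
    rw [map_smul, hatCoHochD_tmul h.cobarD, hochFormula, cobarD_cobarD, TensorProduct.tmul_zero,
      smul_zero, add_zero]
    simp only [smul_add, smul_sub, Finset.smul_sum, smul_smul, ← pow_add, Q₁, Q₂, ← hp]
  have hC : ∀ i ∈ Finset.Ico 0 p,
      hatCoHochD k ((-1 : k) ^ i • (chain k (fr s i) ⊗ₜ[k] (br k (bk s i) * w))) =
        - ∑ j ∈ Finset.Ico 1 i, L₁ i j +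
        (∑ j ∈ Finset.Ico 1 (p - i), G₁ i (i + j) - ∑ j ∈ Finset.Ico 1 (p - i), K₁ i j - Q₁ i) -
        ∑ j ∈ Finset.Ico 0 i, G₁ j i - ∑ j ∈ Finset.Ico 1 (i + 1), R j i := by
    intro i hi
    rw [Finset.mem_Ico] at hi
    have e1 : (-1 : k) ^ i • ∑ j ∈ Finset.Ico 1 i, (-1 : k) ^ j •
        (chain k (dl (fr s i) j) ⊗ₜ[k] (br k (bk s i) * w)) = - ∑ j ∈ Finset.Ico 1 i, L₁ i j := by
      rw [Finset.smul_sum, ← Finset.sum_neg_distrib]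
      refine Finset.sum_congr rfl fun j _ => ?_
      rw [smul_smul, ← pow_add, ← neg_smul]
      congr 1
      rw [pow_succ, mul_neg_one, neg_neg]
    -- The front part has dimension `i`, so the sign of 1 ⊗ d cancels the sign of θ₁. The Leibniz
    -- rule for `[bk s i] w` yields cuts, faces and `Q₁`.
    have e2 : (-1 : k) ^ i • (-1 : k) ^ i • (chain k (fr s i) ⊗ₜ[k] cobarD k (br k (bk s i) * w)) =
        ∑ j ∈ Finset.Ico 1 (p - i), G₁ i (i + j) - ∑ j ∈ Finset.Ico 1 (p - i), K₁ i j - Q₁ i := by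
      rw [smul_smul, ← pow_add, (Even.add_self i).neg_one_pow, one_smul, cobarD_mul, cobarD_br,
        hatSign_br, TensorProduct.tmul_add, Finset.sum_mul, TensorProduct.tmul_sum,
        ← Finset.sum_sub_distrib, sub_eq_add_neg _ (Q₁ i)]
      congr 1
      · refine Finset.sum_congr rfl fun j hj => ?_
        simp only [Finset.mem_Ico] at hj
        rw [fr_bk s (by omega), bk_bk s (by omega), smul_mul_assoc, sub_mul, TensorProduct.tmul_smul,
          TensorProduct.tmul_sub, smul_sub, mul_assoc]
        simp only [G₁, K₁]
        rw [neg_one_pow_eq (a := i + (i + j)) (b := j)]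
        simp only [Nat.even_add]; clear * -; grind
      · simp only [Q₁]
        rw [smul_mul_assoc, TensorProduct.tmul_smul, ← neg_smul, bk_dim]
        congr 1
        obtain ⟨r, hr⟩ : ∃ r, p = i + r + 1 := ⟨p - i - 1, by omega⟩
        rw [← hp, hr, show i + r + 1 - i - 1 = r by omega]
        refine neg_one_pow_eq_neg ?_
        simp only [Nat.even_add, Nat.not_even_one]; clear * -; grind
    have e3 : (-1 : k) ^ i • ∑ j ∈ Finset.Ico 0 i, (-1 : k) ^ j • (chain k (fr (fr s i) j) ⊗ₜ[k]
        (br k (bk (fr s i) j) * (br k (bk s i) * w))) = ∑ j ∈ Finset.Ico 0 i, G₁ j i := by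
      rw [Finset.smul_sum]
      refine Finset.sum_congr rfl fun j hj => ?_
      rw [Finset.mem_Ico] at hj
      rw [smul_smul, ← pow_add, fr_fr s hj.2.le, add_comm i j]
    have e4 : (-1 : k) ^ i • ∑ j ∈ Finset.Ico 1 (i + 1),
        (-1 : k) ^ ((j + 1) * (i - j + (p - i - 1 + q))) •
          (chain k (bk (fr s i) j) ⊗ₜ[k] (br k (bk s i) * w * br k (fr (fr s i) j))) =
        - ∑ j ∈ Finset.Ico 1 (i + 1), R j i := by
      rw [Finset.smul_sum, ← Finset.sum_neg_distrib]
      refine Finset.sum_congr rfl fun j hj => ?_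
      rw [Finset.mem_Ico] at hj
      simp only [R]
      rw [smul_smul, ← pow_add, ← neg_smul, fr_fr s (by omega), mul_assoc]
      congr 1
      obtain ⟨r, hr⟩ : ∃ r, i = j + r := ⟨i - j, by omega⟩
      obtain ⟨t, ht⟩ : ∃ t, p = i + t + 1 := ⟨p - i - 1, by omega⟩
      rw [show p - i - 1 = t by omega, show i - j = r by omega, show p - j = r + t + 1 by omega, hr]
      refine neg_one_pow_eq_neg ?_
      simp only [Nat.even_add, Nat.even_mul, Nat.not_even_one]; clear * -; grind
    rw [map_smul, hatCoHochD_tmul (h.fr hi.2.le), hochFormula]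
    simp only [fr_dim, ← hp]
    rw [smul_add, smul_sub, smul_add, e1, e2, e3, e4]
    abel
  have hE : ∀ i ∈ Finset.Ico 1 (p + 1), hatCoHochD k ((-1 : k) ^ ((i + 1) * (p - i + q)) •
      (chain k (bk s i) ⊗ₜ[k] (w * br k (fr s i)))) =
        ∑ j ∈ Finset.Ico 1 (p - i), K₂ i j +
        (∑ j ∈ Finset.Ico 1 i, G₂ j i + ∑ j ∈ Finset.Ico 1 i, L₂ i j - Q₂ i) -
        ∑ j ∈ Finset.Ico 0 (p - i), R i (i + j) - ∑ j ∈ Finset.Ico 1 (p + 1 - i), G₂ i (i + j) := by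
    intro i hi
    rw [Finset.mem_Ico] at hi
    -- These substitutions remove truncated subtraction from the exponents before parities are
    -- compared.
    obtain ⟨u, hu⟩ : ∃ u, i = u + 1 := ⟨i - 1, by omega⟩
    obtain ⟨r, hr⟩ : ∃ r, p = i + r := ⟨p - i, by omega⟩
    have hpi : p - i = r := by omega
    have e1 : (-1 : k) ^ ((i + 1) * (p - i + q)) • ∑ j ∈ Finset.Ico 1 (p - i), (-1 : k) ^ j •
        (chain k (dl (bk s i) j) ⊗ₜ[k] (w * br k (fr s i))) =
          ∑ j ∈ Finset.Ico 1 (p - i), K₂ i j := by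
      rw [Finset.smul_sum]
      refine Finset.sum_congr rfl fun j _ => ?_
      rw [smul_smul, ← pow_add]
    have e2 : (-1 : k) ^ ((i + 1) * (p - i + q)) • (-1 : k) ^ (p - i) •
        (chain k (bk s i) ⊗ₜ[k] cobarD k (w * br k (fr s i))) =
        ∑ j ∈ Finset.Ico 1 i, G₂ j i + ∑ j ∈ Finset.Ico 1 i, L₂ i j - Q₂ i := by
      rw [smul_smul, ← pow_add, cobarD_mul, cobarD_br, h.sign, TensorProduct.tmul_add,
        smul_mul_assoc, TensorProduct.tmul_smul, Finset.mul_sum, TensorProduct.tmul_sum, smul_add,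
        smul_smul, ← pow_add, Finset.smul_sum, ← Finset.sum_add_distrib, add_comm, sub_eq_add_neg]
      congr 1
      · refine Finset.sum_congr rfl fun j hj => ?_
        simp only [Finset.mem_Ico] at hj
        rw [fr_fr s hj.2.le, mul_smul_comm, TensorProduct.tmul_smul, mul_sub, TensorProduct.tmul_sub,
          smul_smul, ← pow_add, smul_sub, sub_eq_add_neg, ← neg_smul]
        simp only [G₂, L₂, hpi]
        congr 2
        · refine neg_one_pow_eq ?_
          simp only [Nat.even_add, Nat.even_mul, Nat.not_even_one]; clear * -; grind
        · rw [pow_succ, mul_neg_one]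
          refine congrArg _ (neg_one_pow_eq ?_)
          simp only [Nat.even_add, Nat.even_mul, Nat.not_even_one]; clear * -; grind
      · simp only [Q₂]
        rw [← neg_smul, hpi]
        congr 1
        refine neg_one_pow_eq_neg ?_
        rw [hr]
        simp only [Nat.even_add, Nat.even_mul, Nat.not_even_one]; clear * -; grind
    have e3 : (-1 : k) ^ ((i + 1) * (p - i + q)) • ∑ j ∈ Finset.Ico 0 (p - i), (-1 : k) ^ j •
        (chain k (fr (bk s i) j) ⊗ₜ[k] (br k (bk (bk s i) j) * (w * br k (fr s i)))) =
          ∑ j ∈ Finset.Ico 0 (p - i), R i (i + j) := by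
      rw [Finset.smul_sum]
      refine Finset.sum_congr rfl fun j hj => ?_
      rw [Finset.mem_Ico] at hj
      simp only [R]
      rw [smul_smul, ← pow_add, fr_bk s (by omega), bk_bk s (by omega)]
      congr 1
      refine neg_one_pow_eq ?_
      simp only [Nat.even_add, Nat.even_mul, Nat.not_even_one]; clear * -; grind
    have e4 : (-1 : k) ^ ((i + 1) * (p - i + q)) • ∑ j ∈ Finset.Ico 1 (p - i + 1),
        (-1 : k) ^ ((j + 1) * (p - i - j + (q + (i - 1)))) •
          (chain k (bk (bk s i) j) ⊗ₜ[k] (w * br k (fr s i) * br k (fr (bk s i) j))) =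
        - ∑ j ∈ Finset.Ico 1 (p + 1 - i), G₂ i (i + j) := by
      rw [Finset.smul_sum, ← Finset.sum_neg_distrib, show p + 1 - i = p - i + 1 by omega]
      refine Finset.sum_congr rfl fun j hj => ?_
      rw [Finset.mem_Ico] at hj
      simp only [G₂]
      rw [smul_smul, ← pow_add, ← neg_smul, fr_bk s (by omega), bk_bk s (by omega), mul_assoc]
      congr 1
      obtain ⟨t, ht⟩ : ∃ t, r = j + t := ⟨r - j, by omega⟩
      rw [show p - i = j + t by omega, show j + t - j = t by omega, show p - (i + j) = t by omega,
        hu, Nat.add_sub_cancel]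
      refine neg_one_pow_eq_neg ?_
      simp only [Nat.even_add, Nat.even_mul, Nat.not_even_one]; clear * -; grind
    rw [map_smul, hatCoHochD_tmul (h.bk (by omega)), hochFormula]
    simp only [bk_dim, ← hp]
    rw [smul_add, smul_sub, smul_add, e1, e2, e3, e4]
    abel
  have hDD := sum_faces_faces (k := k) p (fun i j => chain k (dl (dl s i) j) ⊗ₜ[k] w)
    (fun i j h1 h2 h3 => by rw [dl_dl s h2 (by omega) (by omega)])
  have hH₁ := sum_split_faces p 0 0 zero_le_one zero_le_one H₁ K₁ L₁
    (fun i j _ hij hj => by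
      simp only [H₁, K₁]
      rw [fr_dl_of_lt s hij (by omega), bk_dl_of_lt s hij (by omega)]
      congr 1
      obtain ⟨m, rfl⟩ := Nat.exists_eq_add_of_lt hij
      rw [show i + m + 1 - i = m + 1 by omega]
      refine neg_one_pow_eq ?_
      simp only [Nat.even_add, Nat.not_even_one]; clear * -; grind)
    (fun i j _ _ hij hi => by
      simp only [H₁, L₁]
      rw [fr_dl_of_le s hij (by omega), bk_dl_of_le s hij (by omega)]
      congr 1
      refine neg_one_pow_eq ?_
      simp only [Nat.even_add, Nat.not_even_one]; clear * -; grind)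
  -- `H₂`, `K₂` and `L₂` all enter the square with the sign +, so `H₂` must be the negative of the
  -- others. The function is negated to fit the lemma.
  have hH₂ := sum_split_faces p 1 1 le_rfl le_rfl (fun i j => - H₂ i j) K₂ L₂
    (fun i j _ hij hj => by
      simp only [H₂, K₂]
      rw [fr_dl_of_lt s hij (by omega), bk_dl_of_lt s hij (by omega), ← neg_smul]
      congr 1
      obtain ⟨m, rfl⟩ := Nat.exists_eq_add_of_lt hij
      obtain ⟨r, hr⟩ := Nat.exists_eq_add_of_lt hj
      rw [show i + m + 1 - i = m + 1 by omega, show p - 1 - i = m + r + 1 by omega,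
        show p - i = m + r + 2 by omega, eq_comm]
      refine neg_one_pow_eq_neg ?_
      simp only [Nat.even_add, Nat.even_mul, Nat.not_even_one, even_two]; clear * -; grind)
    (fun i j _ _ hij hi => by
      simp only [H₂, L₂]
      rw [fr_dl_of_le s hij (by omega), bk_dl_of_le s hij (by omega), ← neg_smul]
      congr 1
      rw [show p - (i + 1) = p - 1 - i by omega, pow_succ, mul_neg_one]
      refine congrArg _ (neg_one_pow_eq ?_)
      simp only [Nat.even_add, Nat.even_mul, Nat.not_even_one]; clear * -; grind)
  have hG₁ := sum_Ico_Ico_one 0 p G₁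
  have hG₂ := sum_Ico_Ico_one 1 (p + 1) G₂
  have hR := sum_Ico_Ico_zero p R
  simp only [Nat.add_zero, Finset.sum_neg_distrib] at hH₁ hH₂
  rw [hochFormula, map_add, map_sub, map_add, map_sum, map_sum, map_sum, Finset.sum_congr rfl hA,
    hB, Finset.sum_congr rfl hC, Finset.sum_congr rfl hE]
  simp only [Finset.sum_add_distrib, Finset.sum_sub_distrib, Finset.sum_neg_distrib]
  rw [hDD, hH₁, neg_eq_iff_eq_neg.1 hH₂, hG₁, hG₂, hR]
  abel

end Formula

/-! ### Concatenation of paths and degenerate edges. -/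

section Words

variable {Y : SSet.{u}}

lemma isPath_append_iff {a b : Vert Y} {u w : List Y.S} :
    IsPath a (u ++ w) b ↔ ∃ c, IsPath a u c ∧ IsPath c w b := by
  induction u generalizing a with
  | nil => simp [IsPath]
  | cons s u ih =>
    simp only [List.cons_append, IsPath, ih]
    constructor
    · rintro ⟨h1, h2, c, h3, h4⟩
      exact ⟨c, ⟨h1, h2, h3⟩, h4⟩
    · rintro ⟨c, ⟨h1, h2, h3⟩, h4⟩
      exact ⟨h1, h2, c, h3, h4⟩

lemma isPath_middle_congr {a b : Vert Y} {u m m' w : List Y.S}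
    (h : ∀ c d, IsPath c m d ↔ IsPath c m' d) :
    IsPath a (u ++ m ++ w) b ↔ IsPath a (u ++ m' ++ w) b := by
  simp only [isPath_append_iff, h]

lemma IsPath.pos {a b : Vert Y} {w : List Y.S} (h : IsPath a w b) {s : Y.S} (hs : s ∈ w) :
    0 < s.dim := by
  induction w generalizing a with
  | nil => simp at hs
  | cons t w ih =>
    rcases List.mem_cons.1 hs with rfl | hs
    · exact h.1
    · exact ih h.2.2 hs

lemma vertex_mk_zero (v : Vert Y) (j : Fin 1) : vertex (SSet.S.mk v : Y.S) j = v := by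
  have h : SimplexCategory.const (SimplexCategory.mk 0) (SimplexCategory.mk 0) j = 𝟙 _ :=
    Subsingleton.elim _ _
  change Y.map (SimplexCategory.const (SimplexCategory.mk 0) (SimplexCategory.mk 0) j).op v = v
  rw [h, op_id, Y.map_id]
  rfl

@[simp] lemma minV_unitEdge (v : Vert Y) : minV (unitEdge v) = v :=
  (vertex_map (SSet.S.mk v) (SimplexCategory.σ 0) _).trans (vertex_mk_zero v _)

@[simp] lemma maxV_unitEdge (v : Vert Y) : maxV (unitEdge v) = v :=
  (vertex_map (SSet.S.mk v) (SimplexCategory.σ 0) _).trans (vertex_mk_zero v _)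

@[simp] lemma unitEdge_dim (v : Vert Y) : (unitEdge v).dim = 1 := rfl

/-- Hence a degenerate edge is recovered from the unit word that represents it, as the inverse map
requires. -/
lemma eq_unitEdge_of_degenerate {s : Y.S} (hs : s.simplex ∈ Y.degenerate s.dim)
    (h1 : s.dim = 1) : s = unitEdge (minV s) := by
  obtain ⟨⟨v⟩, j, hj, rfl⟩ := exists_eq_dg hs
  rename_i n
  simp only [dg_dim] at h1
  obtain rfl : n = 0 := by omega
  obtain rfl : j = 0 := by simpa using hj
  have h : dg (SSet.S.mk v) 0 = unitEdge v := (dgn_eq_dg (SSet.S.mk v) 0).symm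
  rw [h, minV_unitEdge]

lemma unitEdge_degenerate (v : Vert Y) :
    (unitEdge v).simplex ∈ Y.degenerate (unitEdge v).dim :=
  SSet.σ_mem_degenerate _ _ _

end Words

/-! ### Vertices and nondegeneracy of the formally inverted edges. -/

section OpEdges

variable {X : SSet.{u}}

/-- No map from `[0]` to `[1]` is surjective, so no vertices are added. Degenerate edges are
therefore old as well. -/
lemma exists_old (z : ZObj X (op (SimplexCategory.mk 0))) : ∃ x, z = ZObj.old x := by
  rcases z with x | ⟨e, f, hf⟩
  · exact ⟨x, rfl⟩
  · obtain ⟨i, hi⟩ := hf 0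
    obtain ⟨j, hj⟩ := hf 1
    have hij : i = j := Subsingleton.elim (α := Fin 1) i j
    exact absurd (hi.symm.trans ((congrArg _ hij).trans hj)) (by decide)

lemma exists_old_of_degenerate {z : ZObj X (op (SimplexCategory.mk 1))}
    (hz : z ∈ (Z X).degenerate 1) : ∃ x ∈ X.degenerate 1, z = ZObj.old x := by
  obtain ⟨m, hm, f, y, rfl⟩ := hz
  obtain rfl : m = 0 := by omega
  obtain ⟨x, rfl⟩ := exists_old y
  exact ⟨X.map f.op x, ⟨0, hm, f, x, rfl⟩, rfl⟩

lemma edge_nonDegenerate (e : X.nonDegenerate 1) :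
    (edge e).simplex ∈ (Z X).nonDegenerate (edge e).dim := by
  intro h
  obtain ⟨x, hx, h⟩ := exists_old_of_degenerate h
  have : e.1 = x := ZObj.old.inj h
  exact e.2 (this ▸ hx)

lemma opEdge_nonDegenerate (e : X.nonDegenerate 1) :
    (opEdge e).simplex ∈ (Z X).nonDegenerate (opEdge e).dim := by
  intro h
  obtain ⟨x, hx, h⟩ := exists_old_of_degenerate h
  change ZObj.added e _ _ = ZObj.old x at h
  cases h

lemma addedSimplex_const (e : X.nonDegenerate 1) (i : Fin 2) :
    addedSimplex e (n := op (SimplexCategory.mk 0))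
      (SimplexCategory.const (SimplexCategory.mk 0) (SimplexCategory.mk 1) i) =
    ZObj.old (X.map (SimplexCategory.const (SimplexCategory.mk 0) (SimplexCategory.mk 1)
      (Fin.rev i)).op e.1) := by
  rw [addedSimplex, dif_neg]
  · rfl
  · intro hs
    obtain ⟨_, h0⟩ := hs 0
    obtain ⟨_, h1⟩ := hs 1
    exact absurd (h0.symm.trans h1) (by decide)

lemma vertex_opEdge (e : X.nonDegenerate 1) (i : Fin 2) :
    vertex (opEdge e) i = vertex (edge e) (Fin.rev i) := by
  exact addedSimplex_const e i

/-- Both brackets are therefore generators, and the relation `HatRel.inv` applies to them. -/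
lemma OpPair.nonDegenerate {a b : (Z X).S} (h : OpPair a b) :
    a.simplex ∈ (Z X).nonDegenerate a.dim ∧ b.simplex ∈ (Z X).nonDegenerate b.dim := by
  cases h with
  | edge_op e => exact ⟨edge_nonDegenerate e, opEdge_nonDegenerate e⟩
  | op_edge e => exact ⟨opEdge_nonDegenerate e, edge_nonDegenerate e⟩

lemma minV_opEdge (e : X.nonDegenerate 1) : minV (opEdge e) = maxV (edge e) :=
  vertex_opEdge e 0

lemma maxV_opEdge (e : X.nonDegenerate 1) : maxV (opEdge e) = minV (edge e) :=
  vertex_opEdge e 1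

lemma OpPair.endpoints {a b : (Z X).S} (h : OpPair a b) : minV b = maxV a ∧ maxV b = minV a := by
  cases h with
  | edge_op e => exact ⟨minV_opEdge e, maxV_opEdge e⟩
  | op_edge e => exact ⟨(maxV_opEdge e).symm, (minV_opEdge e).symm⟩

end OpEdges

/-! ### Products of brackets along a word, and their differential. -/

section Products

variable (k : Type v) [CommRing k] {X : SSet.{u}}

/-- The element `[s₁|…|sᵣ]`. -/
def wordProd (w : List (Z X).S) : HatPath k X := (w.map (bracket k)).prod

lemma wordProd_nil : wordProd k ([] : List (Z X).S) = 1 := rfl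

lemma wordProd_cons (s : (Z X).S) (w : List (Z X).S) :
    wordProd k (s :: w) = bracket k s * wordProd k w := by
  rw [wordProd, List.map_cons, List.prod_cons, wordProd]

lemma wordProd_append (u w : List (Z X).S) :
    wordProd k (u ++ w) = wordProd k u * wordProd k w := by
  rw [wordProd, List.map_append, List.prod_append, wordProd, wordProd]

lemma wordProd_singleton (s : (Z X).S) : wordProd k [s] = bracket k s := by
  rw [wordProd_cons, wordProd_nil, mul_one]

lemma bracket_unitEdge (v : Vert (Z X)) :
    bracket k (unitEdge v) = hatGen k (HatGen.unit v) := by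
  rw [bracket_of_degenerate_edge k (unitEdge_degenerate v) rfl, minV_unitEdge]

lemma hatUnit_mul_wordProd {a b : Vert (Z X)} {w : List (Z X).S} (h : IsPath a w b) (hw : w ≠ []) :
    hatGen k (HatGen.unit a) * wordProd k w = wordProd k w := by
  cases w with
  | nil => exact absurd rfl hw
  | cons s w => rw [wordProd_cons, ← mul_assoc, ← h.2.1, hatUnit_mul_bracket]

lemma wordProd_mul_hatUnit {a b : Vert (Z X)} {w : List (Z X).S} (h : IsPath a w b) (hw : w ≠ []) :
    wordProd k w * hatGen k (HatGen.unit b) = wordProd k w := by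
  induction w generalizing a with
  | nil => exact absurd rfl hw
  | cons s w ih =>
    rw [wordProd_cons, mul_assoc]
    cases w with
    | nil =>
      obtain rfl : maxV s = b := h.2.2
      rw [wordProd_nil, one_mul, mul_one, bracket_mul_hatUnit]
    | cons t w => rw [ih h.2.2 (by simp)]

lemma hatSign_wordProd (w : List (Z X).S) :
    hatSign k (wordProd k w) = (-1 : k) ^ wordDeg w • wordProd k w := by
  induction w with
  | nil => rw [wordProd_nil, map_one, wordDeg, List.map_nil, List.sum_nil, pow_zero, one_smul]
  | cons s w ih =>
    rw [wordProd_cons, map_mul, hatSign_bracket, ih, smul_mul_smul_comm, ← pow_add, wordDeg_cons]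

/-- The Leibniz rule, where the sign for passing a letter `s` equals the shift by `dim s - 1` in the
numbering of inner vertices. -/
lemma cobarD_wordProd {w : List (Z X).S} (hw : ∀ s ∈ w, 0 < s.dim) :
    cobarD k (wordProd k w) = ∑ i ∈ Finset.Ico 1 (wordDeg w + 1),
      (-1 : k) ^ i • (wordProd k (wordSplit w i) - wordProd k (wordDel w i)) := by
  induction w with
  | nil => rw [wordProd_nil, cobarD_one]; rfl
  | cons s w ih =>
    have hs : 0 < s.dim := hw s (by simp)
    rw [wordProd_cons, cobarD_mul, ih fun t ht => hw t (by simp [ht]), cobarD_bracket, wordDeg_cons,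
      ← Finset.sum_Ico_consecutive _ (show 1 ≤ s.dim by omega)
        (show s.dim ≤ s.dim - 1 + wordDeg w + 1 by omega)]
    congr 1
    · rw [Finset.sum_mul]
      refine Finset.sum_congr rfl fun i hi => ?_
      rw [Finset.mem_Ico] at hi
      rw [wordSplit, wordDel, dif_pos hi.2, dif_pos hi.2, front_eq_fr, back_eq_bk, del_eq_dl _ _ hs,
        splitTerm, smul_mul_assoc, sub_mul]
      simp only [wordProd_cons, mul_assoc]
    · rw [hatSign_bracket, Finset.mul_sum]
      refine Finset.sum_nbij' (fun i => i + (s.dim - 1)) (fun i => i - (s.dim - 1)) ?_ ?_ ?_ ?_ ?_ <;>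
        simp only [Finset.mem_Ico] <;> intro i hi
      · omega
      · omega
      · omega
      · omega
      · rw [wordSplit, wordDel, dif_neg (by omega), dif_neg (by omega), Nat.add_sub_cancel,
          wordProd_cons, wordProd_cons, smul_mul_smul_comm, ← pow_add, mul_sub, add_comm i]

end Products

/-! ### The comparison map and its compatibility with the differentials. -/

section Comparison

open TensorProduct ClosedNecklace

variable (k : Type v) [CommRing k] {X : SSet.{u}} {n : ℕ}

/-- The element `x ⊗ [s₁|…|sᵣ]` of the hat-coHochschild complex. -/
def hochElt (r : ClosedNecklace X n) : SChains k X ⊗[k] HatPath k X :=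
  chain k r.first ⊗ₜ[k] wordProd k r.word

lemma closes_wordProd (r : ClosedNecklace X n) :
    Closes k r.first (wordDeg r.word) (wordProd k r.word) :=
  ⟨hatUnit_mul_wordProd k r.path r.word_ne, wordProd_mul_hatUnit k r.path r.word_ne,
    hatSign_wordProd k r.word⟩

lemma hochElt_of_isDegenerate {r : ClosedNecklace X n} (h : r.IsDegenerate) : hochElt k r = 0 := by
  rcases h with h | ⟨s, hs, h2, h⟩
  · rw [hochElt, chain_of_degenerate k h, TensorProduct.zero_tmul]
  · have : wordProd k r.word = 0 := by
      obtain ⟨u, w, huw⟩ := List.append_of_mem hs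
      rw [huw, wordProd_append, wordProd_cons, bracket_of_degenerate k h (by omega), zero_mul,
        mul_zero]
    rw [hochElt, this, TensorProduct.tmul_zero]

lemma hochElt_eq_of_rel {r r' : ClosedNecklace X n}
    (h : Rel (r.first, r.word) (r'.first, r'.word)) : hochElt k r = hochElt k r' := by
  have hzero : ∀ q q' : ClosedNecklace X n, q.IsDegenerate → q'.IsDegenerate →
      hochElt k q = hochElt k q' := by
    intro q q' h1 h2
    rw [hochElt_of_isDegenerate k h1, hochElt_of_isDegenerate k h2]
  obtain ⟨x, w, h1, h2, h3⟩ := r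
  obtain ⟨x', w', h1', h2', h3'⟩ := r'
  dsimp only at h
  cases h with
  | unit _ u v w hne =>
    simp only [hochElt, wordProd_append, wordProd_singleton, bracket_unitEdge]
    congr 1
    rw [List.append_assoc, isPath_append_iff] at h2
    obtain ⟨c, hu, -, hc, hw⟩ := h2
    rw [minV_unitEdge] at hc
    subst hc
    rw [maxV_unitEdge] at hw
    change IsPath v w _ at hw
    -- The unit word is absorbed by whichever neighbouring part is nonempty. With no other letter
    -- this would fail, since the empty product is the global 1 and not the unit word at `v`.
    by_cases hwn : w = []
    · subst hwn
      rw [wordProd_mul_hatUnit k hu (by simpa using hne)]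
    · rw [mul_assoc, hatUnit_mul_wordProd k hw hwn]
  | inv _ u a b w hab =>
    obtain ⟨ha, hb⟩ := hab.nonDegenerate
    have ha' : 0 < a.dim := by rw [hab.dim_eq.1]; exact one_pos
    have hb' : 0 < b.dim := by rw [hab.dim_eq.2]; exact one_pos
    simp only [hochElt, wordProd_append, wordProd_cons, wordProd_nil, mul_one, bracket_unitEdge]
    rw [bracket_of_nonDegenerate k ha ha', bracket_of_nonDegenerate k hb hb',
      bead_mul_bead k ha ha' hb hb' hab]
  | slide _ u s t w =>
    -- Each simplex that is made degenerate is itself a letter on the other side of the relation, so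
    -- it has positive dimension and its degeneracy has dimension at least 2. Both necklaces are
    -- then degenerate.
    refine hzero _ _ (Or.inr ⟨dgn s (Fin.last _), by simp, ?_, SSet.σ_mem_degenerate _ _ _⟩)
      (Or.inr ⟨dgn t 0, by simp, ?_, SSet.σ_mem_degenerate _ _ _⟩)
    · exact Nat.succ_le_succ (h2'.pos (s := s) (by simp))
    · exact Nat.succ_le_succ (h2.pos (s := t) (by simp))
  | slide_first _ s w =>
    refine hzero _ _ (Or.inl (SSet.σ_mem_degenerate _ _ _))
      (Or.inr ⟨dgn s 0, by simp, ?_, SSet.σ_mem_degenerate _ _ _⟩)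
    exact Nat.succ_le_succ (h2.pos (s := s) (by simp))
  | slide_last _ w s =>
    refine hzero _ _ (Or.inr ⟨dgn s (Fin.last _), by simp, ?_, SSet.σ_mem_degenerate _ _ _⟩)
      (Or.inl (SSet.σ_mem_degenerate _ _ _))
    exact Nat.succ_le_succ (h2'.pos (s := s) (by simp))

/-- The element of the hat-coHochschild complex which corresponds to an element of the closed
necklical set. -/
def hochLambda (c : LambdaHat X n) : SChains k X ⊗[k] HatPath k X :=
  Quot.lift (hochElt k) (fun _ _ h => hochElt_eq_of_rel k h) c

variable (X n)

/-- The comparison map from the chains of the closed necklical set to the hat-coHochschild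
complex. -/
def toHoch : Chains k X n →ₗ[k] SChains k X ⊗[k] HatPath k X :=
  (degenerateChains k X n).liftQ (Finsupp.linearCombination k (hochLambda k))
    (by
      refine Submodule.span_le.2 ?_
      rintro _ ⟨r, hr, rfl⟩
      rw [SetLike.mem_coe, LinearMap.mem_ker, Finsupp.linearCombination_single, one_smul]
      exact hochElt_of_isDegenerate k hr)

variable {X n}

lemma toHoch_cls (r : ClosedNecklace X n) : toHoch k X n (cls k r) = hochElt k r := by
  refine (Submodule.liftQ_apply _ _ _).trans ?_
  rw [Finsupp.linearCombination_single, one_smul]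
  rfl

lemma cls_of_isDegenerate {r : ClosedNecklace X n} (h : r.IsDegenerate) : cls k r = 0 :=
  (Submodule.Quotient.mk_eq_zero _).2 (Submodule.subset_span ⟨r, h, rfl⟩)

/-- Reduces identities between linear maps on chains to single necklaces, degenerate ones included.
-/
lemma chains_hom_ext {M : Type*} [AddCommGroup M] [Module k M] {f g : Chains k X n →ₗ[k] M}
    (h : ∀ r, f (cls k r) = g (cls k r)) : f = g := by
  refine Submodule.linearMap_qext _ (Finsupp.lhom_ext' fun c => LinearMap.ext_ring ?_)
  obtain ⟨r, rfl⟩ := Quot.exists_rep c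
  exact h r

lemma chainsD_cls (r : ClosedNecklace X (n + 1)) : chainsD k X n (cls k r) = repBoundary k r := by
  refine (Submodule.liftQ_apply _ _ _).trans ?_
  rw [Finsupp.linearCombination_single, one_smul]
  rfl

lemma hochElt_d2 (r : ClosedNecklace X (n + 1)) (i : Fin r.first.dim) :
    hochElt k (r.d2 i) = chain k (bk r.first (i.1 + 1)) ⊗ₜ[k]
      (wordProd k r.word * br k (fr r.first (i.1 + 1))) := by
  simp only [hochElt, d2, wordProd_append, wordProd_singleton, back_eq_bk, front_eq_fr]
  rfl

lemma hochElt_d0_of_lt (r : ClosedNecklace X (n + 1)) {i : Fin (n + 1)} (h : i.1 < r.first.dim) :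
    hochElt k (r.d0 i) = chain k (fr r.first i.1) ⊗ₜ[k]
      (br k (bk r.first i.1) * wordProd k r.word) := by
  rw [d0, dif_pos h, hochElt]
  simp only [wordProd_cons, back_eq_bk, front_eq_fr]
  rfl

lemma hochElt_d0_of_not_lt (r : ClosedNecklace X (n + 1)) {i : Fin (n + 1)}
    (h : ¬ i.1 < r.first.dim) : hochElt k (r.d0 i) =
      chain k r.first ⊗ₜ[k] wordProd k (wordSplit r.word (i.1 + 1 - r.first.dim)) := by
  rw [d0, dif_neg h, hochElt]

lemma hochElt_d1_zero (r : ClosedNecklace X (n + 1)) {i : Fin (n + 1)} (h : i.1 < r.first.dim)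
    (h0 : i.1 = 0) : hochElt k (r.d1 i) = chain k (bk r.first 1) ⊗ₜ[k]
      (wordProd k r.word * br k (fr r.first 1)) := by
  rw [d1, dif_pos h, dif_pos h0, hochElt_d2]

lemma hochElt_d1_of_lt (r : ClosedNecklace X (n + 1)) {i : Fin (n + 1)} (h : i.1 < r.first.dim)
    (h0 : i.1 ≠ 0) : hochElt k (r.d1 i) = chain k (dl r.first i.1) ⊗ₜ[k] wordProd k r.word := by
  rw [d1, dif_pos h, dif_neg h0, hochElt]
  simp only [del_eq_dl _ _ (Nat.zero_lt_of_lt h)]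

lemma hochElt_d1_of_not_lt (r : ClosedNecklace X (n + 1)) {i : Fin (n + 1)}
    (h : ¬ i.1 < r.first.dim) : hochElt k (r.d1 i) =
      chain k r.first ⊗ₜ[k] wordProd k (wordDel r.word (i.1 + 1 - r.first.dim)) := by
  rw [d1, dif_neg h, hochElt]

lemma toHoch_faceSum (r : ClosedNecklace X (n + 1)) :
    toHoch k X n (faceSum k r) = hatCoHochD k (hochElt k r) := by
  rw [hochElt, hatCoHochD_tmul (closes_wordProd k r), hochFormula,
    cobarD_wordProd k fun s hs => r.path.pos hs]
  have hn : r.first.dim + wordDeg r.word = n + 1 := r.deg_eq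
  set p := r.first.dim with hp
  set q := wordDeg r.word with hq
  let a : ℕ → SChains k X ⊗[k] HatPath k X := fun i =>
    chain k (fr r.first i) ⊗ₜ[k] (br k (bk r.first i) * wordProd k r.word)
  let b : ℕ → SChains k X ⊗[k] HatPath k X := fun i =>
    chain k (bk r.first i) ⊗ₜ[k] (wordProd k r.word * br k (fr r.first i))
  let c : ℕ → SChains k X ⊗[k] HatPath k X := fun i =>
    chain k (dl r.first i) ⊗ₜ[k] wordProd k r.word
  let e : ℕ → SChains k X ⊗[k] HatPath k X := fun i =>
    chain k r.first ⊗ₜ[k] (wordProd k (wordSplit r.word i) - wordProd k (wordDel r.word i))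
  -- Indices below `p` belong to the first bead and the others to the word. At index 0 the face d¹₁
  -- = d²₁ contributes the first term `b 1` of θ₂.
  have hd : ∀ i : Fin (n + 1), toHoch k X n
      ((-1 : k) ^ (i.1 + 1) • (cls k (r.d0 i) - cls k (r.d1 i))) =
        if i.1 < p then - ((-1 : k) ^ i.1 • a i.1) + (-1 : k) ^ i.1 • (if i.1 = 0 then b 1 else c i.1)
        else (-1 : k) ^ (i.1 + 1) • e (i.1 + 1 - p) := by
    intro i
    rw [map_smul, map_sub, toHoch_cls, toHoch_cls]
    split_ifs with h h0
    · rw [hochElt_d0_of_lt k r h, hochElt_d1_zero k r h h0, pow_succ, mul_neg_one, neg_smul,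
        smul_sub]
      abel
    · rw [hochElt_d0_of_lt k r h, hochElt_d1_of_lt k r h h0, pow_succ, mul_neg_one, neg_smul,
        smul_sub]
      abel
    · rw [hochElt_d0_of_not_lt k r h, hochElt_d1_of_not_lt k r h, ← TensorProduct.tmul_sub]
  have h2 : toHoch k X n (∑ i : Fin p with 0 < i.1, (-1 : k) ^ (i.1 * (n + 1)) • cls k (r.d2 i)) =
      ∑ i ∈ Finset.Ico 1 p, (-1 : k) ^ (i * (n + 1)) • b (i + 1) := by
    rw [map_sum]
    refine sum_fin_filter _ (fun i => 0 < i) _ _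
      (fun i => by simp only [Finset.mem_Ico]; omega) _ _ fun i hi => ?_
    rw [map_smul, toHoch_cls, hochElt_d2]
  have h3 : (-1 : k) ^ p • (chain k r.first ⊗ₜ[k] ∑ i ∈ Finset.Ico 1 (q + 1),
      (-1 : k) ^ i • (wordProd k (wordSplit r.word i) - wordProd k (wordDel r.word i))) =
        ∑ i ∈ Finset.Ico p (n + 1), (-1 : k) ^ (i + 1) • e (i + 1 - p) := by
    rw [TensorProduct.tmul_sum, Finset.smul_sum]
    refine Finset.sum_nbij' (fun i => i + p - 1) (fun i => i + 1 - p) ?_ ?_ ?_ ?_ ?_ <;>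
      simp only [Finset.mem_Ico] <;> intro i hi
    · omega
    · omega
    · omega
    · omega
    · rw [show i + p - 1 + 1 = p + i by omega, Nat.add_sub_cancel_left, TensorProduct.tmul_smul,
        smul_smul, ← pow_add]
  rw [faceSum, map_add, h2, map_sum, Finset.sum_congr rfl fun i _ => hd i,
    Fin.sum_univ_eq_sum_range (fun i => if i < p then - ((-1 : k) ^ i • a i) +
      (-1 : k) ^ i • (if i = 0 then b 1 else c i) else (-1 : k) ^ (i + 1) • e (i + 1 - p)),
    Finset.range_eq_Ico, ← Finset.sum_Ico_consecutive _ (Nat.zero_le p) (by omega : p ≤ n + 1), h3,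
    Finset.sum_congr rfl (fun i hi => if_pos (Finset.mem_Ico.1 hi).2),
    Finset.sum_congr (s₁ := Finset.Ico p (n + 1)) rfl
      (fun i hi => if_neg (not_lt.2 (Finset.mem_Ico.1 hi).1)),
    Finset.sum_add_distrib, Finset.sum_neg_distrib]
  change _ = ∑ i ∈ Finset.Ico 1 p, (-1 : k) ^ i • c i + _ -
    ∑ i ∈ Finset.Ico 0 p, (-1 : k) ^ i • a i +
      ∑ i ∈ Finset.Ico 1 (p + 1), (-1 : k) ^ ((i + 1) * (p - i + q)) • b i
  rcases Nat.eq_zero_or_pos p with h0 | h0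
  · simp [h0]
  · have h4 : ∑ i ∈ Finset.Ico 0 p, (-1 : k) ^ i • (if i = 0 then b 1 else c i) =
        b 1 + ∑ i ∈ Finset.Ico 1 p, (-1 : k) ^ i • c i := by
      rw [Finset.sum_eq_sum_Ico_succ_bot h0, if_pos rfl, pow_zero, one_smul]
      congr 1
      refine Finset.sum_congr rfl fun i hi => ?_
      rw [if_neg (by have := Finset.mem_Ico.1 hi; omega)]
    -- The first term of θ₂ has an even exponent. For the others, with `N = p + q`, the exponent `(i
    -- + 1)(N - i)` has the parity of `(i - 1)N`, since `i(i + 1)` is even; the summation index is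
    -- then shifted by one.
    have h5 : ∑ i ∈ Finset.Ico 1 (p + 1), (-1 : k) ^ ((i + 1) * (p - i + q)) • b i =
        b 1 + ∑ i ∈ Finset.Ico 1 p, (-1 : k) ^ (i * (n + 1)) • b (i + 1) := by
      rw [Finset.sum_eq_sum_Ico_succ_bot (by omega), ← Finset.sum_Ico_add' _ 1 p 1,
        (Even.mul_right (⟨1, rfl⟩ : Even (1 + 1)) _).neg_one_pow, one_smul]
      congr 1
      refine Finset.sum_congr rfl fun i hi => ?_
      rw [Finset.mem_Ico] at hi
      congr 1
      obtain ⟨t, ht⟩ : ∃ t, p = i + 1 + t := ⟨p - i - 1, by omega⟩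
      rw [← hn, show p - (i + 1) = t by omega, ht]
      refine neg_one_pow_eq ?_
      simp only [Nat.even_add, Nat.even_mul, Nat.not_even_one]; clear * -; grind
    rw [h4, h5]
    abel

end Comparison

/-! ### The inverse of the comparison map and the transfer of the differential. -/

section Inverse

open TensorProduct ClosedNecklace

variable (k : Type v) [CommRing k] {X : SSet.{u}} {n : ℕ}

/-- Having equal values under `f` in every two-sided context is a ring congruence. It contains the
relations, so it identifies whatever the quotient identifies; the empty context gives the claim.
This is needed because `f` is only linear, so the universal property for algebra maps does not apply
to it. -/
lemma eq_of_hatMk_eq {M : Type*} [AddCommGroup M] [Module k M]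
    (f : FreeAlgebra k (HatGen X) →ₗ[k] M)
    (hf : ∀ ⦃a b⦄, HatRel k a b → ∀ c d, f (c * a * d) = f (c * b * d))
    {a b : FreeAlgebra k (HatGen X)} (h : hatMk k a = hatMk k b) : f a = f b := by
  let C : RingCon (FreeAlgebra k (HatGen X)) :=
    { r := fun a b => ∀ c d, f (c * a * d) = f (c * b * d)
      iseqv := ⟨fun _ _ _ => rfl, fun h c d => (h c d).symm, fun h h' c d => (h c d).trans (h' c d)⟩
      add' := fun h h' c d => by rw [mul_add, add_mul, map_add, h, h', ← map_add, ← add_mul, ← mul_add]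
      mul' := fun {w x y z} h h' c d => by
        rw [← mul_assoc, mul_assoc (c * w), h, ← mul_assoc, h', ← mul_assoc] }
  let g : HatPath k X →ₐ[k] C.Quotient :=
    hatLift k (RingCon.mkₐ k C) fun a b hab => (RingCon.eq C).2 (hf hab)
  have hg : ∀ a, g (hatMk k a) = (a : C.Quotient) := fun a => hatLift_hatMk k _ _ a
  have hab : C a b := (RingCon.eq C).1 (by rw [← hg, ← hg, h])
  simpa using hab 1 1

/-- The linear map on the path algebra induced by a linear map on the free algebra which respects
the relations. -/
def linLift {M : Type*} [AddCommGroup M] [Module k M] (f : FreeAlgebra k (HatGen X) →ₗ[k] M)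
    (hf : ∀ ⦃a b⦄, HatRel k a b → ∀ c d, f (c * a * d) = f (c * b * d)) : HatPath k X →ₗ[k] M :=
  (LinearMap.ker (hatMk k (X := X)).toLinearMap).liftQ f (fun a ha => by
      have := eq_of_hatMk_eq k f hf (ha.trans (map_zero (hatMk k)).symm)
      rwa [map_zero] at this) ∘ₗ
    ((hatMk k (X := X)).toLinearMap.quotKerEquivOfSurjective (hatMk_surjective k)).symm.toLinearMap

lemma linLift_hatMk {M : Type*} [AddCommGroup M] [Module k M]
    (f : FreeAlgebra k (HatGen X) →ₗ[k] M)
    (hf : ∀ ⦃a b⦄, HatRel k a b → ∀ c d, f (c * a * d) = f (c * b * d))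
    (a : FreeAlgebra k (HatGen X)) : linLift k f hf (hatMk k a) = f a := by
  rw [linLift, LinearMap.comp_apply]
  have : ((hatMk k (X := X)).toLinearMap.quotKerEquivOfSurjective (hatMk_surjective k)).symm
      (hatMk k a) = Submodule.Quotient.mk a := by
    rw [LinearEquiv.symm_apply_eq]
    rfl
  refine (congrArg _ this).trans ?_
  exact Submodule.liftQ_apply _ _ _

/-- The monomial of a list of generators. -/
def monomial (l : List (HatGen X)) : FreeAlgebra k (HatGen X) := (l.map (FreeAlgebra.ι k)).prod

lemma monomial_append (l l' : List (HatGen X)) :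
    monomial k (l ++ l') = monomial k l * monomial k l' := by
  rw [monomial, List.map_append, List.prod_append, monomial, monomial]

lemma basisFreeMonoid_apply (l : List (HatGen X)) :
    FreeAlgebra.basisFreeMonoid k (HatGen X) (FreeMonoid.ofList l) = monomial k l := by
  rw [FreeAlgebra.basisFreeMonoid, Module.Basis.map_apply, Finsupp.coe_basisSingleOne]
  change MonoidAlgebra.lift k (FreeAlgebra k (HatGen X)) (FreeMonoid (HatGen X))
    (FreeMonoid.lift (FreeAlgebra.ι k)) (MonoidAlgebra.single (FreeMonoid.ofList l) 1) = _
  rw [MonoidAlgebra.lift_single, one_smul, FreeMonoid.lift_ofList, monomial]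

/-- The linear map on the free algebra with given values on the monomials. -/
def monomialLift {M : Type*} [AddCommGroup M] [Module k M] (g : List (HatGen X) → M) :
    FreeAlgebra k (HatGen X) →ₗ[k] M :=
  (FreeAlgebra.basisFreeMonoid k (HatGen X)).constr k fun l => g l.toList

lemma monomialLift_monomial {M : Type*} [AddCommGroup M] [Module k M] (g : List (HatGen X) → M)
    (l : List (HatGen X)) : monomialLift k g (monomial k l) = g l := by
  rw [← basisFreeMonoid_apply, monomialLift, Module.Basis.constr_basis]
  rfl

lemma mul_mul_eq_of_monomial {M : Type*} [AddCommGroup M] [Module k M]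
    (f : FreeAlgebra k (HatGen X) →ₗ[k] M) (a b : FreeAlgebra k (HatGen X))
    (h : ∀ l l', f (monomial k l * a * monomial k l') = f (monomial k l * b * monomial k l'))
    (c d : FreeAlgebra k (HatGen X)) : f (c * a * d) = f (c * b * d) := by
  have h1 : ∀ l d, f (monomial k l * a * d) = f (monomial k l * b * d) := by
    intro l d
    have : f ∘ₗ LinearMap.mulLeft k (monomial k l * a) =
        f ∘ₗ LinearMap.mulLeft k (monomial k l * b) := by
      refine (FreeAlgebra.basisFreeMonoid k (HatGen X)).ext fun l' => ?_
      rw [← FreeMonoid.ofList_toList l', basisFreeMonoid_apply]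
      exact h l _
    exact LinearMap.congr_fun this d
  have : f ∘ₗ LinearMap.mulRight k (a * d) = f ∘ₗ LinearMap.mulRight k (b * d) := by
    refine (FreeAlgebra.basisFreeMonoid k (HatGen X)).ext fun l' => ?_
    rw [← FreeMonoid.ofList_toList l', basisFreeMonoid_apply]
    simp only [LinearMap.comp_apply, LinearMap.mulRight_apply, ← mul_assoc]
    exact h1 _ d
  have := LinearMap.congr_fun this c
  simpa only [LinearMap.comp_apply, LinearMap.mulRight_apply, ← mul_assoc] using this

open Classical in
/-- The chain represented by a simplex and a word, which is `0` if these do not form a closed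
necklace of dimension `n`. -/
def necklaceChain (x : X.S) (n : ℕ) (w : List (Z X).S) : Chains k X n :=
  if h : w ≠ [] ∧ IsPath (inclV (maxV x)) w (inclV (minV x)) ∧ x.dim + wordDeg w = n then
    cls k ⟨x, w, h.1, h.2.1, h.2.2⟩
  else 0

lemma necklaceChain_eq (r : ClosedNecklace X n) :
    necklaceChain k r.first n r.word = cls k r :=
  dif_pos ⟨r.word_ne, r.path, r.deg_eq⟩

/-- The hypotheses on paths and degrees ensure that both words form closed necklaces of dimension
`n` or neither does. -/
lemma necklaceChain_eq_of_rel {x : X.S} {w w' : List (Z X).S} (h : Rel (x, w) (x, w'))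
    (hne : w ≠ []) (hne' : w' ≠ [])
    (hp : IsPath (inclV (maxV x)) w (inclV (minV x)) ↔ IsPath (inclV (maxV x)) w' (inclV (minV x)))
    (hd : wordDeg w = wordDeg w') : necklaceChain k x n w = necklaceChain k x n w' := by
  by_cases hc : IsPath (inclV (maxV x)) w (inclV (minV x)) ∧ x.dim + wordDeg w = n
  · rw [necklaceChain, dif_pos ⟨hne, hc⟩, necklaceChain, dif_pos ⟨hne', hp.1 hc.1, hd ▸ hc.2⟩]
    exact cls_eq k h
  · rw [necklaceChain, dif_neg fun hh => hc hh.2, necklaceChain,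
      dif_neg fun hh => hc ⟨hp.2 hh.2.1, hd ▸ hh.2.2⟩]

lemma necklaceChain_of_not_isPath {x : X.S} {w : List (Z X).S}
    (h : ¬ IsPath (inclV (maxV x)) w (inclV (minV x))) : necklaceChain k x n w = 0 :=
  dif_neg fun hh => h hh.2.1

lemma necklaceChain_unit (x : X.S) (u : List (Z X).S) (v : Vert (Z X)) (w : List (Z X).S)
    (h : u ++ w ≠ [])
    (hp : IsPath (inclV (maxV x)) (u ++ [unitEdge v] ++ w) (inclV (minV x)) ↔
      IsPath (inclV (maxV x)) (u ++ w) (inclV (minV x))) :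
    necklaceChain k x n (u ++ [unitEdge v] ++ w) = necklaceChain k x n (u ++ w) := by
  refine necklaceChain_eq_of_rel k (Rel.unit x u v w h) (by simp) h hp ?_
  have h0 : wordDeg [unitEdge v] = 0 := rfl
  rw [wordDeg_append, wordDeg_append, wordDeg_append, h0, add_zero]

/-- The simplex of a generator. -/
def genSimplex (g : HatGen X) : (Z X).S :=
  match g with
  | HatGen.unit v => unitEdge v
  | HatGen.bead s _ _ => s

/-- The word of a list of generators, preceded by a constant edge. -/
def genWord (x : X.S) (l : List (HatGen X)) : List (Z X).S :=
  unitEdge (inclV (maxV x)) :: l.map genSimplex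

lemma genWord_append (x : X.S) (l l' : List (HatGen X)) :
    genWord x (l ++ l') = genWord x l ++ l'.map genSimplex := by
  simp [genWord]

lemma genWord_ne_nil (x : X.S) (l : List (HatGen X)) : genWord x l ≠ [] := by simp [genWord]

variable (n) in
/-- The linear map on the free algebra which sends a word to the chain of a closed necklace with
first bead `x`. -/
def freeNecklace (x : X.S) : FreeAlgebra k (HatGen X) →ₗ[k] Chains k X n :=
  monomialLift k fun l => necklaceChain k x n (genWord x l)

/-- The relations with units become deletions of constant edges, the inverse relation is `Rel.inv`,
and orthogonality of units holds because non-composable words are sent to 0. The constant edge in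
front of each word keeps it nonempty, even for the empty monomial. -/
lemma freeNecklace_rel (x : X.S) {a b : FreeAlgebra k (HatGen X)} (h : HatRel k a b)
    (c d : FreeAlgebra k (HatGen X)) :
    freeNecklace k n x (c * a * d) = freeNecklace k n x (c * b * d) := by
  refine mul_mul_eq_of_monomial k _ a b (fun l l' => ?_) c d
  have h2 : ∀ g g' : HatGen X, freeNecklace k n x
      (monomial k l * (FreeAlgebra.ι k g * FreeAlgebra.ι k g') * monomial k l') =
        necklaceChain k x n (genWord x l ++ [genSimplex g, genSimplex g'] ++ l'.map genSimplex) := by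
    intro g g'
    have : FreeAlgebra.ι k g * FreeAlgebra.ι k g' = monomial k [g, g'] := by simp [monomial]
    rw [this, ← monomial_append, ← monomial_append, freeNecklace, monomialLift_monomial,
      genWord_append, genWord_append]
    rfl
  have h1 : ∀ g : HatGen X, freeNecklace k n x
      (monomial k l * FreeAlgebra.ι k g * monomial k l') =
        necklaceChain k x n (genWord x l ++ [genSimplex g] ++ l'.map genSimplex) := by
    intro g
    have : FreeAlgebra.ι k g = monomial k [g] := by simp [monomial]
    rw [this, ← monomial_append, ← monomial_append, freeNecklace, monomialLift_monomial,
      genWord_append, genWord_append]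
    rfl
  have hl := genWord_ne_nil x l
  have hu : ∀ (u : Vert (Z X)) (s : (Z X).S), 0 < s.dim → minV s = u →
      necklaceChain k x n (genWord x l ++ [unitEdge u, s] ++ l'.map genSimplex) =
        necklaceChain k x n (genWord x l ++ [s] ++ l'.map genSimplex) := by
    intro u s hs hm
    have := necklaceChain_unit k (n := n) x (genWord x l) u ([s] ++ l'.map genSimplex) (by simp) (by
      have := isPath_middle_congr (a := inclV (maxV x)) (b := inclV (minV x)) (u := genWord x l)
        (m := [unitEdge u, s]) (m' := [s]) (w := l'.map genSimplex)
        (fun c d => by simp [IsPath, hs, hm])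
      simpa using this)
    simpa using this
  cases h with
  | unit_mul_self v =>
    rw [freeUnit, h2, h1]
    exact hu v (unitEdge v) one_pos (minV_unitEdge v)
  | unit_mul_unit v w hvw =>
    rw [freeUnit, freeUnit, h2, mul_zero, zero_mul, map_zero]
    refine necklaceChain_of_not_isPath k ?_
    simp only [isPath_append_iff]
    -- A path through consecutive constant edges at `v` and `w` would force `v = w`.
    rintro ⟨_, ⟨_, _, h⟩, _⟩
    simp [genSimplex, IsPath] at h
    exact hvw (by tauto)
  | unit_mul s hs pos =>
    rw [freeUnit, freeBead, h2, h1]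
    exact hu _ s pos rfl
  | mul_unit s hs pos =>
    rw [freeUnit, freeBead, h2, h1]
    have := necklaceChain_unit k (n := n) x (genWord x l ++ [s]) (maxV s) (l'.map genSimplex)
      (by simp) (by
        have := isPath_middle_congr (a := inclV (maxV x)) (b := inclV (minV x)) (u := genWord x l)
          (m := [s, unitEdge (maxV s)]) (m' := [s]) (w := l'.map genSimplex)
          (fun c d => by simp [IsPath])
        simpa using this)
    simpa [genSimplex] using this
  | inv a b ha ha' hb hb' hab =>
    rw [freeUnit, freeBead, freeBead, h2, h1]
    refine necklaceChain_eq_of_rel k (Rel.inv x _ a b _ hab) (by simp) (by simp)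
      (isPath_middle_congr fun c d => ?_) ?_
    · simp [IsPath, genSimplex, ha', hb', hab.endpoints]
    · simp [wordDeg, genSimplex, hab.dim_eq]

variable (n) in
/-- The linear map on the path algebra which sends a word to the chain of a closed necklace with
first bead `x`. -/
def pathNecklace (x : X.S) : HatPath k X →ₗ[k] Chains k X n :=
  linLift k (freeNecklace k n x) fun _ _ h => freeNecklace_rel k x h

/-- Letter by letter: a nondegenerate simplex is a generator, and a degenerate edge is the constant
edge of a unit generator. Larger degenerate simplices are excluded, as they have bracket 0 and
cannot be recovered. -/
lemma exists_gens {w : List (Z X).S} (hw : ∀ s ∈ w, 0 < s.dim)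
    (hd : ∀ s ∈ w, 2 ≤ s.dim → s.simplex ∉ (Z X).degenerate s.dim) :
    ∃ l : List (HatGen X), l.map genSimplex = w ∧ hatMk k (monomial k l) = wordProd k w := by
  induction w with
  | nil => exact ⟨[], rfl, map_one _⟩
  | cons s w ih =>
    obtain ⟨l, hl, hl'⟩ := ih (fun t ht => hw t (by simp [ht])) (fun t ht => hd t (by simp [ht]))
    have hs := hw s (by simp)
    have hg : ∃ g : HatGen X, genSimplex g = s ∧ hatGen k g = bracket k s := by
      by_cases h : s.simplex ∈ (Z X).degenerate s.dim
      · have h1 : s.dim = 1 := by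
          by_contra hne
          exact hd s (by simp) (by omega) h
        exact ⟨HatGen.unit (minV s), (eq_unitEdge_of_degenerate h h1).symm,
          (bracket_of_degenerate_edge k h h1).symm⟩
      · exact ⟨HatGen.bead s h hs, rfl, (bracket_of_nonDegenerate k h hs).symm⟩
    obtain ⟨g, hg, hg'⟩ := hg
    refine ⟨g :: l, by rw [List.map_cons, hg, hl], ?_⟩
    rw [wordProd_cons, ← hl', ← hg', hatGen, ← map_mul, monomial, List.map_cons, List.prod_cons,
      monomial]

lemma pathNecklace_wordProd (r : ClosedNecklace X n) (hr : ¬ r.IsDegenerate) :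
    pathNecklace k n r.first (wordProd k r.word) = cls k r := by
  obtain ⟨l, hl, hl'⟩ := exists_gens k (w := r.word) (fun s hs => r.path.pos hs)
    (fun s hs h2 h => hr (Or.inr ⟨s, hs, h2, h⟩))
  rw [← hl', pathNecklace, linLift_hatMk, freeNecklace, monomialLift_monomial, genWord, hl]
  -- The constant edge added in front is deleted, which is allowed because the word of a necklace is
  -- nonempty.
  refine (necklaceChain_unit k r.first [] (inclV (maxV r.first)) r.word r.word_ne ?_).trans
    (necklaceChain_eq k r)
  simp [IsPath]

variable (X n)

/-- The inverse of the comparison map, extended by zero. -/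
def ofHoch : SChains k X ⊗[k] HatPath k X →ₗ[k] Chains k X n :=
  TensorProduct.lift ((sBasis k).constr k fun x : X.N => pathNecklace k n x.toS)

variable {X n}

lemma ofHoch_toHoch (c : Chains k X n) : ofHoch k X n (toHoch k X n c) = c := by
  refine LinearMap.congr_fun (f := ofHoch k X n ∘ₗ toHoch k X n) (g := LinearMap.id)
    (chains_hom_ext k fun r => ?_) c
  rw [LinearMap.comp_apply, toHoch_cls, LinearMap.id_apply]
  by_cases hr : r.IsDegenerate
  · rw [hochElt_of_isDegenerate k hr, map_zero, cls_of_isDegenerate k hr]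
  · have hx : r.first.simplex ∈ X.nonDegenerate r.first.dim := fun h => hr (Or.inl h)
    have hc : chain k r.first = sBasis k (SSet.N.mk' r.first hx) := dif_pos hx
    rw [hochElt, hc, ofHoch, TensorProduct.lift.tmul, Module.Basis.constr_basis,
      pathNecklace_wordProd k r hr]

lemma toHoch_injective : Function.Injective (toHoch k X n) :=
  Function.LeftInverse.injective (ofHoch_toHoch k)

/-- The faces need not vanish individually; their sum does because its image is the differential of
0 and `toHoch` is injective. -/
lemma faceSum_of_isDegenerate {r : ClosedNecklace X (n + 1)} (h : r.IsDegenerate) :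
    faceSum k r = 0 := by
  apply toHoch_injective k
  rw [toHoch_faceSum, hochElt_of_isDegenerate k h, map_zero, map_zero]

lemma chainsD_cls_eq_faceSum (r : ClosedNecklace X (n + 1)) :
    chainsD k X n (cls k r) = faceSum k r := by
  rw [chainsD_cls]
  by_cases h : r.IsDegenerate
  · rw [repBoundary, if_pos h, faceSum_of_isDegenerate k h]
  · rw [repBoundary, if_neg h]

lemma toHoch_chainsD (c : Chains k X (n + 1)) :
    toHoch k X n (chainsD k X n c) = hatCoHochD k (toHoch k X (n + 1) c) := by
  refine LinearMap.congr_fun (f := toHoch k X n ∘ₗ chainsD k X n)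
    (g := hatCoHochD k ∘ₗ toHoch k X (n + 1)) (chains_hom_ext k fun r => ?_) c
  rw [LinearMap.comp_apply, LinearMap.comp_apply, chainsD_cls_eq_faceSum, toHoch_faceSum, toHoch_cls]

lemma hatCoHochD_hatCoHochD_toHoch (c : Chains k X n) :
    hatCoHochD k (hatCoHochD k (toHoch k X n c)) = 0 := by
  refine LinearMap.congr_fun (f := hatCoHochD k ∘ₗ hatCoHochD k ∘ₗ toHoch k X n)
    (g := 0) (chains_hom_ext k fun r => ?_) c
  rw [LinearMap.comp_apply, LinearMap.comp_apply, toHoch_cls, hochElt,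
    hatCoHochD_tmul (closes_wordProd k r), hochFormula_hochFormula (closes_wordProd k r),
    LinearMap.zero_apply]

lemma hatCoHochD_toHoch_zero (c : Chains k X 0) : hatCoHochD k (toHoch k X 0 c) = 0 := by
  refine LinearMap.congr_fun (f := hatCoHochD k ∘ₗ toHoch k X 0)
    (g := 0) (chains_hom_ext k fun r => ?_) c
  have h := r.deg_eq
  have hp : r.first.dim = 0 := by omega
  have hq : wordDeg r.word = 0 := by omega
  rw [LinearMap.comp_apply, toHoch_cls, hochElt, hatCoHochD_tmul (closes_wordProd k r), hochFormula,
    cobarD_wordProd k fun s hs => r.path.pos hs, hp, hq]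
  simp

/-- A summand of `hatCoHoch` is spanned by tensors of a simplex with a product along a word, and
each such pair is a closed necklace. -/
lemma range_toHoch : LinearMap.range (toHoch k X n) = hatCoHoch k X n := by
  apply le_antisymm
  · rintro _ ⟨c, rfl⟩
    have : (hatCoHoch k X n).mkQ ∘ₗ toHoch k X n = 0 := by
      refine chains_hom_ext k fun r => ?_
      rw [LinearMap.comp_apply, toHoch_cls, LinearMap.zero_apply, Submodule.mkQ_apply,
        Submodule.Quotient.mk_eq_zero]
      have hmem : hochElt k r ∈ LinearMap.range (TensorProduct.mapIncl
          (chainsFromTo k (minV r.first) (maxV r.first) r.first.dim)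
          (hatCobar k (inclV (maxV r.first)) (inclV (minV r.first)) (wordDeg r.word))) :=
        ⟨(⟨chain k r.first, Submodule.subset_span ⟨r.first, rfl, rfl, rfl, rfl⟩⟩ :
          chainsFromTo k _ _ _) ⊗ₜ[k] (⟨wordProd k r.word,
            Submodule.subset_span ⟨r.word, r.word_ne, r.path, rfl, rfl⟩⟩ : hatCobar k _ _ _), rfl⟩
      rw [hatCoHoch]
      exact Submodule.mem_iSup_of_mem _ (Submodule.mem_iSup_of_mem _ (Submodule.mem_iSup_of_mem
        r.deg_eq (Submodule.mem_iSup_of_mem _ (Submodule.mem_iSup_of_mem _ hmem))))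
    have := LinearMap.congr_fun this c
    rwa [LinearMap.comp_apply, LinearMap.zero_apply, Submodule.mkQ_apply,
      Submodule.Quotient.mk_eq_zero] at this
  · rw [hatCoHoch]
    refine iSup_le fun p => iSup_le fun q => iSup_le fun hpq => iSup_le fun a => iSup_le fun b => ?_
    have key : ∀ s : X.S, minV s = a → maxV s = b → s.dim = p → ∀ w : List (Z X).S, w ≠ [] →
        IsPath (inclV b) w (inclV a) → wordDeg w = q →
          chain k s ⊗ₜ[k] wordProd k w ∈ LinearMap.range (toHoch k X n) := by
      rintro s rfl rfl rfl w hw hpath rfl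
      exact ⟨cls k ⟨s, w, hw, hpath, hpq⟩, toHoch_cls k _⟩
    rw [TensorProduct.range_mapIncl, chainsFromTo, hatCobar, Submodule.map₂_span_span,
      Submodule.span_le]
    rintro _ ⟨y, ⟨s, h1, h2, h3, rfl⟩, z, ⟨w, hw, h4, h5, rfl⟩, rfl⟩
    exact key s h1 h2 h3 w hw h4 h5

end Inverse

end HatNecklical

end

/-! ### The comparison theorem. -/

theorem mainTheorem3 (k : Type v) [CommRing k] (X : SSet.{u}) :
    (∀ (n : ℕ) (r : ClosedNecklace X (n + 1)), chainsD k X n (cls k r) = faceSum k r) ∧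
    (∀ (n : ℕ) (c : Chains k X (n + 2)), chainsD k X n (chainsD k X (n + 1) c) = 0) ∧
    (∀ (n : ℕ), ∀ z ∈ hatCoHoch k X (n + 1), hatCoHochD k z ∈ hatCoHoch k X n) ∧
    (∀ z ∈ hatCoHoch k X 0, hatCoHochD k z = 0) ∧
    (∀ (n : ℕ), ∀ z ∈ hatCoHoch k X n, hatCoHochD k (hatCoHochD k z) = 0) ∧
    ∃ e : ∀ n : ℕ, Chains k X n ≃ₗ[k] hatCoHoch k X n,
      (∀ (n : ℕ) (r : ClosedNecklace X n),
        (e n (cls k r) : SChains k X ⊗[k] HatPath k X) =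
          chain k r.first ⊗ₜ[k] (r.word.map (bracket k)).prod) ∧
      (∀ (n : ℕ) (c : Chains k X (n + 1)),
        (e n (chainsD k X n c) : SChains k X ⊗[k] HatPath k X) = hatCoHochD k (e (n + 1) c)) := by
  have hsurj : ∀ n, ∀ z ∈ hatCoHoch k X n, ∃ c, toHoch k X n c = z := fun n z hz => by
    rwa [← range_toHoch] at hz
  refine ⟨fun n r => chainsD_cls_eq_faceSum k r, fun n c => ?_, fun n z hz => ?_, fun z hz => ?_,
    fun n z hz => ?_, fun n => (LinearEquiv.ofInjective _ (toHoch_injective k)).trans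
      (LinearEquiv.ofEq _ _ (range_toHoch k)), fun n r => toHoch_cls k r,
    fun n c => toHoch_chainsD k c⟩
  -- That the differential of necklaces squares to zero is read off in the hat-coHochschild complex.
  · apply toHoch_injective k
    rw [toHoch_chainsD, toHoch_chainsD, hatCoHochD_hatCoHochD_toHoch, map_zero]
  · obtain ⟨c, rfl⟩ := hsurj _ z hz
    rw [← toHoch_chainsD, ← range_toHoch]
    exact ⟨_, rfl⟩
  · obtain ⟨c, rfl⟩ := hsurj _ z hz
    exact hatCoHochD_toHoch_zero k c
  · obtain ⟨c, rfl⟩ := hsurj _ z hz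
    exact hatCoHochD_hatCoHochD_toHoch k c
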